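/- Let $n\ge 1$ and let $N$ be the single nilpotent $n\times n$ Jordan block over $\mathbb R$ ($Ne_1=0$, $Ne_{j+1}=e_j$), $M=N^{t}$. For $d\ge 1$ let $P_d$ be the homogeneous polynomials of degree $d$ in $x_1,\dots,x_n$ and $P_d\otimes\mathbb R^n$ the homogeneous polynomial maps of degree $d$. For a matrix $A$ put $(S_A\varphi)(x)=\varphi(Ax)$, $(M_A\varphi)(x)=A\varphi(x)$, $\Delta_A=M_A-S_A$. For a pair $(X,Y)$ of operators put $\overline Y=\sum_{i=1}^{n-1}\sum_{l=0}^{i-1}X^lY^iX^{i-l-1}$ and $\overline H=\sum_{i=1}^{n-1}[Y^i,X^i]$; applied to $(N,M)$ this gives $\overline M,\overline H$, applied to $(S_N,S_M)$ it gives $S_{\overline M},S_{\overline H}$ (this is the meaning of these two symbols). Put $\Delta_{\overline M}=M_{\overline M}-S_{\overline M}$ and $\Delta^{+}_{\overline H}=M_{\overline H}+S_{\overline H}$. A monomial is of type $|k,l|$ if $k$ and $l$ are the lowest and the highest index of a variable occurring in it; $|K\rangle=e_K$. For a combination $w$ of monomials of type $|1,n-k+1|$ ($1\le k\le n$) and $0\le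 p\le k-1$ put $$\Join_p w=\sum_{i+j=p}\binom pi\frac{S_N^jw}{j!\binom{k-1}{j}}\otimes\frac{N^ie_n}{i!\binom{n-1}{i}}=\sum_{i+j=p}\frac{1}{i!\,j!}\frac{\binom pi}{\binom{n-1}{i}\binom{k-1}{j}}\,S_N^jw\otimes|n-i\rangle .$$ Then, for every $d\ge1$: 1. $(S_{\overline M},S_{\overline H},S_N)$ on $P_d$, $(\overline M,\overline H,N)$ on $\mathbb R^n$ and $(\Delta_{\overline M},\Delta^+_{\overline H},\Delta_N)$ on $P_d\otimes\mathbb R^n$ satisfy $[e,f]=h$, $[h,f]=-2f$, $[h,e]=2e$. On a monomial of type $|k,l|$, $S_N^j$ raises all indices by $j$ (result $0$ if $l+j>n$) and $S_M^j$ lowers all indices by $j$ (result $0$ if $j\ge k$). 2. $\ker S_M=\ker S_{\overline M}$ is the direct sum over $k=1,\dots,n$ of the spans of the monomials of type $|1,k|$, and $S_{\overline H}$ acts on the $k$-th summand as $n-k$. 3. $\mathbb R^n$ is the irreducible representation $V_{n-1}$ of dimension $n$. Each monomial $w$ of type $|1,n-k+1|$ generates under $S_N$ a copy $V_{k-1}(w)$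 of the irreducible $k$-dimensional representation; $P_d$ is the direct sum of all $V_{k-1}(w)$ and $P_d\otimes\mathbb R^n$ is the direct sum of all $V_{k-1}(w)\otimes V_{n-1}$, $1\le k\le n$. Moreover $V_{k-1}(w)\otimes V_{n-1}=\bigoplus_{p=0}^{k-1}V_{n+k-2-2p}$, where the $p$-th summand is irreducible of dimension $n+k-1-2p$ and is generated under $\Delta_N$ by $\Join_pw$; and $P_d\otimes\mathbb R^n$ is the direct sum of all these irreducible summands. 4. $\Join_pw\in\ker\Delta_{\overline M}$ has $\Delta^+_{\overline H}$-eigenvalue $n+k-2-2p$, and the $\Join_pw$ ($w$ a degree-$d$ monomial of type $|1,n-k+1|$, $1\le k\le n$, $0\le p\le k-1$) form a basis of $\ker\Delta_{\overline M}$. 5. $P_d\otimes\mathbb R^n=\ker\Delta_{\overline M}\oplus\operatorname{im}\Delta_N=\ker M_M\oplus\operatorname{im}M_N=\ker M_M\oplus\operatorname{im}\Delta_N$, where $\ker M_M=P_d\otimes\mathbb R e_n$. For $w$ a combination of monomials of type $|1,n-k+1|$, $0\le i\le n-1$, $0\le j\le k-1$, the projection onto $\ker\Delta_{\overline M}$ along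 $\operatorname{im}\Delta_N$ satisfies $$\pi_{\ker\Delta_{\overline M}}\bigl(S_N^jw\otimes|n-i\rangle\bigr)=\frac{(i+j)!\binom{n-1}{i+j}\binom{k-1}{i+j}}{\binom{n+k-(i+j)-1}{i+j}}\Join_{i+j}w$$ (read as $0$ if $i+j>k-1$), and the projection onto $\ker M_M$ along $\operatorname{im}M_N$ satisfies, for $0\le p\le k-1$, $$\pi_{\ker M_M}(\Join_pw)=\frac{(k-1-p)!}{(k-1)!}\,S_N^pw\otimes|n\rangle .$$ The styles $\ker\Delta_{\overline M}$ and $\mathbb R[x]\otimes\ker M$ are equivalent: both are complements of $\operatorname{im}\Delta_N$, $\pi_{\ker M_M}$ maps $\ker\Delta_{\overline M}$ bijectively onto $\ker M_M$, and $\pi_{\ker\Delta_{\overline M}}$ maps $\ker M_M$ bijectively onto $\ker\Delta_{\overline M}$. 6. Say that a formal map $f\in\mathbb R[[x]]^n$ with $f(0)=0$ and linear part $Nx$ is in normal form with style $\mathcal C$ if, for every $d\ge2$, $\mathcal C_d$ is a complement of $\operatorname{im}\Delta_N$ in $P_d\otimes\mathbb R^n$ and contains the degree-$d$ part of $f$.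 Put $|a,b|_F=x_ax_bF(x_a,\dots,x_b)$ for $a<b$ and $|a,a|_F=x_aF(x_a)$. Then $f$ is in normal form with style $\ker\Delta_{\overline M}$ if and only if there are unique power series $F^p_{n-k+1}$ in $n-k+1$ variables ($1\le k\le n$, $0\le p\le k-1$) with $F^p_1(0)=0$ and $$f(x)=Nx+\sum_{k=1}^n\sum_{p=0}^{k-1}\sum_{i+j=p}\frac1{i!\,j!}\frac{\binom pi}{\binom{n-1}i\binom{k-1}j}\,|j+1,\,n-k+j+1|_{F^p_{n-k+1}}\;e_{n-i},$$ and in normal form with style $\ker M_M$ if and only if $f(x)=Nx+g(x)e_n$ for a unique power series $g$ without constant and linear terms. 7. For $n=2$, $f$ is in normal form with style $\ker\Delta_{\overline M}$ if and only if there are unique power series with $F_1^0(0)=F_1^1(0)=0$ and $$f=\begin{pmatrix}x_2\\0\end{pmatrix}+\begin{pmatrix}0\\x_1x_2F_2^0(x_1,x_2)\end{pmatrix}+\begin{pmatrix}0\\x_1F_1^0(x_1)\end{pmatrix}+\begin{pmatrix}x_1F_1^1(x_1)\\x_2F_1^1(x_2)\end{pmatrix};$$ equivalently, the second and third terms may be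 replaced by $(0,\,x_1q(x_1,x_2))^t$ with $q(0)=0$ (again uniquely). 8. For $n=3$, $f$ is in normal form with style $\ker\Delta_{\overline M}$ if and only if there are unique power series with $F_1^0(0)=F_1^1(0)=F_1^2(0)=0$ and $$f=\begin{pmatrix}x_2\\x_3\\0\end{pmatrix}+\begin{pmatrix}0\\0\\x_1x_3F_3^0(x_1,x_2,x_3)\end{pmatrix}+\begin{pmatrix}0\\0\\x_1x_2F_2^0(x_1,x_2)\end{pmatrix}+\begin{pmatrix}0\\0\\x_1F_1^0(x_1)\end{pmatrix}+\begin{pmatrix}0\\\tfrac12x_1x_2F_2^1(x_1,x_2)\\x_2x_3F_2^1(x_2,x_3)\end{pmatrix}+\begin{pmatrix}0\\x_1F_1^1(x_1)\\x_2F_1^1(x_2)\end{pmatrix}+\begin{pmatrix}x_1F_1^2(x_1)\\x_2F_1^2(x_2)\\x_3F_1^2(x_3)\end{pmatrix}.$$ -/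

import Mathlib

open scoped Nat

noncomputable section

namespace NilMap

/-! ### The Jordan block, the bar construction and abstract `sl₂`-notions -/

/-- The single `n × n` nilpotent Jordan block `N` (ones on the superdiagonal):
`N e₁ = 0`, `N e_{j+1} = e_j`. -/
def jordanN (n : ℕ) : Matrix (Fin n) (Fin n) ℝ :=
  Matrix.of fun i j => if (i : ℕ) + 1 = (j : ℕ) then 1 else 0

/-- The transpose `M` of the Jordan block. -/
def jordanM (n : ℕ) : Matrix (Fin n) (Fin n) ℝ := (jordanN n).transpose

/-- `∑_{i=1}^{p-1} ∑_{l=0}^{i-1} x^l y^i x^{i-l-1}`. -/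
def barM {R : Type*} [Ring R] (p : ℕ) (x y : R) : R :=
  ∑ i ∈ Finset.Icc 1 (p - 1), ∑ l ∈ Finset.range i, x ^ l * y ^ i * x ^ (i - l - 1)

/-- `∑_{i=1}^{p-1} [y^i, x^i]`. -/
def barH {R : Type*} [Ring R] (p : ℕ) (x y : R) : R :=
  ∑ i ∈ Finset.Icc 1 (p - 1), ⁅y ^ i, x ^ i⁆

/-- The relations `[e, f] = h`, `[h, f] = -2 f`, `[h, e] = 2 e` (the case `e = h = f = 0` is
allowed, which is what happens for `n = 1`). -/
def Sl2Relations {R : Type*} [Ring R] (e h f : R) : Prop :=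
  ⁅e, f⁆ = h ∧ ⁅h, f⁆ = -(2 • f) ∧ ⁅h, e⁆ = 2 • e

section Abstract

variable {V : Type*} [AddCommGroup V] [Module ℝ V]

/-- `U` is stable under `e`, `h`, `f`. -/
def IsStable (e h f : Module.End ℝ V) (U : Submodule ℝ V) : Prop :=
  ∀ u ∈ U, e u ∈ U ∧ h u ∈ U ∧ f u ∈ U

/-- `U` is a copy of `V_l`, the irreducible `(l+1)`-dimensional representation of `sl₂`,
for the action of the triple `e, h, f`. -/
def IsSl2Irrep (e h f : Module.End ℝ V) (l : ℕ) (U : Submodule ℝ V) : Prop :=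
  IsStable e h f U ∧ Module.finrank ℝ U = l + 1 ∧
    ∀ W ≤ U, IsStable e h f W → W = ⊥ ∨ W = U

/-- `U` is the internal direct sum of the family `A`. -/
def IsDirectSum {ι : Type*} (A : ι → Submodule ℝ V) (U : Submodule ℝ V) : Prop :=
  iSupIndep A ∧ iSup A = U

/-- The span of the orbit `w, f w, f² w, …`. -/
def orbit (f : Module.End ℝ V) (w : V) : Submodule ℝ V :=
  Submodule.span ℝ (Set.range fun q : ℕ => (f ^ q) w)

/-- `w^{(j)} = (1/j!) f^j w`. -/
def divPow (f : Module.End ℝ V) (j : ℕ) (w : V) : V := ((j ! : ℝ))⁻¹ • (f ^ j) w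

end Abstract

/-! ### Homogeneous polynomial maps and the homological operator -/

/-- Homogeneous polynomials of degree `d` in `n` variables. -/
abbrev P (n d : ℕ) : Type := MvPolynomial.homogeneousSubmodule (Fin n) ℝ d

/-- Homogeneous polynomial maps `ℝⁿ → ℝⁿ` of degree `d`, that is `P n d ⊗ ℝⁿ`, given by their
component functions. -/
abbrev VP (n d : ℕ) : Type := Fin n → P n d

/-- The `i`-th component of `x ↦ A x` as a polynomial. -/
def linForm {n : ℕ} (A : Matrix (Fin n) (Fin n) ℝ) (i : Fin n) : MvPolynomial (Fin n) ℝ :=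
  ∑ j, MvPolynomial.C (A i j) * MvPolynomial.X j

theorem linForm_isHomogeneous {n : ℕ} (A : Matrix (Fin n) (Fin n) ℝ) (i : Fin n) :
    (linForm A i).IsHomogeneous 1 := by
  refine MvPolynomial.IsHomogeneous.sum _ _ _ fun j _ => ?_
  simpa using (MvPolynomial.isHomogeneous_C (Fin n) (A i j)).mul
    (MvPolynomial.isHomogeneous_X ℝ j)

/-- The substitution operator `S_A`: `(S_A u)(x) = u(A x)`. -/
def subs {n : ℕ} (A : Matrix (Fin n) (Fin n) ℝ) (d : ℕ) : Module.End ℝ (P n d) :=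
  (MvPolynomial.aeval (linForm A)).toLinearMap.restrict (by
    intro u hu
    have h := MvPolynomial.IsHomogeneous.aeval hu (linForm A) (linForm_isHomogeneous A)
    simpa using h)

/-- The multiplication operator `M_A`: `(M_A u)(x) = A (u x)`, that is `1 ⊗ A`. -/
def mult {n : ℕ} (A : Matrix (Fin n) (Fin n) ℝ) (d : ℕ) : Module.End ℝ (VP n d) where
  toFun u := fun i => ∑ j, A i j • u j
  map_add' u v := by
    funext i
    simp [Finset.sum_add_distrib]
  map_smul' c u := by
    funext i
    simp only [Pi.smul_apply, RingHom.id_apply, Finset.smul_sum]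
    exact Finset.sum_congr rfl fun j _ => smul_comm _ _ _

/-- The homological operator `Δ_A = 1 ⊗ A - S_A ⊗ 1`. -/
def homOp {n : ℕ} (A : Matrix (Fin n) (Fin n) ℝ) (d : ℕ) : Module.End ℝ (VP n d) :=
  mult A d - (subs A d).compLeft (Fin n)

variable (n d : ℕ)

/-- `S_N`. -/
def SN : Module.End ℝ (P n d) := subs (jordanN n) d

/-- `S_M`. -/
def SM : Module.End ℝ (P n d) := subs (jordanM n) d

/-- The bar of `S_M` (not the substitution operator of the bar of `M`); the nilpotency index of
the Jordan block is `n`. -/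
def SMbar : Module.End ℝ (P n d) := barM n (SN n d) (SM n d)

/-- The bar of `S_H`. -/
def SHbar : Module.End ℝ (P n d) := barH n (SN n d) (SM n d)

/-- `Δ_N`. -/
def DN : Module.End ℝ (VP n d) := homOp (jordanN n) d

/-- `Δ` of the bar of `M`: the bar of `M` acting on values minus the bar of `S_M`. -/
def DMbar : Module.End ℝ (VP n d) :=
  mult (barM n (jordanN n) (jordanM n)) d - (SMbar n d).compLeft (Fin n)

/-- The sum of the bar of `H` acting on values and the bar of `S_H`. -/
def DHbar : Module.End ℝ (VP n d) :=
  mult (barH n (jordanN n) (jordanM n)) d + (SHbar n d).compLeft (Fin n)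

/-! ### Monomials `|k,l|`, vectors `|K⟩`, transvectants -/

/-- The exponent `s` is of type `|k,l|`: lowest occurring index `k`, highest occurring index `l`.
Indices are counted from `0` here. -/
def IsBra {n : ℕ} (k l : Fin n) (s : Fin n →₀ ℕ) : Prop :=
  0 < s k ∧ 0 < s l ∧ (∀ i < k, s i = 0) ∧ ∀ i > l, s i = 0

/-- The span of the degree-`d` monomials of type `|k,l|`. -/
def braSpan (k l : Fin n) : Submodule ℝ (P n d) :=
  Submodule.span ℝ {u | ∃ s, IsBra k l s ∧ (u : MvPolynomial (Fin n) ℝ) = MvPolynomial.monomial s 1}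

/-- The degree-`d` monomials of type `|1,m+1|` (one-based notation). -/
def Gen [NeZero n] (m : Fin n) : Type := {s : Fin n →₀ ℕ // s.degree = d ∧ IsBra 0 m s}

variable {n d}

/-- The monomial with a given exponent as a homogeneous polynomial. -/
def Gen.poly [NeZero n] {m : Fin n} (g : Gen n d m) : P n d :=
  ⟨MvPolynomial.monomial g.1 1, MvPolynomial.isHomogeneous_monomial 1 g.2.1⟩

/-- Raise all indices in a monomial by `j`. -/
def shiftUp (j : ℕ) (s : Fin n →₀ ℕ) : Fin n →₀ ℕ :=
  Finsupp.equivFunOnFinite.symm fun a =>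
    if j ≤ (a : ℕ) then s ⟨(a : ℕ) - j, (Nat.sub_le _ _).trans_lt a.2⟩ else 0

/-- Lower all indices in a monomial by `j`. -/
def shiftDown (j : ℕ) (s : Fin n →₀ ℕ) : Fin n →₀ ℕ :=
  Finsupp.equivFunOnFinite.symm fun a => if h : (a : ℕ) + j < n then s ⟨(a : ℕ) + j, h⟩ else 0

/-- The pure tensor `w ⊗ v`. -/
def tens (w : P n d) (v : Fin n → ℝ) : VP n d := fun c => v c • w

/-- The standard basis vector `|n-i⟩` (one-based notation). -/
def ket (n i : ℕ) : Fin n → ℝ := fun c => if (c : ℕ) + i + 1 = n then 1 else 0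

/-- The `p`-th transvectant of `w ⊗ v`, where `w`, `v` have weights `a`, `b`:
`∑_{i+j=p} binom(p,i) (w^{(j)} / binom(a,j)) ⊗ (v^{(i)} / binom(b,i))`. -/
def transvectant (a b p : ℕ) (w : P n d) (v : Fin n → ℝ) : VP n d :=
  ∑ ij ∈ Finset.HasAntidiagonal.antidiagonal p,
    ((p.choose ij.1 : ℝ) / ((a.choose ij.2 : ℝ) * (b.choose ij.1 : ℝ))) •
      tens (divPow (SN n d) ij.2 w) (divPow (Matrix.toLin' (jordanN n)) ij.1 v)

/-- The `p`-th transvectant of `|1,m+1| ⊗ |n⟩`: the weights are `n-1-m` and `n-1`. -/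
def transv (m p : ℕ) (w : P n d) : VP n d :=
  transvectant (n - 1 - m) (n - 1) p w (ket n 0)

/-! ### Formal maps and their normal forms -/

/-- The homogeneous part of degree `d` of a power series. -/
def homPart (d : ℕ) (f : MvPowerSeries (Fin n) ℝ) : P n d :=
  ⟨∑ s ∈ Finset.univ.finsuppAntidiag d, MvPolynomial.monomial s (MvPowerSeries.coeff s f), by
    refine Submodule.sum_mem _ fun s hs => MvPolynomial.isHomogeneous_monomial _ ?_
    rw [Finset.mem_finsuppAntidiag] at hs
    rw [Finsupp.degree_eq_sum]
    exact hs.1⟩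

/-- The linear map `x ↦ A x` as a formal map. -/
def linMap (A : Matrix (Fin n) (Fin n) ℝ) : Fin n → MvPowerSeries (Fin n) ℝ :=
  fun i => (linForm A i : MvPowerSeries (Fin n) ℝ)

/-- The formal map `f` has linear part `A` and is in normal form with style `K`: in each degree
`d ≥ 2`, `K d` is a complement of the image of `Δ_A` and contains the degree-`d` part of `f`. -/
structure IsNormalForm (A : Matrix (Fin n) (Fin n) ℝ) (K : ∀ d, Submodule ℝ (VP n d))
    (f : Fin n → MvPowerSeries (Fin n) ℝ) : Prop where
  const : ∀ i, MvPowerSeries.constantCoeff (f i) = 0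
  linear : ∀ i, (homPart 1 (f i) : MvPolynomial (Fin n) ℝ) = linForm A i
  style : ∀ d, 2 ≤ d → IsCompl (LinearMap.range (homOp A d)) (K d)
  mem : ∀ d, 2 ≤ d → (fun i => homPart d (f i)) ∈ K d

/-- The variable with (zero-based) index `t`, and `0` if there is no such variable. -/
def pvar (n t : ℕ) : MvPowerSeries (Fin n) ℝ :=
  if h : t < n then MvPowerSeries.X ⟨t, h⟩ else 0

/-- In one-based notation, `x_{j+1} x_{j+m+1} F(x_{j+1}, …, x_{j+m+1})` if `m > 0` and
`x_{j+1} F(x_{j+1})` if `m = 0`. -/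
def bracket (n j m : ℕ) (F : MvPowerSeries (Fin (m + 1)) ℝ) : MvPowerSeries (Fin n) ℝ :=
  (if m = 0 then pvar n j else pvar n j * pvar n (j + m)) *
    MvPowerSeries.subst (fun b : Fin (m + 1) => pvar n (j + b)) F

/-- The sum of all transvectants, with coefficient functions `F m p`:
`∑_m ∑_p ∑_{i+j=p} (1/(i! j!)) binom(p,i) / (binom(n-1,i) binom(n-1-m,j)) ·
  |j+1, j+m+1| |n-i⟩`. -/
def transvectantSum (n : ℕ)
    (F : ∀ m : Fin n, Fin (n - m) → MvPowerSeries (Fin ((m : ℕ) + 1)) ℝ) :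
    Fin n → MvPowerSeries (Fin n) ℝ :=
  fun c => ∑ m : Fin n, ∑ p : Fin (n - m), ∑ ij ∈ Finset.HasAntidiagonal.antidiagonal (p : ℕ),
    if (c : ℕ) + ij.1 + 1 = n then
      ((1 : ℝ) / ((ij.1)! * (ij.2)!) *
        (((p : ℕ).choose ij.1 : ℝ) / (((n - 1).choose ij.1 : ℝ) * ((n - 1 - m).choose ij.2 : ℝ)))) •
        bracket n ij.2 m (F m p)
    else 0

/-- The style given by the kernel of `Δ` of the bar of `M`. -/
def kerDeltaStyle (n : ℕ) : ∀ d, Submodule ℝ (VP n d) := fun d => LinearMap.ker (DMbar n d)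

/-- The style given by the kernel of `M_M`, that is `ℝ[x] ⊗ ker M`. -/
def kerMultStyle (n : ℕ) : ∀ d, Submodule ℝ (VP n d) :=
  fun d => LinearMap.ker (mult (jordanM n) d)

end NilMap

end

open NilMap
open scoped Nat

/-!
Everything rests on one observation: the substitution operators `S_N` and `S_M` raise and lower the
indices of a monomial, so they act on the monomials `w, S_N w, S_N² w, …` that start from a
monomial `w` of type `|1,m+1|` as the two shifts of a string of length `n - m`, exactly as `N` and
`M` act on `e_n, …, e_1`. On a shift string of length `k ≤ n` the bar construction gives
`e v_j = j (k - j) v_{j-1}` and `h v_j = (k - 1 - 2 j) v_j` (`IsShiftString.barM_apply`,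
`IsShiftString.barH_apply`), which is the standard irreducible representation of `sl₂`. Since every
monomial lies on exactly one string (`exists_shiftUp_eq`, `shiftUp_injective`), the strings form
a basis of `P n d`, indexed by `StringIdx n d`, and the statements about `P n d` and `ℝⁿ` follow.
The triple on `P n d ⊗ ℝⁿ` is a difference of two commuting triples.

The homological operator is controlled by two linear maps from `P n d ⊗ ℝⁿ` to `P n d`:

* `reduce` sends `w ⊗ N^i e_n` to `S_N^i w`, and its kernel is the image of `Δ_N` (`range_DN`);
* `lastComp` takes the last component; its kernel is the image of `M_N`, and it is injective on
  `ker Δ_M̄`, because the bar of `M` has nonzero entries exactly below the diagonal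
  (`eq_zero_of_lastComp_eq_zero`).

Both send the transvectant which belongs to an element of the basis of strings to a nonzero
multiple of that element. For `lastComp` the factor is one coefficient of the transvectant, for
`reduce` it is the sum of the coefficients, which a Vandermonde convolution evaluates
(`sum_transvCoeff`). Hence the transvectants form a basis of `ker Δ_M̄`, and all the complements and
projections can be read off. The Clebsch-Gordan decomposition needs no dimension count: the strings
of linearly independent primitive vectors are independent (`linearIndependent_strings`), and they
exhaust `V ⊗ V'` because the transvectants span it modulo the image of the nilpotent operator `Δ_N`
(`le_iSup_orbit`).

For formal maps, `lastComp` reduces the normal form to its last component: a formal map which lies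
in `ker Δ_M̄` in each degree is determined by that component (`eq_of_last_eq`), and an arbitrary
power series without constant term occurs there, with unique coefficient functions, since sorting
monomials by their lowest and highest index writes it uniquely as a sum of series
`x_a x_b F(x_a, …, x_b)` and `x_a F(x_a)` (`coeff_last_transvectantSum`). Dimensions two and three
are special cases, up to a rescaling of the coefficient functions.
-/

noncomputable section

namespace NilMap

/-! ### Shift strings and the bar construction -/

section Abstract

variable {V : Type*} [AddCommGroup V] [Module ℝ V]

/-- A sequence `v 0, …, v (k-1)` (continued by `0`) which `f` shifts upwards and `y` shifts
downwards: a Jordan string of length `k` for `f` whose transpose is `y`. -/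
structure IsShiftString (f y : Module.End ℝ V) (k : ℕ) (v : ℕ → V) : Prop where
  f_apply : ∀ j, f (v j) = v (j + 1)
  eq_zero : ∀ j, k ≤ j → v j = 0
  y_zero : y (v 0) = 0
  y_succ : ∀ j, j + 1 < k → y (v (j + 1)) = v j

namespace IsShiftString

variable {f y : Module.End ℝ V} {k n : ℕ} {v : ℕ → V}

theorem f_pow (hv : IsShiftString f y k v) (i j : ℕ) : (f ^ i) (v j) = v (j + i) := by
  induction i with
  | zero => simp
  | succ i ih => rw [pow_succ', Module.End.mul_apply, ih, hv.f_apply, add_assoc]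

theorem y_pow (hv : IsShiftString f y k v) (i : ℕ) {j : ℕ} (hj : j < k) :
    (y ^ i) (v j) = if i ≤ j then v (j - i) else 0 := by
  induction i with
  | zero => simp
  | succ i ih =>
    rw [pow_succ', Module.End.mul_apply, ih]
    rcases lt_trichotomy i j with h | h | h
    · rw [if_pos h.le, if_pos (by omega)]
      obtain ⟨t, rfl⟩ : ∃ t, j = i + 1 + t := ⟨j - (i + 1), by omega⟩
      rw [show i + 1 + t - i = t + 1 by omega, hv.y_succ _ (by omega)]
      congr 1
      omega
    · subst h
      rw [if_pos le_rfl, if_neg (by omega), Nat.sub_self, hv.y_zero]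
    · rw [if_neg (by omega), if_neg (by omega), map_zero]

theorem barH_apply (hv : IsShiftString f y k v) (hk : k ≤ n) {j : ℕ} (hj : j < k) :
    barH n f y (v j) = ((k : ℝ) - 1 - 2 * j) • v j := by
  have hterm : ∀ i, ⁅y ^ i, f ^ i⁆ (v j) =
      ((if i < k - j then 1 else 0) - (if i < j + 1 then 1 else 0) : ℝ) • v j := by
    intro i
    rw [Ring.lie_def, LinearMap.sub_apply, Module.End.mul_apply, Module.End.mul_apply, hv.f_pow,
      hv.y_pow i hj, sub_smul]
    congr 1
    · by_cases h : i < k - j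
      · rw [hv.y_pow _ (by omega)]
        simp [h]
      · rw [hv.eq_zero _ (by omega)]
        simp [h]
    · by_cases h : i ≤ j
      · rw [if_pos h, if_pos (by omega), hv.f_pow, Nat.sub_add_cancel h, one_smul]
      · rw [if_neg h, if_neg (by omega)]
        simp
  have hcount : ∀ a, 1 ≤ a → a ≤ n →
      ∑ i ∈ Finset.Icc 1 (n - 1), (if i < a then 1 else 0 : ℝ) = (a : ℝ) - 1 := by
    intro a ha han
    rw [Finset.sum_boole, show (Finset.Icc 1 (n - 1)).filter (fun i => i < a) =
      Finset.Ico 1 a by ext; simp; omega, Nat.card_Ico, Nat.cast_sub ha, Nat.cast_one]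
  rw [barH, LinearMap.sum_apply, Finset.sum_congr rfl fun i _ => hterm i, ← Finset.sum_smul,
    Finset.sum_sub_distrib, hcount _ (by omega) (by omega), hcount _ (by omega) (by omega),
    Nat.cast_sub hj.le]
  congr 1
  push_cast
  ring

/-- Both shifts in `x ^ l * y ^ i * x ^ (i - l - 1)` stay inside the string for exactly
`j * (k - j)` pairs `(i, l)`. -/
theorem barM_apply (hv : IsShiftString f y k v) (hk : k ≤ n) {j : ℕ} (hj : j < k) :
    barM n f y (v j) = ((j : ℝ) * ((k : ℝ) - j)) • v (j - 1) := by
  have hterm : ∀ i l, l < i → (f ^ l * y ^ i * f ^ (i - l - 1)) (v j) =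
      (if l < j ∧ i - l - 1 < k - j then 1 else 0 : ℝ) • v (j - 1) := by
    intro i l hl
    rw [Module.End.mul_apply, Module.End.mul_apply, hv.f_pow]
    by_cases h : i - l - 1 < k - j
    · rw [hv.y_pow _ (by omega)]
      by_cases h' : l < j
      · rw [if_pos (by omega), if_pos ⟨h', h⟩, hv.f_pow, one_smul]
        congr 1
        omega
      · rw [if_neg (by omega), if_neg (by omega)]
        simp
    · rw [hv.eq_zero _ (by omega), if_neg (by omega)]
      simp
  have hcount : ∑ i ∈ Finset.Icc 1 (n - 1), ∑ l ∈ Finset.range i,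
      (if l < j ∧ i - l - 1 < k - j then 1 else 0 : ℝ) = (j : ℝ) * ((k : ℝ) - j) := by
    rw [Finset.sum_sigma', Finset.sum_boole, ← Nat.cast_sub hj.le, ← Nat.cast_mul]
    congr 1
    trans (Finset.range j ×ˢ Finset.range (k - j)).card
    · refine Finset.card_nbij' (fun x => (x.2, x.1 - x.2 - 1)) (fun x => ⟨x.1 + x.2 + 1, x.1⟩)
        ?_ ?_ ?_ ?_
      · rintro ⟨i, l⟩ h
        simp at h ⊢
        omega
      · rintro ⟨i, l⟩ h
        simp at h ⊢
        omega
      · rintro ⟨i, l⟩ h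
        simp at h ⊢
        omega
      · rintro ⟨i, l⟩ h
        simp at h ⊢
        omega
    · simp
  rw [barM, LinearMap.sum_apply, ← hcount, Finset.sum_smul]
  refine Finset.sum_congr rfl fun i _ => ?_
  rw [LinearMap.sum_apply, Finset.sum_smul]
  exact Finset.sum_congr rfl fun l hl => hterm i l (Finset.mem_range.1 hl)

end IsShiftString

/-- If shift strings of length at most `n` span, the bar construction gives an `sl₂`-triple. -/
theorem sl2Relations_bar {f y : Module.End ℝ V} {n : ℕ} {s : Set V}
    (hs : Submodule.span ℝ s = ⊤)
    (h : ∀ u ∈ s, ∃ k v j, IsShiftString f y k v ∧ k ≤ n ∧ j < k ∧ v j = u) :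
    Sl2Relations (barM n f y) (barH n f y) f := by
  -- the four values which the bar operators take near a position `j` of a string
  have key : ∀ k v, IsShiftString f y k v → k ≤ n → ∀ j, j < k →
      (barM n f y (v j) = ((j : ℝ) * ((k : ℝ) - j)) • v (j - 1)) ∧
      (barM n f y (v (j + 1)) = (((j : ℝ) + 1) * ((k : ℝ) - 1 - j)) • v j) ∧
      (barH n f y (v j) = ((k : ℝ) - 1 - 2 * j) • v j) ∧
      (barH n f y (v (j + 1)) = ((k : ℝ) - 3 - 2 * j) • v (j + 1)) ∧
      (1 ≤ j → barH n f y (v (j - 1)) = ((k : ℝ) + 1 - 2 * j) • v (j - 1)) := by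
    intro k v hv hk j hj
    refine ⟨hv.barM_apply hk hj, ?_, hv.barH_apply hk hj, ?_, fun h1 => ?_⟩
    · rcases Nat.lt_or_ge (j + 1) k with h' | h'
      · rw [hv.barM_apply hk h']
        push_cast
        congr 1
        ring
      · have : k = j + 1 := by omega
        rw [hv.eq_zero _ h', this]
        simp
    · rcases Nat.lt_or_ge (j + 1) k with h' | h'
      · rw [hv.barH_apply hk h']
        push_cast
        congr 1
        ring
      · rw [hv.eq_zero _ h']
        simp
    · rw [hv.barH_apply hk (by omega), Nat.cast_sub h1]
      congr 1
      push_cast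
      ring
  refine ⟨LinearMap.ext_on hs fun u hu => ?_, LinearMap.ext_on hs fun u hu => ?_,
    LinearMap.ext_on hs fun u hu => ?_⟩ <;>
  · obtain ⟨k, v, j, hv, hk, hj, rfl⟩ := h u hu
    obtain ⟨h1, h2, h3, h4, h5⟩ := key k v hv hk j hj
    simp only [Ring.lie_def, LinearMap.sub_apply, Module.End.mul_apply, LinearMap.neg_apply,
      h1, h3, map_smul, hv.f_apply, h2, h4, two_smul, LinearMap.add_apply]
    rcases Nat.eq_zero_or_pos j with rfl | hj0
    · simp
      try module
    · try rw [h5 hj0]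
      try rw [Nat.sub_add_cancel hj0]
      module

/-! ### Primitive vectors and irreducible representations of `sl₂` -/

section Primitive

variable {e h f : Module.End ℝ V} {l : ℕ} {u : V}

theorem h_pow_apply (H : Sl2Relations e h f) (hh : h u = (l : ℝ) • u) (q : ℕ) :
    h ((f ^ q) u) = ((l : ℝ) - 2 * q) • (f ^ q) u := by
  induction q with
  | zero => simpa using hh
  | succ q ih =>
    have := LinearMap.congr_fun H.2.1 ((f ^ q) u)
    simp only [Ring.lie_def, LinearMap.sub_apply, Module.End.mul_apply, LinearMap.neg_apply,
      LinearMap.smul_apply, ih, map_smul] at this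
    rw [pow_succ', Module.End.mul_apply, sub_eq_iff_eq_add.1 this]
    push_cast
    module

theorem e_pow_succ_apply (H : Sl2Relations e h f) (he : e u = 0) (hh : h u = (l : ℝ) • u)
    (q : ℕ) :
    e ((f ^ (q + 1)) u) = (((q : ℝ) + 1) * ((l : ℝ) - q)) • (f ^ q) u := by
  have key : ∀ x, e (f x) = h x + f (e x) := fun x => by
    have := LinearMap.congr_fun H.1 x
    simp only [Ring.lie_def, LinearMap.sub_apply, Module.End.mul_apply] at this
    exact sub_eq_iff_eq_add.1 this
  rw [pow_succ', Module.End.mul_apply, key, h_pow_apply H hh]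
  induction q with
  | zero => simp [he]
  | succ q ih =>
    rw [pow_succ', Module.End.mul_apply, key, h_pow_apply H hh, ih, map_smul]
    push_cast
    module

/-- A nilpotent lowering operator forces the string of a primitive vector of weight `l` to have
length `l + 1`. -/
theorem pow_weight_succ_eq_zero (H : Sl2Relations e h f) (hf : IsNilpotent f) (he : e u = 0)
    (hh : h u = (l : ℝ) • u) {q : ℕ} (hq : l < q) : (f ^ q) u = 0 := by
  classical
  suffices h0 : (f ^ (l + 1)) u = 0 by
    obtain ⟨t, rfl⟩ : ∃ t, q = t + (l + 1) := ⟨q - (l + 1), by omega⟩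
    rw [pow_add, Module.End.mul_apply, h0, map_zero]
  by_contra hne
  have hstep : ∀ q, (f ^ (l + 1 + q)) u ≠ 0 := by
    intro q
    induction q with
    | zero => exact hne
    | succ q ih =>
      intro hz
      have := e_pow_succ_apply H he hh (l + 1 + q)
      rw [show l + 1 + q + 1 = l + 1 + (q + 1) by ring, hz, map_zero] at this
      refine ih ((smul_eq_zero.1 this.symm).resolve_left (mul_ne_zero (by positivity) ?_))
      push_cast
      intro hc
      have : (0 : ℝ) ≤ q := by positivity
      linarith
  obtain ⟨t, ht⟩ := hf
  apply hstep t
  rw [pow_add, ht, mul_zero, LinearMap.zero_apply]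

theorem exists_e_pow_apply (H : Sl2Relations e h f) (he : e u = 0) (hh : h u = (l : ℝ) • u)
    {q : ℕ} (hq : q ≤ l) : ∃ c : ℝ, c ≠ 0 ∧ (e ^ q) ((f ^ q) u) = c • u := by
  induction q with
  | zero => exact ⟨1, one_ne_zero, by simp⟩
  | succ q ih =>
    obtain ⟨c, hc, h'⟩ := ih (by omega)
    refine ⟨((q : ℝ) + 1) * ((l : ℝ) - q) * c, mul_ne_zero (mul_ne_zero (by positivity) ?_) hc,
      ?_⟩
    · have : (q : ℝ) + 1 ≤ l := by exact_mod_cast hq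
      linarith
    · rw [pow_succ, Module.End.mul_apply, e_pow_succ_apply H he hh, map_smul, h', smul_smul]

theorem e_pow_apply_of_lt (H : Sl2Relations e h f) (he : e u = 0) (hh : h u = (l : ℝ) • u)
    {q r : ℕ} (hqr : q < r) : (e ^ r) ((f ^ q) u) = 0 := by
  induction q generalizing r with
  | zero =>
    obtain ⟨t, rfl⟩ : ∃ t, r = t + 1 := ⟨r - 1, by omega⟩
    simp [pow_succ, he]
  | succ q ih =>
    obtain ⟨t, rfl⟩ : ∃ t, r = t + 1 := ⟨r - 1, by omega⟩
    rw [pow_succ, Module.End.mul_apply, e_pow_succ_apply H he hh, map_smul, ih (by omega),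
      smul_zero]

theorem mem_orbit_self (f : Module.End ℝ V) (u : V) : u ∈ orbit f u :=
  Submodule.subset_span ⟨0, by simp⟩

theorem map_mem_orbit (f : Module.End ℝ V) (u : V) {x : V} (hx : x ∈ orbit f u) :
    f x ∈ orbit f u := by
  induction hx using Submodule.span_induction with
  | mem x hx =>
    obtain ⟨q, rfl⟩ := hx
    exact Submodule.subset_span ⟨q + 1, by simp [pow_succ']⟩
  | zero => simp
  | add x y _ _ hx hy => simpa using add_mem hx hy
  | smul a x _ hx => simpa using Submodule.smul_mem _ a hx

theorem orbit_le {f : Module.End ℝ V} {u : V} {W : Submodule ℝ V} (hu : u ∈ W)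
    (hW : ∀ x ∈ W, f x ∈ W) : orbit f u ≤ W := by
  refine Submodule.span_le.2 ?_
  rintro _ ⟨q, rfl⟩
  induction q with
  | zero => simpa using hu
  | succ q ih => simpa [pow_succ'] using hW _ ih

theorem orbit_eq_span (H : Sl2Relations e h f) (hf : IsNilpotent f) (he : e u = 0)
    (hh : h u = (l : ℝ) • u) :
    orbit f u = Submodule.span ℝ (Set.range fun q : Fin (l + 1) => (f ^ (q : ℕ)) u) := by
  refine le_antisymm (Submodule.span_le.2 ?_) (Submodule.span_mono ?_)
  · rintro _ ⟨q, rfl⟩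
    by_cases hq : l < q
    · simp [pow_weight_succ_eq_zero H hf he hh hq]
    · exact Submodule.subset_span ⟨⟨q, by omega⟩, rfl⟩
  · rintro _ ⟨q, rfl⟩
    exact ⟨q, rfl⟩

theorem isStable_orbit (H : Sl2Relations e h f) (he : e u = 0) (hh : h u = (l : ℝ) • u) :
    IsStable e h f (orbit f u) := by
  intro x hx
  refine ⟨?_, ?_, map_mem_orbit f u hx⟩
  · induction hx using Submodule.span_induction with
    | mem x hx =>
      obtain ⟨q, rfl⟩ := hx
      rcases q with _ | q
      · simp [he]
      · simp only [e_pow_succ_apply H he hh]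
        exact Submodule.smul_mem _ _ (Submodule.subset_span ⟨q, rfl⟩)
    | zero => simp
    | add x y _ _ hx hy => simpa using add_mem hx hy
    | smul a x _ hx => simpa using Submodule.smul_mem _ a hx
  · induction hx using Submodule.span_induction with
    | mem x hx =>
      obtain ⟨q, rfl⟩ := hx
      simp only [h_pow_apply H hh]
      exact Submodule.smul_mem _ _ (Submodule.subset_span ⟨q, rfl⟩)
    | zero => simp
    | add x y _ _ hx hy => simpa using add_mem hx hy
    | smul a x _ hx => simpa using Submodule.smul_mem _ a hx

/-- The strings of linearly independent primitive vectors are linearly independent: to a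
nontrivial relation apply `e ^ Q`, where `Q` is the largest power of `f` which occurs, to get a
nontrivial relation between the primitive vectors. -/
theorem linearIndependent_strings {ι : Type*} {u : ι → V} {l : ι → ℕ} (H : Sl2Relations e h f)
    (he : ∀ x, e (u x) = 0) (hh : ∀ x, h (u x) = (l x : ℝ) • u x)
    (hu : LinearIndependent ℝ u) :
    LinearIndependent ℝ fun σ : Σ x, Fin (l x + 1) => (f ^ (σ.2 : ℕ)) (u σ.1) := by
  classical
  rw [linearIndependent_iff']
  intro s g hg
  by_contra! hcon
  obtain ⟨σ₁, hσ₁, hg₁⟩ := hcon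
  obtain ⟨σ₀, hσ₀, hmax⟩ := (s.filter fun σ => g σ ≠ 0).exists_max_image (fun σ => (σ.2 : ℕ))
    ⟨σ₁, by simp [hσ₁, hg₁]⟩
  rw [Finset.mem_filter] at hσ₀
  set Q : ℕ := σ₀.2.val with hQ
  choose c hc hcu using fun σ : {σ : Σ x, Fin (l x + 1) // (σ.2 : ℕ) = Q} =>
    exists_e_pow_apply H (he σ.1.1) (hh σ.1.1) (q := Q)
      (by have h1 := σ.1.2.2; have h2 := σ.2; omega)
  have hinj : Function.Injective
      fun σ : {σ : Σ x, Fin (l x + 1) // (σ.2 : ℕ) = Q} => σ.1.1 := by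
    rintro ⟨⟨x, q⟩, hq⟩ ⟨⟨y, r⟩, hr⟩ (rfl : x = y)
    have : q = r := Fin.ext (hq.trans hr.symm)
    subst this
    rfl
  have hrel : ∑ σ ∈ s.subtype (fun σ => (σ.2 : ℕ) = Q), (g σ.1 * c σ) • u σ.1.1 = 0 := by
    have h1 := congrArg (e ^ Q) hg
    rw [map_zero, map_sum, ← Finset.sum_filter_add_sum_filter_not s (fun σ => (σ.2 : ℕ) = Q),
      Finset.sum_eq_zero (s := s.filter fun σ => ¬ (σ.2 : ℕ) = Q), add_zero] at h1
    · rw [← h1, ← Finset.subtype_map, Finset.sum_map]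
      refine Finset.sum_congr rfl fun σ _ => ?_
      have h2 := hcu σ
      have h3 := σ.2
      simp only [Function.Embedding.subtype_apply, map_smul, h3, h2, smul_smul]
    · intro σ hσ
      rw [Finset.mem_filter] at hσ
      rw [map_smul]
      by_cases hgσ : g σ = 0
      · rw [hgσ, zero_smul]
      · have := hmax σ (by simp [hσ.1, hgσ])
        rw [e_pow_apply_of_lt H (he _) (hh _) (by omega), smul_zero]
  have := linearIndependent_iff'.1 (hu.comp _ hinj) _ _ hrel ⟨σ₀, rfl⟩ (by simpa using hσ₀.1)
  exact mul_ne_zero hσ₀.2 (hc _) this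

theorem iSupIndep_orbit {ι : Type*} {u : ι → V} {l : ι → ℕ} (H : Sl2Relations e h f)
    (hf : IsNilpotent f) (he : ∀ x, e (u x) = 0) (hh : ∀ x, h (u x) = (l x : ℝ) • u x)
    (hu : LinearIndependent ℝ u) : iSupIndep fun x => orbit f (u x) := by
  have hli := linearIndependent_strings H he hh hu
  have horb : ∀ x, orbit f (u x) = Submodule.span ℝ
      ((fun σ : Σ x, Fin (l x + 1) => (f ^ (σ.2 : ℕ)) (u σ.1)) '' {σ | σ.1 = x}) := by
    intro x
    rw [orbit_eq_span H hf (he x) (hh x)]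
    congr 1
    ext v
    constructor
    · rintro ⟨q, rfl⟩
      exact ⟨⟨x, q⟩, rfl, rfl⟩
    · rintro ⟨⟨y, q⟩, rfl, rfl⟩
      exact ⟨q, rfl⟩
  intro x
  simp only [horb, ← Submodule.span_iUnion]
  rw [← Set.image_iUnion₂]
  refine hli.disjoint_span_image (Set.disjoint_left.2 ?_)
  rintro σ rfl hσ
  simp at hσ

theorem isSl2Irrep_orbit (H : Sl2Relations e h f) (hf : IsNilpotent f) (he : e u = 0)
    (hh : h u = (l : ℝ) • u) (hu : u ≠ 0) : IsSl2Irrep e h f l (orbit f u) := by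
  have hspan := orbit_eq_span H hf he hh
  have hli : LinearIndependent ℝ fun q : Fin (l + 1) => (f ^ (q : ℕ)) u :=
    (linearIndependent_strings (ι := Unit) (u := fun _ => u) (l := fun _ => l) H (fun _ => he)
      (fun _ => hh) (linearIndependent_unique_iff.2 hu)).comp
      (fun q => ⟨(), q⟩) fun q r hqr => by simpa using hqr
  refine ⟨isStable_orbit H he hh, ?_, fun W hW hst => ?_⟩
  · rw [hspan, finrank_span_eq_card hli, Fintype.card_fin]
  · by_cases hbot : W = ⊥
    · exact Or.inl hbot
    refine Or.inr (le_antisymm hW (orbit_le ?_ fun x hx => (hst x hx).2.2))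
    obtain ⟨w, hw, hw0⟩ := W.exists_mem_ne_zero_of_ne_bot hbot
    have hw' := hW hw
    rw [hspan, Submodule.mem_span_range_iff_exists_fun] at hw'
    obtain ⟨c, rfl⟩ := hw'
    have hex : (Finset.univ.filter fun q => c q ≠ 0).Nonempty := by
      by_contra hemp
      rw [Finset.not_nonempty_iff_eq_empty, Finset.filter_eq_empty_iff] at hemp
      refine hw0 (Finset.sum_eq_zero fun q hq => ?_)
      rw [not_not.1 (hemp hq), zero_smul]
    obtain ⟨Q, hQ, hmax⟩ := Finset.exists_max_image _ (fun q : Fin (l + 1) => (q : ℕ)) hex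
    have hpow : ∀ (t : ℕ) x, x ∈ W → (e ^ t) x ∈ W := by
      intro t
      induction t with
      | zero => simp
      | succ t ih => exact fun x hx => by simpa [pow_succ] using ih _ (hst x hx).1
    obtain ⟨a, ha, hau⟩ := exists_e_pow_apply H he hh (Nat.lt_succ_iff.1 Q.2)
    have hmem := hpow Q _ hw
    rw [map_sum, Finset.sum_eq_single Q, map_smul, hau, smul_smul] at hmem
    · exact (Submodule.smul_mem_iff _ (mul_ne_zero (by simpa using hQ) ha)).1 hmem
    · intro q _ hq
      rw [map_smul]
      by_cases hc : c q = 0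
      · rw [hc, zero_smul]
      · have h1 := hmax q (by simp [hc])
        have h2 : (q : ℕ) ≠ Q := fun h => hq (Fin.ext h)
        rw [e_pow_apply_of_lt H he hh (by omega), smul_zero]
    · simp

/-- A submodule generated modulo the image of a nilpotent operator is generated under the
operator. -/
theorem le_iSup_orbit {ι : Type*} {u : ι → V} (hf : IsNilpotent f) {T : Submodule ℝ V}
    (hT : T ≤ Submodule.span ℝ (Set.range u) ⊔ T.map f) : T ≤ ⨆ x, orbit f (u x) := by
  set K : Submodule ℝ V := ⨆ x, orbit f (u x) with hK
  have hspan : Submodule.span ℝ (Set.range u) ≤ K := by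
    refine Submodule.span_le.2 ?_
    rintro _ ⟨x, rfl⟩
    exact Submodule.mem_iSup_of_mem x (mem_orbit_self f _)
  have hmap : K.map f ≤ K := by
    rw [hK, Submodule.map_iSup]
    refine iSup_mono fun x => ?_
    rintro _ ⟨y, hy, rfl⟩
    exact map_mem_orbit f _ hy
  have key : ∀ q, T ≤ K ⊔ T.map (f ^ q) := by
    intro q
    induction q with
    | zero => simp [Module.End.one_eq_id]
    | succ q ih =>
      have : T.map (f ^ (q + 1)) = (T.map (f ^ q)).map f := by
        rw [pow_succ', Module.End.mul_eq_comp, Submodule.map_comp]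
      rw [this]
      calc T ≤ K ⊔ T.map f := hT.trans (sup_le_sup_right hspan _)
        _ ≤ K ⊔ (K ⊔ T.map (f ^ q)).map f := sup_le_sup_left (Submodule.map_mono ih) _
        _ ≤ K ⊔ (T.map (f ^ q)).map f := by
          rw [Submodule.map_sup]
          exact sup_le le_sup_left (sup_le (hmap.trans le_sup_left) le_sup_right)
  obtain ⟨t, ht⟩ := hf
  simpa [ht] using key t

end Primitive

end Abstract

/-! ### Shifts of exponents -/

section Exponents

variable {n : ℕ}

theorem shiftUp_apply (j : ℕ) (s : Fin n →₀ ℕ) (a : Fin n) :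
    shiftUp j s a = if j ≤ (a : ℕ) then s ⟨(a : ℕ) - j, (Nat.sub_le _ _).trans_lt a.2⟩ else 0 :=
  rfl

theorem shiftDown_apply (j : ℕ) (s : Fin n →₀ ℕ) (a : Fin n) :
    shiftDown j s a = if h : (a : ℕ) + j < n then s ⟨(a : ℕ) + j, h⟩ else 0 :=
  rfl

theorem shiftUp_zero (s : Fin n →₀ ℕ) : shiftUp 0 s = s := by
  ext a
  simp [shiftUp_apply]

theorem shiftDown_zero (s : Fin n →₀ ℕ) : shiftDown 0 s = s := by
  ext a
  simp [shiftDown_apply]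

theorem shiftUp_shiftUp (i j : ℕ) (s : Fin n →₀ ℕ) :
    shiftUp i (shiftUp j s) = shiftUp (j + i) s := by
  ext a
  simp only [shiftUp_apply]
  split_ifs <;> first | rfl | omega | (congr 2; omega)

theorem shiftDown_shiftDown (i j : ℕ) (s : Fin n →₀ ℕ) :
    shiftDown i (shiftDown j s) = shiftDown (j + i) s := by
  ext a
  simp only [shiftDown_apply]
  split_ifs <;> first | rfl | omega | (congr 2; omega)

theorem IsBra.le {k l : Fin n} {s : Fin n →₀ ℕ} (h : IsBra k l s) : k ≤ l := by
  by_contra! hlt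
  exact h.2.1.ne' (h.2.2.1 _ hlt)

theorem IsBra.unique {k l k' l' : Fin n} {s : Fin n →₀ ℕ} (h : IsBra k l s)
    (h' : IsBra k' l' s) : k = k' ∧ l = l' := by
  constructor
  · refine le_antisymm ?_ ?_ <;> by_contra! hlt
    · exact h'.1.ne' (h.2.2.1 _ hlt)
    · exact h.1.ne' (h'.2.2.1 _ hlt)
  · refine le_antisymm ?_ ?_ <;> by_contra! hlt
    · exact h.2.1.ne' (h'.2.2.2 _ hlt)
    · exact h'.2.1.ne' (h.2.2.2 _ hlt)

theorem exists_isBra {s : Fin n →₀ ℕ} (hs : s ≠ 0) : ∃ k l, IsBra k l s := by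
  have hne : s.support.Nonempty := Finsupp.support_nonempty_iff.2 hs
  refine ⟨s.support.min' hne, s.support.max' hne,
    Nat.pos_of_ne_zero (Finsupp.mem_support_iff.1 (s.support.min'_mem hne)),
    Nat.pos_of_ne_zero (Finsupp.mem_support_iff.1 (s.support.max'_mem hne)), ?_, ?_⟩
  · intro i hi
    by_contra h
    exact absurd (s.support.min'_le i (Finsupp.mem_support_iff.2 h)) (not_le.2 hi)
  · intro i hi
    by_contra h
    exact absurd (s.support.le_max' i (Finsupp.mem_support_iff.2 h)) (not_le.2 hi)

theorem IsBra.shiftUp {k l : Fin n} {s : Fin n →₀ ℕ} (h : IsBra k l s) {j : ℕ}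
    (hj : (l : ℕ) + j < n) :
    IsBra ⟨k + j, (Nat.add_le_add_right (Fin.le_def.1 h.le) j).trans_lt hj⟩ ⟨l + j, hj⟩
      (shiftUp j s) := by
  refine ⟨?_, ?_, fun i hi => ?_, fun i hi => ?_⟩
  · simpa [shiftUp_apply] using h.1
  · simpa [shiftUp_apply] using h.2.1
  · rw [shiftUp_apply]
    split_ifs with hc
    · refine h.2.2.1 _ ?_
      rw [Fin.lt_def] at hi ⊢
      simp at hi ⊢
      omega
    · rfl
  · rw [shiftUp_apply]
    split_ifs with hc
    · refine h.2.2.2 _ ?_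
      rw [gt_iff_lt, Fin.lt_def] at hi ⊢
      simp at hi ⊢
      omega
    · rfl

theorem IsBra.shiftDown {k l : Fin n} {s : Fin n →₀ ℕ} (h : IsBra k l s) {j : ℕ}
    (hj : j ≤ (k : ℕ)) :
    IsBra ⟨k - j, (Nat.sub_le _ _).trans_lt k.2⟩ ⟨l - j, (Nat.sub_le _ _).trans_lt l.2⟩
      (shiftDown j s) := by
  have hkl := Fin.le_def.1 h.le
  refine ⟨?_, ?_, fun i hi => ?_, fun i hi => ?_⟩
  · simpa [shiftDown_apply, Nat.sub_add_cancel hj] using h.1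
  · simpa [shiftDown_apply, Nat.sub_add_cancel (hj.trans hkl)] using h.2.1
  · rw [shiftDown_apply]
    split_ifs with hc
    · refine h.2.2.1 _ ?_
      rw [Fin.lt_def] at hi ⊢
      simp at hi ⊢
      omega
    · rfl
  · rw [shiftDown_apply]
    split_ifs with hc
    · refine h.2.2.2 _ ?_
      rw [gt_iff_lt, Fin.lt_def] at hi ⊢
      simp at hi ⊢
      omega
    · rfl

theorem IsBra.shiftDown_shiftUp {k l : Fin n} {s : Fin n →₀ ℕ} (h : IsBra k l s) {i j : ℕ}
    (hj : (l : ℕ) + (i + j) < n) :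
    NilMap.shiftDown i (NilMap.shiftUp (i + j) s) = NilMap.shiftUp j s := by
  ext a
  simp only [shiftDown_apply, shiftUp_apply]
  split_ifs <;> try omega
  · congr 2
    omega
  · symm
    refine h.2.2.2 _ ?_
    rw [gt_iff_lt, Fin.lt_def]
    simp
    omega

theorem IsBra.shiftUp_shiftDown {k l : Fin n} {s : Fin n →₀ ℕ} (h : IsBra k l s) {j : ℕ}
    (hj : j ≤ (k : ℕ)) : NilMap.shiftUp j (NilMap.shiftDown j s) = s := by
  ext a
  simp only [shiftDown_apply, shiftUp_apply]
  split_ifs <;> try omega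
  · congr 2
    omega
  · symm
    refine h.2.2.1 _ ?_
    rw [Fin.lt_def]
    omega

/-- Every nonzero exponent is obtained by raising one whose lowest occurring index is the first
one. -/
theorem exists_shiftUp_eq [NeZero n] {s : Fin n →₀ ℕ} (hs : s ≠ 0) :
    ∃ (m : Fin n) (p : Fin (n - m)) (t : Fin n →₀ ℕ), IsBra 0 m t ∧ t = shiftDown p s ∧
      ∃ (k l : Fin n), IsBra k l s ∧ (k : ℕ) = p ∧ shiftUp p t = s := by
  obtain ⟨k, l, h⟩ := exists_isBra hs
  have hkl := Fin.le_def.1 h.le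
  refine ⟨⟨l - k, (Nat.sub_le _ _).trans_lt l.2⟩, ⟨k, ?_⟩, shiftDown k s, ?_, rfl, k, l, h, rfl,
    h.shiftUp_shiftDown le_rfl⟩
  · have := l.2
    simp
    omega
  · have := h.shiftDown (j := k) le_rfl
    convert this using 1
    ext
    simp

/-- A raised exponent determines the exponent and the amount by which it was raised. -/
theorem shiftUp_injective [NeZero n] {m m' : Fin n} {s s' : Fin n →₀ ℕ} (h : IsBra 0 m s)
    (h' : IsBra 0 m' s') {p p' : ℕ} (hp : (m : ℕ) + p < n) (hp' : (m' : ℕ) + p' < n)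
    (heq : shiftUp p s = shiftUp p' s') : m = m' ∧ p = p' ∧ s = s' := by
  have h1 := h.shiftUp hp
  rw [heq] at h1
  obtain ⟨h2, h3⟩ := h1.unique (h'.shiftUp hp')
  simp at h2 h3
  subst h2
  refine ⟨Fin.ext (by omega), rfl, ?_⟩
  have h4 := h.shiftDown_shiftUp (i := p) (j := 0) hp
  have h5 := h'.shiftDown_shiftUp (i := p) (j := 0) hp'
  rw [add_zero, shiftUp_zero] at h4 h5
  rw [← h4, ← h5, heq]

end Exponents

/-! ### The substitution operators on monomials -/

section Monomials

variable {n d : ℕ}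

theorem linForm_jordanN (i : Fin n) :
    linForm (jordanN n) i =
      if h : (i : ℕ) + 1 < n then MvPolynomial.X ⟨(i : ℕ) + 1, h⟩ else 0 := by
  unfold linForm jordanN
  split_ifs with h
  · rw [Finset.sum_eq_single ⟨(i : ℕ) + 1, h⟩]
    · simp
    · intro b _ hb
      have : ¬ (i : ℕ) + 1 = b := fun hc => hb (Fin.ext hc.symm)
      simp [this]
    · simp
  · refine Finset.sum_eq_zero fun b _ => ?_
    have : ¬ (i : ℕ) + 1 = b := fun hc => h (hc ▸ b.2)
    simp [this]

theorem linForm_jordanM (i : Fin n) :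
    linForm (jordanM n) i =
      if 0 < (i : ℕ) then MvPolynomial.X ⟨(i : ℕ) - 1, (Nat.sub_le _ _).trans_lt i.2⟩ else 0 := by
  unfold linForm jordanM jordanN
  split_ifs with h
  · rw [Finset.sum_eq_single ⟨(i : ℕ) - 1, (Nat.sub_le _ _).trans_lt i.2⟩]
    · simp [Nat.sub_add_cancel h]
    · intro b _ hb
      have : ¬ (b : ℕ) + 1 = i := fun hc => hb (Fin.ext (by simp; omega))
      simp [this]
    · simp
  · refine Finset.sum_eq_zero fun b _ => ?_
    have : ¬ (b : ℕ) + 1 = i := by omega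
    simp [this]

theorem coe_subs (A : Matrix (Fin n) (Fin n) ℝ) (w : P n d) :
    ((subs A d w : P n d) : MvPolynomial (Fin n) ℝ) = MvPolynomial.aeval (linForm A) w.1 :=
  rfl

theorem aeval_monomial_eq_zero {g : Fin n → MvPolynomial (Fin n) ℝ} {s : Fin n →₀ ℕ} {i : Fin n}
    (hi : s i ≠ 0) (hg : g i = 0) : MvPolynomial.aeval g (MvPolynomial.monomial s (1 : ℝ)) = 0 := by
  rw [MvPolynomial.aeval_monomial, Finsupp.prod,
    Finset.prod_eq_zero (Finsupp.mem_support_iff.2 hi) (by rw [hg, zero_pow hi]), mul_zero]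

theorem aeval_monomial_eq_monomial {g : Fin n → MvPolynomial (Fin n) ℝ} {s t : Fin n →₀ ℕ}
    (θ : Fin n → Fin n) (hg : ∀ i, s i ≠ 0 → g i = MvPolynomial.X (θ i))
    (ht : ∀ a, t a = ∑ i, if θ i = a then s i else 0) :
    MvPolynomial.aeval g (MvPolynomial.monomial s (1 : ℝ)) = MvPolynomial.monomial t 1 := by
  have h1 : MvPolynomial.aeval g (MvPolynomial.monomial s (1 : ℝ)) =
      MvPolynomial.rename θ (MvPolynomial.monomial s 1) := by
    rw [MvPolynomial.aeval_monomial, map_one, one_mul, MvPolynomial.monomial_eq, map_mul,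
      map_one, map_one, one_mul, Finsupp.prod, Finsupp.prod, map_prod]
    refine Finset.prod_congr rfl fun i hi => ?_
    rw [hg i (Finsupp.mem_support_iff.1 hi), map_pow, MvPolynomial.rename_X]
  rw [h1, MvPolynomial.rename_monomial]
  refine congrArg (fun t => MvPolynomial.monomial t (1 : ℝ)) (Finsupp.ext fun a => ?_)
  rw [ht a, Finsupp.mapDomain, Finsupp.sum_fintype _ _ (by simp), Finsupp.finsetSum_apply]
  exact Finset.sum_congr rfl fun i _ => by rw [Finsupp.single_apply]

theorem SN_monomial {s : Fin n →₀ ℕ} {w : P n d}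
    (hw : (w : MvPolynomial (Fin n) ℝ) = MvPolynomial.monomial s 1)
    (hs : ∀ i : Fin n, (i : ℕ) + 1 = n → s i = 0) :
    ((SN n d w : P n d) : MvPolynomial (Fin n) ℝ) = MvPolynomial.monomial (shiftUp 1 s) 1 := by
  rw [SN, coe_subs, hw]
  refine aeval_monomial_eq_monomial
    (fun i => if h : (i : ℕ) + 1 < n then ⟨i + 1, h⟩ else i) (fun i hi => ?_) fun a => ?_
  · have h : (i : ℕ) + 1 < n := by
      have h1 := i.2
      have h2 := mt (hs i) hi
      omega
    rw [linForm_jordanN, dif_pos h, dif_pos h]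
  · rw [shiftUp_apply]
    split_ifs with h
    · rw [Finset.sum_eq_single ⟨(a : ℕ) - 1, (Nat.sub_le _ _).trans_lt a.2⟩]
      · simp [Nat.sub_add_cancel h]
      · intro i _ hi
        split_ifs with h1 h2 h2
        · exact absurd (Fin.ext (by simp [← h2])) hi
        · rfl
        · exact hs i (by omega)
        · rfl
      · simp
    · symm
      refine Finset.sum_eq_zero fun i _ => ?_
      split_ifs with h1 h2 h2
      · exact absurd (by simp [← h2]) h
      · rfl
      · exact hs i (by omega)
      · rfl

theorem SN_monomial_eq_zero {s : Fin n →₀ ℕ} {w : P n d}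
    (hw : (w : MvPolynomial (Fin n) ℝ) = MvPolynomial.monomial s 1) {i : Fin n}
    (hi : (i : ℕ) + 1 = n) (hs : s i ≠ 0) : SN n d w = 0 := by
  apply Subtype.ext
  rw [SN, coe_subs, hw]
  exact aeval_monomial_eq_zero hs (by rw [linForm_jordanN, dif_neg (by omega)])

theorem SM_monomial {s : Fin n →₀ ℕ} {w : P n d}
    (hw : (w : MvPolynomial (Fin n) ℝ) = MvPolynomial.monomial s 1)
    (hs : ∀ i : Fin n, (i : ℕ) = 0 → s i = 0) :
    ((SM n d w : P n d) : MvPolynomial (Fin n) ℝ) = MvPolynomial.monomial (shiftDown 1 s) 1 := by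
  rw [SM, coe_subs, hw]
  refine aeval_monomial_eq_monomial
    (fun i => ⟨(i : ℕ) - 1, (Nat.sub_le _ _).trans_lt i.2⟩) (fun i hi => ?_) fun a => ?_
  · rw [linForm_jordanM, if_pos]
    exact Nat.pos_of_ne_zero (mt (hs i) hi)
  · rw [shiftDown_apply]
    split_ifs with h
    · rw [Finset.sum_eq_single ⟨(a : ℕ) + 1, h⟩]
      · simp
      · intro i _ hi
        split_ifs with h1
        · apply hs i
          by_contra h0
          exact hi (Fin.ext (by simp [← h1]; omega))
        · rfl
      · simp
    · symm
      refine Finset.sum_eq_zero fun i _ => ?_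
      split_ifs with h1
      · apply hs i
        have := i.2
        rw [← h1] at h
        simp at h
        omega
      · rfl

theorem SM_monomial_eq_zero {s : Fin n →₀ ℕ} {w : P n d}
    (hw : (w : MvPolynomial (Fin n) ℝ) = MvPolynomial.monomial s 1) {i : Fin n}
    (hi : (i : ℕ) = 0) (hs : s i ≠ 0) : SM n d w = 0 := by
  apply Subtype.ext
  rw [SM, coe_subs, hw]
  exact aeval_monomial_eq_zero hs (by rw [linForm_jordanM, if_neg (by omega)])

theorem SN_pow_monomial {k l : Fin n} {s : Fin n →₀ ℕ} (h : IsBra k l s) {w : P n d}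
    (hw : (w : MvPolynomial (Fin n) ℝ) = MvPolynomial.monomial s 1) (j : ℕ) :
    (((SN n d ^ j) w : P n d) : MvPolynomial (Fin n) ℝ) =
      if (l : ℕ) + j < n then MvPolynomial.monomial (shiftUp j s) 1 else 0 := by
  induction j with
  | zero => simp [shiftUp_zero, hw]
  | succ j ih =>
    rw [pow_succ', Module.End.mul_apply]
    by_cases h1 : (l : ℕ) + j < n
    · rw [if_pos h1] at ih
      have hb := h.shiftUp h1
      by_cases h2 : (l : ℕ) + (j + 1) < n
      · rw [if_pos h2, SN_monomial ih, shiftUp_shiftUp]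
        intro i hi
        refine hb.2.2.2 i ?_
        rw [gt_iff_lt, Fin.lt_def]
        simp
        omega
      · rw [if_neg h2, SN_monomial_eq_zero ih (i := ⟨l + j, h1⟩) (by simp; omega) hb.2.1.ne']
        rfl
    · rw [if_neg h1] at ih
      have : (SN n d ^ j) w = 0 := Subtype.ext ih
      rw [this, map_zero, if_neg (by omega)]
      rfl

theorem SM_pow_monomial {k l : Fin n} {s : Fin n →₀ ℕ} (h : IsBra k l s) {w : P n d}
    (hw : (w : MvPolynomial (Fin n) ℝ) = MvPolynomial.monomial s 1) (j : ℕ) :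
    (((SM n d ^ j) w : P n d) : MvPolynomial (Fin n) ℝ) =
      if j ≤ (k : ℕ) then MvPolynomial.monomial (shiftDown j s) 1 else 0 := by
  induction j with
  | zero => simp [shiftDown_zero, hw]
  | succ j ih =>
    rw [pow_succ', Module.End.mul_apply]
    by_cases h1 : j ≤ (k : ℕ)
    · rw [if_pos h1] at ih
      have hb := h.shiftDown h1
      by_cases h2 : j + 1 ≤ (k : ℕ)
      · rw [if_pos h2, SM_monomial ih, shiftDown_shiftDown]
        intro i hi
        refine hb.2.2.1 i ?_
        rw [Fin.lt_def]
        simp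
        omega
      · rw [if_neg h2, SM_monomial_eq_zero ih (i := ⟨k - j, (Nat.sub_le _ _).trans_lt k.2⟩)
          (by simp; omega) hb.1.ne']
        rfl
    · rw [if_neg h1] at ih
      have : (SM n d ^ j) w = 0 := Subtype.ext ih
      rw [this, map_zero, if_neg (by omega)]
      rfl

theorem span_monomials_eq_top {K : Submodule ℝ (P n d)}
    (hK : ∀ (s : Fin n →₀ ℕ) (w : P n d), s.degree = d →
      (w : MvPolynomial (Fin n) ℝ) = MvPolynomial.monomial s 1 → w ∈ K) : K = ⊤ := by
  refine eq_top_iff.2 fun u _ => ?_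
  have hdeg : ∀ s ∈ (u : MvPolynomial (Fin n) ℝ).support, s.degree = d := by
    intro s hs
    rw [Finsupp.degree_eq_weight_one]
    exact (MvPolynomial.mem_homogeneousSubmodule d _).1 u.2 (MvPolynomial.mem_support_iff.1 hs)
  have hu : u = ∑ s : (u : MvPolynomial (Fin n) ℝ).support,
      (u : MvPolynomial (Fin n) ℝ).coeff s.1 •
        (⟨MvPolynomial.monomial s.1 1, MvPolynomial.isHomogeneous_monomial 1 (hdeg s.1 s.2)⟩ :
          P n d) := by
    apply Subtype.ext
    rw [AddSubmonoidClass.coe_finsetSum]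
    conv_lhs => rw [MvPolynomial.as_sum (u : MvPolynomial (Fin n) ℝ), ← Finset.sum_coe_sort]
    refine Finset.sum_congr rfl fun s _ => ?_
    simp [MvPolynomial.smul_monomial]
  rw [hu]
  exact Submodule.sum_mem _ fun s _ => Submodule.smul_mem _ _ (hK s.1 _ (hdeg s.1 s.2) rfl)

end Monomials

/-! ### The basis of strings of monomials -/

section StringBasis

/-- If `e` sends each member of a basis outside `Z` to a nonzero multiple of another one, different
members to different ones, and kills the members in `Z`, then the latter span its kernel. -/
theorem ker_eq_span_image {V ι : Type*} [AddCommGroup V] [Module ℝ V] {b : ι → V}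
    (hb : LinearIndependent ℝ b) (hspan : Submodule.span ℝ (Set.range b) = ⊤)
    {e : Module.End ℝ V} {Z : Set ι} (hZ : ∀ x ∈ Z, e (b x) = 0) (c : ι → ℝ) (τ : ι → ι)
    (hτ : Set.InjOn τ Zᶜ) (hc : ∀ x ∉ Z, c x ≠ 0) (he : ∀ x ∉ Z, e (b x) = c x • b (τ x)) :
    LinearMap.ker e = Submodule.span ℝ (b '' Z) := by
  classical
  refine le_antisymm (fun u hu => ?_) (Submodule.span_le.2 ?_)
  · have hmem : u ∈ Submodule.span ℝ (Set.range b) := hspan ▸ Submodule.mem_top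
    obtain ⟨a, rfl⟩ := Finsupp.mem_span_range_iff_exists_finsupp.1 hmem
    rw [LinearMap.mem_ker, Finsupp.sum, map_sum] at hu
    have hrel : ∑ x ∈ a.support.subtype (· ∈ Zᶜ), (a x * c x) • b (τ x) = 0 := by
      rw [← Finset.sum_filter_add_sum_filter_not _ (· ∈ Zᶜ),
        Finset.sum_eq_zero (s := a.support.filter fun x => ¬ x ∈ Zᶜ), add_zero] at hu
      · rw [← hu, ← Finset.subtype_map, Finset.sum_map]
        refine Finset.sum_congr rfl fun x _ => ?_
        rw [Function.Embedding.subtype_apply, map_smul, he _ x.2, smul_smul]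
      · intro x hx
        rw [map_smul, hZ x (by simpa using (Finset.mem_filter.1 hx).2), smul_zero]
    have hzero := linearIndependent_iff'.1 (hb.comp _ hτ.injective) _ _ hrel
    refine Submodule.sum_mem _ fun x hx => Submodule.smul_mem _ _ (Submodule.subset_span ?_)
    refine ⟨x, ?_, rfl⟩
    by_contra hxZ
    have := hzero ⟨x, hxZ⟩ (by simpa using hx)
    exact mul_ne_zero (Finsupp.mem_support_iff.1 hx) (hc x hxZ) this
  · rintro _ ⟨x, hx, rfl⟩
    exact hZ x hx

variable {n d : ℕ} [NeZero n]

/-- The index set of the monomials of degree `d`: a monomial `g` of type `|1,m+1|` (one-based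
notation) together with the number of steps by which its indices are raised. -/
abbrev StringIdx (n d : ℕ) [NeZero n] : Type := Σ m : Fin n, Gen n d m × Fin (n - m)

/-- The raised monomial. -/
def stringVec (x : StringIdx n d) : P n d := (SN n d ^ (x.2.2 : ℕ)) x.2.1.poly

theorem Gen.pow_poly {m : Fin n} (g : Gen n d m) (j : ℕ) :
    (((SN n d ^ j) g.poly : P n d) : MvPolynomial (Fin n) ℝ) =
      if (m : ℕ) + j < n then MvPolynomial.monomial (shiftUp j g.1) 1 else 0 :=
  SN_pow_monomial g.2.2 rfl j

theorem coe_stringVec (x : StringIdx n d) :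
    (stringVec x : MvPolynomial (Fin n) ℝ) = MvPolynomial.monomial (shiftUp x.2.2 x.2.1.1) 1 := by
  rw [stringVec, Gen.pow_poly, if_pos]
  have := x.2.2.2
  omega

theorem Gen.isShiftString {m : Fin n} (g : Gen n d m) :
    IsShiftString (SN n d) (SM n d) (n - m) fun j => (SN n d ^ j) g.poly where
  f_apply j := by rw [pow_succ', Module.End.mul_apply]
  eq_zero j hj := by
    apply Subtype.ext
    rw [g.pow_poly, if_neg (by omega)]
    rfl
  y_zero := SM_monomial_eq_zero (s := g.1) (i := 0) (by simp [Gen.poly]) (by simp) g.2.2.1.ne'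
  y_succ j hj := by
    have h : (m : ℕ) + (1 + j) < n := by omega
    apply Subtype.ext
    have h1 := g.pow_poly (1 + j)
    rw [if_pos h] at h1
    rw [add_comm j 1, SM_monomial h1, g.pow_poly, if_pos (by omega),
      g.2.2.shiftDown_shiftUp h]
    intro i hi
    rw [shiftUp_apply, if_neg (by omega)]

theorem shiftUp_stringIdx_injective :
    Function.Injective fun x : StringIdx n d => shiftUp x.2.2 x.2.1.1 := by
  rintro ⟨m, g, p⟩ ⟨m', g', p'⟩ h
  have h1 : (p : ℕ) < n - m := p.2
  have h2 : (p' : ℕ) < n - m' := p'.2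
  obtain ⟨rfl, hp, hg⟩ := shiftUp_injective (p := p) (p' := p') g.2.2 g'.2.2 (by omega) (by omega) h
  have hp' : p = p' := Fin.ext hp
  have hg' : g = g' := Subtype.ext hg
  rw [hp', hg']

theorem exists_shiftUp_stringIdx (hd : 1 ≤ d) {s : Fin n →₀ ℕ} (hs : s.degree = d) :
    ∃ x : StringIdx n d, shiftUp x.2.2 x.2.1.1 = s := by
  have hs0 : s ≠ 0 := by
    rintro rfl
    simp at hs
    omega
  obtain ⟨m, p, t, ht, htd, k, l, hkl, hkp, hup⟩ := exists_shiftUp_eq hs0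
  -- lowering indices preserves the degree, because `S_M` acts on `P n d`
  have hdeg : t.degree = d := by
    have h := SM_pow_monomial hkl
      (w := (⟨MvPolynomial.monomial s 1, MvPolynomial.isHomogeneous_monomial 1 hs⟩ : P n d)) rfl p
    rw [if_pos hkp.ge, ← htd] at h
    have h2 := ((SM n d ^ (p : ℕ))
      (⟨MvPolynomial.monomial s 1, MvPolynomial.isHomogeneous_monomial 1 hs⟩ : P n d)).2
    rw [h, MvPolynomial.mem_homogeneousSubmodule] at h2
    rw [Finsupp.degree_eq_weight_one]
    exact h2 (by simp)
  exact ⟨⟨m, ⟨t, hdeg, ht⟩, p⟩, hup⟩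

theorem linearIndependent_stringVec : LinearIndependent ℝ (stringVec (n := n) (d := d)) := by
  refine LinearIndependent.of_comp (MvPolynomial.homogeneousSubmodule (Fin n) ℝ d).subtype ?_
  have h := (MvPolynomial.basisMonomials (Fin n) ℝ).linearIndependent.comp _
    (shiftUp_stringIdx_injective (n := n) (d := d))
  rw [MvPolynomial.coe_basisMonomials] at h
  have heq : (MvPolynomial.homogeneousSubmodule (Fin n) ℝ d).subtype ∘ stringVec =
      (fun s => MvPolynomial.monomial s (1 : ℝ)) ∘
        fun x : StringIdx n d => shiftUp x.2.2 x.2.1.1 := funext coe_stringVec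
  rw [heq]
  exact h

theorem span_stringVec (hd : 1 ≤ d) :
    Submodule.span ℝ (Set.range (stringVec (n := n) (d := d))) = ⊤ := by
  refine span_monomials_eq_top fun s w hs hw => Submodule.subset_span ?_
  obtain ⟨x, rfl⟩ := exists_shiftUp_stringIdx hd hs
  exact ⟨x, Subtype.ext ((coe_stringVec x).trans hw.symm)⟩

theorem sl2Relations_subs (hd : 1 ≤ d) : Sl2Relations (SMbar n d) (SHbar n d) (SN n d) := by
  refine sl2Relations_bar (span_stringVec hd) ?_
  rintro _ ⟨x, rfl⟩
  exact ⟨_, _, x.2.2, x.2.1.isShiftString, Nat.sub_le _ _, x.2.2.2, rfl⟩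

theorem SN_pow_eq_zero (hd : 1 ≤ d) {j : ℕ} (hj : n ≤ j) : SN n d ^ j = 0 := by
  refine LinearMap.ext_on (span_stringVec hd) ?_
  rintro _ ⟨x, rfl⟩
  have := x.2.1.isShiftString.f_pow j x.2.2
  rw [stringVec, this, x.2.1.isShiftString.eq_zero _ (by omega), LinearMap.zero_apply]

theorem isNilpotent_SN (hd : 1 ≤ d) : IsNilpotent (SN n d) := ⟨n, SN_pow_eq_zero hd le_rfl⟩

theorem SMbar_stringVec (m : Fin n) (g : Gen n d m) {j : ℕ} (hj : j < n - m) :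
    SMbar n d ((SN n d ^ j) g.poly) =
      ((j : ℝ) * (((n - m : ℕ) : ℝ) - j)) • (SN n d ^ (j - 1)) g.poly :=
  g.isShiftString.barM_apply (Nat.sub_le _ _) hj

theorem Gen.SMbar_poly {m : Fin n} (g : Gen n d m) : SMbar n d g.poly = 0 := by
  simpa using SMbar_stringVec m g (j := 0) (by have := m.2; omega)

theorem Gen.SHbar_poly {m : Fin n} (g : Gen n d m) :
    SHbar n d g.poly = ((n - 1 - m : ℕ) : ℝ) • g.poly := by
  have h := g.isShiftString.barH_apply (n := n) (Nat.sub_le _ _) (j := 0)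
    (by have := m.2; omega)
  have h2 : n - m = n - 1 - m + 1 := by have := m.2; omega
  rw [h2] at h
  simpa [SHbar] using h

theorem Gen.poly_ne_zero {m : Fin n} (g : Gen n d m) : g.poly ≠ 0 := by
  intro h
  have := congrArg Subtype.val h
  simp [Gen.poly] at this

theorem linearIndependent_poly :
    LinearIndependent ℝ fun x : Σ m : Fin n, Gen n d m => x.2.poly := by
  have h := (linearIndependent_stringVec (n := n) (d := d)).comp
    (fun x : Σ m : Fin n, Gen n d m => (⟨x.1, x.2, ⟨0, by have := x.1.2; omega⟩⟩ : StringIdx n d))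
    (by
      rintro ⟨m, g⟩ ⟨m', g'⟩ h
      obtain ⟨rfl, h⟩ := Sigma.mk.inj h
      rw [heq_eq_eq] at h
      obtain rfl := (Prod.mk.inj h).1
      rfl)
  exact h

theorem isSl2Irrep_orbit_poly (hd : 1 ≤ d) {m : Fin n} (g : Gen n d m) :
    IsSl2Irrep (SMbar n d) (SHbar n d) (SN n d) (n - 1 - m) (orbit (SN n d) g.poly) :=
  isSl2Irrep_orbit (sl2Relations_subs hd) (isNilpotent_SN hd) g.SMbar_poly g.SHbar_poly
    g.poly_ne_zero

theorem isDirectSum_orbit_poly (hd : 1 ≤ d) :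
    IsDirectSum (fun x : Σ m : Fin n, Gen n d m => orbit (SN n d) x.2.poly) ⊤ := by
  refine ⟨iSupIndep_orbit (sl2Relations_subs hd) (isNilpotent_SN hd) (fun x => x.2.SMbar_poly)
    (fun x => x.2.SHbar_poly) linearIndependent_poly, ?_⟩
  rw [eq_top_iff, ← span_stringVec hd, Submodule.span_le]
  rintro _ ⟨x, rfl⟩
  exact Submodule.mem_iSup_of_mem (⟨x.1, x.2.1⟩ : Σ m : Fin n, Gen n d m)
    (Submodule.subset_span ⟨x.2.2, rfl⟩)

theorem braSpan_eq_span (m : Fin n) :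
    braSpan n d 0 m = Submodule.span ℝ (Set.range (Gen.poly (n := n) (d := d) (m := m))) := by
  refine le_antisymm (Submodule.span_mono ?_) (Submodule.span_mono ?_)
  · rintro u ⟨s, hs, hu⟩
    have hdeg : s.degree = d := by
      have h2 := u.2
      rw [hu, MvPolynomial.mem_homogeneousSubmodule] at h2
      rw [Finsupp.degree_eq_weight_one]
      exact h2 (by simp)
    exact ⟨⟨s, hdeg, hs⟩, Subtype.ext hu.symm⟩
  · rintro _ ⟨g, rfl⟩
    exact ⟨g.1, g.2.2, rfl⟩

/-- The members of the basis of strings which start a string. -/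
def stringStart (n d : ℕ) [NeZero n] : Set (StringIdx n d) := {x | (x.2.2 : ℕ) = 0}

/-- One step down in a string. -/
def stringPred (x : StringIdx n d) : StringIdx n d :=
  ⟨x.1, x.2.1, ⟨(x.2.2 : ℕ) - 1, (Nat.sub_le _ _).trans_lt x.2.2.2⟩⟩

theorem stringPred_injOn : Set.InjOn (stringPred (n := n) (d := d)) (stringStart n d)ᶜ := by
  rintro ⟨m, g, p⟩ hx ⟨m', g', p'⟩ hx' h
  obtain ⟨rfl, h⟩ := Sigma.mk.inj h
  rw [heq_eq_eq] at h
  obtain ⟨rfl, h⟩ := Prod.mk.inj h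
  have h1 : (p : ℕ) ≠ 0 := hx
  have h2 : (p' : ℕ) ≠ 0 := hx'
  have h3 := congrArg Fin.val h
  have : p = p' := Fin.ext (by simp at h3; omega)
  rw [this]

theorem ker_SM (hd : 1 ≤ d) :
    LinearMap.ker (SM n d) = Submodule.span ℝ (stringVec '' stringStart n d) := by
  refine ker_eq_span_image linearIndependent_stringVec (span_stringVec hd) ?_ (fun _ => 1)
    stringPred stringPred_injOn (fun _ _ => one_ne_zero) ?_
  · rintro ⟨m, g, p⟩ (hp : (p : ℕ) = 0)
    simpa [stringVec, hp] using g.isShiftString.y_zero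
  · rintro ⟨m, g, p⟩ (hp : ¬ (p : ℕ) = 0)
    obtain ⟨q, hq⟩ : ∃ q, (p : ℕ) = q + 1 := ⟨p - 1, by omega⟩
    have := p.2
    simpa [stringVec, stringPred, hq] using g.isShiftString.y_succ q (by omega)

theorem ker_SMbar (hd : 1 ≤ d) :
    LinearMap.ker (SMbar n d) = Submodule.span ℝ (stringVec '' stringStart n d) := by
  refine ker_eq_span_image linearIndependent_stringVec (span_stringVec hd) ?_
    (fun x => (x.2.2 : ℝ) * (((n - x.1 : ℕ) : ℝ) - (x.2.2 : ℕ)))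
    stringPred stringPred_injOn ?_ ?_
  · rintro ⟨m, g, p⟩ (hp : (p : ℕ) = 0)
    simpa [stringVec, hp] using g.SMbar_poly
  · rintro ⟨m, g, p⟩ (hp : ¬ (p : ℕ) = 0)
    refine mul_ne_zero (Nat.cast_ne_zero.2 hp) (sub_ne_zero.2 ?_)
    exact_mod_cast p.2.ne'
  · rintro ⟨m, g, p⟩ _
    exact SMbar_stringVec m g p.2

theorem isDirectSum_braSpan (hd : 1 ≤ d) :
    IsDirectSum (fun m : Fin n => braSpan n d 0 m) (LinearMap.ker (SM n d)) := by
  have hbra : ∀ m : Fin n, braSpan n d 0 m =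
      Submodule.span ℝ (stringVec '' {x : StringIdx n d | (x.2.2 : ℕ) = 0 ∧ x.1 = m}) := by
    intro m
    rw [braSpan_eq_span]
    congr 1
    ext u
    constructor
    · rintro ⟨g, rfl⟩
      exact ⟨⟨m, g, ⟨0, by have := m.2; omega⟩⟩, ⟨rfl, rfl⟩, rfl⟩
    · rintro ⟨⟨m', g, p⟩, ⟨hp, hm⟩, rfl⟩
      simp only at hp hm
      subst hm
      exact ⟨g, by simp [stringVec, hp]⟩
  constructor
  · intro m
    simp only [hbra, ← Submodule.span_iUnion]
    rw [← Set.image_iUnion₂]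
    refine linearIndependent_stringVec.disjoint_span_image (Set.disjoint_left.2 ?_)
    rintro σ ⟨_, rfl⟩ hσ
    simp at hσ
  · simp only [hbra]
    rw [← Submodule.span_iUnion, ← Set.image_iUnion, ker_SM hd]
    congr 2
    ext x
    simp [stringStart]

theorem SHbar_braSpan {m : Fin n} {w : P n d} (hw : w ∈ braSpan n d 0 m) :
    SHbar n d w = ((n - 1 - m : ℕ) : ℝ) • w := by
  rw [braSpan_eq_span] at hw
  induction hw using Submodule.span_induction with
  | mem x hx =>
    obtain ⟨g, rfl⟩ := hx
    exact g.SHbar_poly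
  | zero => simp
  | add x y _ _ hx hy => rw [map_add, hx, hy, smul_add]
  | smul a x _ hx => rw [map_smul, hx, smul_comm]

theorem SN_pow_braSpan_eq_zero {m : Fin n} {w : P n d} (hw : w ∈ braSpan n d 0 m) {j : ℕ}
    (hj : n ≤ m + j) : (SN n d ^ j) w = 0 := by
  rw [braSpan_eq_span] at hw
  induction hw using Submodule.span_induction with
  | mem x hx =>
    obtain ⟨g, rfl⟩ := hx
    exact g.isShiftString.eq_zero j (by omega)
  | zero => simp
  | add x y _ _ hx hy => rw [map_add, hx, hy, add_zero]
  | smul a x _ hx => rw [map_smul, hx, smul_zero]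

end StringBasis

/-! ### The standard representation -/

section Standard

variable {n : ℕ}

theorem jordanN_ket (i : ℕ) : Matrix.toLin' (jordanN n) (ket n i) = ket n (i + 1) := by
  ext c
  rw [Matrix.toLin'_apply, Matrix.mulVec, dotProduct]
  simp only [jordanN, ket, Matrix.of_apply, mul_ite, mul_one, mul_zero]
  by_cases h : (c : ℕ) + 1 < n
  · rw [Finset.sum_eq_single ⟨c + 1, h⟩]
    · simp only [if_true]
      split_ifs <;> first | rfl | omega
    · intro b _ hb
      have : ¬ (c : ℕ) + 1 = b := fun hc => hb (Fin.ext hc.symm)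
      simp [this]
    · simp
  · rw [if_neg (by omega)]
    refine Finset.sum_eq_zero fun b _ => ?_
    have : ¬ (c : ℕ) + 1 = b := by omega
    simp [this]

theorem jordanM_ket_succ {i : ℕ} (hi : i + 1 < n) :
    Matrix.toLin' (jordanM n) (ket n (i + 1)) = ket n i := by
  ext c
  rw [Matrix.toLin'_apply, Matrix.mulVec, dotProduct]
  simp only [jordanM, jordanN, ket, Matrix.of_apply, Matrix.transpose_apply, mul_ite, mul_one,
    mul_zero]
  by_cases h : 0 < (c : ℕ)
  · rw [Finset.sum_eq_single ⟨c - 1, (Nat.sub_le _ _).trans_lt c.2⟩]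
    · simp only
      split_ifs <;> first | rfl | omega
    · intro b _ hb
      have : ¬ (b : ℕ) + 1 = c := fun hc => hb (Fin.ext (by simp; omega))
      simp [this]
    · simp
  · rw [if_neg (by omega)]
    refine Finset.sum_eq_zero fun b _ => ?_
    have : ¬ (b : ℕ) + 1 = c := by omega
    simp [this]

theorem jordanM_ket_zero : Matrix.toLin' (jordanM n) (ket n 0) = 0 := by
  ext c
  rw [Matrix.toLin'_apply, Matrix.mulVec, dotProduct]
  refine Finset.sum_eq_zero fun b _ => ?_
  simp only [jordanM, jordanN, ket, Matrix.of_apply, Matrix.transpose_apply]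
  have := c.2
  split_ifs <;> first | (exfalso; omega) | simp

theorem ket_eq_zero {i : ℕ} (hi : n ≤ i) : ket n i = 0 := by
  ext c
  have := c.2
  simp only [ket, Pi.zero_apply]
  rw [if_neg (by omega)]

theorem isShiftString_ket (n : ℕ) :
    IsShiftString (Matrix.toLin' (jordanN n)) (Matrix.toLin' (jordanM n)) n (ket n) where
  f_apply := jordanN_ket
  eq_zero _ := ket_eq_zero
  y_zero := jordanM_ket_zero
  y_succ _ := jordanM_ket_succ

theorem single_eq_ket (c : Fin n) : Pi.single c (1 : ℝ) = ket n (n - 1 - c) := by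
  ext b
  have h1 := b.2
  have h2 := c.2
  simp only [ket, Pi.single_apply, Fin.ext_iff]
  split_ifs <;> first | rfl | omega

theorem span_ket (n : ℕ) : Submodule.span ℝ (Set.range fun i : Fin n => ket n i) = ⊤ := by
  rw [eq_top_iff, ← (Pi.basisFun ℝ (Fin n)).span_eq, Submodule.span_le]
  rintro _ ⟨c, rfl⟩
  refine Submodule.subset_span ⟨⟨n - 1 - c, by have := c.2; omega⟩, ?_⟩
  rw [Pi.basisFun_apply, single_eq_ket]

theorem map_barM {R S : Type*} [Ring R] [Ring S] (θ : R →+* S) (p : ℕ) (x y : R) :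
    θ (barM p x y) = barM p (θ x) (θ y) := by
  simp [barM]

theorem map_barH {R S : Type*} [Ring R] [Ring S] (θ : R →+* S) (p : ℕ) (x y : R) :
    θ (barH p x y) = barH p (θ x) (θ y) := by
  simp [barH, Ring.lie_def]

theorem Sl2Relations.of_map {R S : Type*} [Ring R] [Ring S] (θ : R →+* S)
    (hθ : Function.Injective θ) {e h f : R} (H : Sl2Relations (θ e) (θ h) (θ f)) :
    Sl2Relations e h f := by
  obtain ⟨h1, h2, h3⟩ := H
  refine ⟨hθ ?_, hθ ?_, hθ ?_⟩ <;>
    simpa only [Ring.lie_def, map_sub, map_mul, map_neg, map_nsmul]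

/-- The action of matrices on column vectors as a ring homomorphism. -/
def toLinHom (n : ℕ) : Matrix (Fin n) (Fin n) ℝ →+* Module.End ℝ (Fin n → ℝ) :=
  (Matrix.toLinAlgEquiv' (R := ℝ) (n := Fin n)).toRingEquiv.toRingHom

theorem toLinHom_apply (A : Matrix (Fin n) (Fin n) ℝ) : toLinHom n A = Matrix.toLin' A := rfl

theorem toLin'_barM (n : ℕ) : Matrix.toLin' (barM n (jordanN n) (jordanM n)) =
    barM n (Matrix.toLin' (jordanN n)) (Matrix.toLin' (jordanM n)) := by
  simp only [← toLinHom_apply, map_barM]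

theorem toLin'_barH (n : ℕ) : Matrix.toLin' (barH n (jordanN n) (jordanM n)) =
    barH n (Matrix.toLin' (jordanN n)) (Matrix.toLin' (jordanM n)) := by
  simp only [← toLinHom_apply, map_barH]

theorem sl2Relations_toLin' (n : ℕ) :
    Sl2Relations (Matrix.toLin' (barM n (jordanN n) (jordanM n)))
      (Matrix.toLin' (barH n (jordanN n) (jordanM n))) (Matrix.toLin' (jordanN n)) := by
  rw [toLin'_barM, toLin'_barH]
  refine sl2Relations_bar (span_ket n) ?_
  rintro _ ⟨i, rfl⟩
  exact ⟨n, ket n, i, isShiftString_ket n, le_rfl, i.2, rfl⟩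

theorem sl2Relations_jordan (n : ℕ) :
    Sl2Relations (barM n (jordanN n) (jordanM n)) (barH n (jordanN n) (jordanM n))
      (jordanN n) := by
  refine Sl2Relations.of_map (toLinHom n) (Matrix.toLin' (R := ℝ)).injective ?_
  simpa only [toLinHom_apply] using sl2Relations_toLin' n

theorem barM_ket {j : ℕ} (hj : j < n) :
    Matrix.toLin' (barM n (jordanN n) (jordanM n)) (ket n j) =
      ((j : ℝ) * ((n : ℝ) - j)) • ket n (j - 1) := by
  rw [toLin'_barM]
  exact (isShiftString_ket n).barM_apply le_rfl hj

theorem barH_ket {j : ℕ} (hj : j < n) :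
    Matrix.toLin' (barH n (jordanN n) (jordanM n)) (ket n j) =
      ((n : ℝ) - 1 - 2 * j) • ket n j := by
  rw [toLin'_barH]
  exact (isShiftString_ket n).barH_apply le_rfl hj

/-- The bar of `M` has its nonzero entries `c * (n - c)` just below the diagonal. -/
theorem barM_jordan_apply (c b : Fin n) : barM n (jordanN n) (jordanM n) c b =
    if (c : ℕ) = b + 1 then (c : ℝ) * ((n : ℝ) - c) else 0 := by
  have h := congrFun (barM_ket (n := n) (j := n - 1 - b) (by have := b.2; omega)) c
  rw [← single_eq_ket, Matrix.toLin'_apply, Matrix.mulVec_single_one] at h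
  have hb := b.2
  have hc := c.2
  rw [Matrix.col_apply] at h
  rw [h]
  simp only [ket, Pi.smul_apply, smul_eq_mul, mul_ite, mul_one, mul_zero]
  rcases Nat.lt_or_ge ((b : ℕ) + 1) n with h1 | h1
  · by_cases h2 : (c : ℕ) = b + 1
    · rw [if_pos (by omega), if_pos h2, Nat.cast_sub (by omega), Nat.cast_sub (by omega), h2]
      push_cast
      ring
    · rw [if_neg (by omega), if_neg h2]
  · rw [if_neg (by omega : ¬ (c : ℕ) = b + 1), show n - 1 - (b : ℕ) = 0 by omega]
    simp

theorem isSl2Irrep_standard (n : ℕ) [NeZero n] :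
    IsSl2Irrep (Matrix.toLin' (barM n (jordanN n) (jordanM n)))
      (Matrix.toLin' (barH n (jordanN n) (jordanM n))) (Matrix.toLin' (jordanN n)) (n - 1) ⊤ := by
  have hn := NeZero.pos n
  have htop : orbit (Matrix.toLin' (jordanN n)) (ket n 0) = ⊤ := by
    rw [eq_top_iff, ← span_ket n, Submodule.span_le]
    rintro _ ⟨i, rfl⟩
    exact Submodule.subset_span ⟨i, by simpa using (isShiftString_ket n).f_pow i 0⟩
  rw [← htop]
  refine isSl2Irrep_orbit (sl2Relations_toLin' n) ⟨n, ?_⟩ ?_ ?_ ?_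
  · refine LinearMap.ext_on (span_ket n) ?_
    rintro _ ⟨i, rfl⟩
    rw [(isShiftString_ket n).f_pow, ket_eq_zero (by omega), LinearMap.zero_apply]
  · simpa using barM_ket hn
  · simpa [Nat.cast_sub (show 1 ≤ n from hn)] using barH_ket hn
  · intro h
    simpa [ket, Nat.sub_add_cancel hn] using congrFun h ⟨n - 1, by omega⟩

end Standard

/-! ### Operators on polynomial maps -/

theorem Sl2Relations.map {R S : Type*} [Ring R] [Ring S] (θ : R →+* S) {e h f : R}
    (H : Sl2Relations e h f) : Sl2Relations (θ e) (θ h) (θ f) := by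
  obtain ⟨h1, h2, h3⟩ := H
  refine ⟨?_, ?_, ?_⟩
  · rw [← h1]
    simp [Ring.lie_def]
  · rw [← map_nsmul, ← map_neg, ← h2]
    simp [Ring.lie_def]
  · rw [← map_nsmul, ← h3]
    simp [Ring.lie_def]

/-- The difference of two commuting triples, with the weights added. -/
theorem Sl2Relations.sub {R : Type*} [Ring R] {e h f e' h' f' : R} (H : Sl2Relations e h f)
    (H' : Sl2Relations e' h' f') (hef : Commute e f') (hfe : Commute f e') (hhf : Commute h f')
    (hfh : Commute f h') (hhe : Commute h e') (heh : Commute e h') :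
    Sl2Relations (e - e') (h + h') (f - f') := by
  obtain ⟨h1, h2, h3⟩ := H
  obtain ⟨h1', h2', h3'⟩ := H'
  simp only [Ring.lie_def] at *
  refine ⟨?_, ?_, ?_⟩
  · rw [← h1, ← h1']
    simp only [Ring.lie_def, sub_mul, mul_sub, hef.eq, hfe.eq]
    abel
  · rw [smul_sub, neg_sub', ← h2, ← neg_neg (2 • f'), ← h2']
    simp only [Ring.lie_def, add_mul, mul_add, sub_mul, mul_sub, hhf.eq, hfh.eq]
    abel
  · rw [smul_sub, ← h3, ← h3']
    simp only [Ring.lie_def, add_mul, mul_add, sub_mul, mul_sub, hhe.eq, heh.eq]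
    abel

section Operators

variable {n d : ℕ}

theorem mult_apply (A : Matrix (Fin n) (Fin n) ℝ) (u : VP n d) (c : Fin n) :
    mult A d u c = ∑ b, A c b • u b := rfl

/-- `A ↦ M_A` as a ring homomorphism. -/
def multHom (n d : ℕ) : Matrix (Fin n) (Fin n) ℝ →+* Module.End ℝ (VP n d) where
  toFun A := mult A d
  map_one' := by
    refine LinearMap.ext fun u => funext fun c => ?_
    simp [mult_apply, Matrix.one_apply]
  map_zero' := by
    refine LinearMap.ext fun u => funext fun c => ?_
    simp [mult_apply]
  map_add' A B := by
    refine LinearMap.ext fun u => funext fun c => ?_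
    simp [mult_apply, add_smul, Finset.sum_add_distrib]
  map_mul' A B := by
    refine LinearMap.ext fun u => funext fun c => ?_
    simp only [mult_apply, Module.End.mul_apply, Matrix.mul_apply, Finset.sum_smul,
      Finset.smul_sum, smul_smul]
    exact Finset.sum_comm

theorem multHom_apply (A : Matrix (Fin n) (Fin n) ℝ) : multHom n d A = mult A d := rfl

/-- Componentwise action of operators on polynomials, as a ring homomorphism. -/
def compHom (n d : ℕ) : Module.End ℝ (P n d) →+* Module.End ℝ (VP n d) where
  toFun f := f.compLeft (Fin n)
  map_one' := rfl
  map_zero' := rfl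
  map_add' _ _ := rfl
  map_mul' _ _ := rfl

theorem compHom_apply (f : Module.End ℝ (P n d)) : compHom n d f = f.compLeft (Fin n) := rfl

theorem commute_mult_compLeft (A : Matrix (Fin n) (Fin n) ℝ) (f : Module.End ℝ (P n d)) :
    Commute (mult A d) (f.compLeft (Fin n)) := by
  refine LinearMap.ext fun u => funext fun c => ?_
  simp [Module.End.mul_apply, mult_apply, LinearMap.compLeft_apply]

theorem sl2Relations_homOp [NeZero n] (hd : 1 ≤ d) :
    Sl2Relations (DMbar n d) (DHbar n d) (DN n d) := by
  have h1 := (sl2Relations_jordan n).map (S := Module.End ℝ (VP n d)) (multHom n d)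
  have h2 := (sl2Relations_subs (n := n) hd).map (S := Module.End ℝ (VP n d)) (compHom n d)
  simp only [multHom_apply, compHom_apply] at h1 h2
  exact h1.sub h2 (commute_mult_compLeft _ _)
    (commute_mult_compLeft _ _) (commute_mult_compLeft _ _) (commute_mult_compLeft _ _)
    (commute_mult_compLeft _ _) (commute_mult_compLeft _ _)

theorem isNilpotent_jordanN (n : ℕ) : IsNilpotent (jordanN n) := by
  refine ⟨n, (Matrix.toLin' (R := ℝ)).injective ?_⟩
  rw [← toLinHom_apply, map_pow, map_zero, toLinHom_apply]
  refine LinearMap.ext_on (span_ket n) ?_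
  rintro _ ⟨i, rfl⟩
  rw [(isShiftString_ket n).f_pow, ket_eq_zero (by omega), LinearMap.zero_apply]

theorem isNilpotent_DN [NeZero n] (hd : 1 ≤ d) : IsNilpotent (DN n d) := by
  have h1 := (isNilpotent_jordanN n).map (multHom n d)
  have h2 := (isNilpotent_SN (n := n) hd).map (compHom n d)
  rw [multHom_apply] at h1
  rw [compHom_apply] at h2
  exact Commute.isNilpotent_sub (R := Module.End ℝ (VP n d)) (commute_mult_compLeft _ _) h1 h2

/-- `w ↦ w ⊗ v` as a linear map. -/
def tensHom (d : ℕ) (v : Fin n → ℝ) : P n d →ₗ[ℝ] VP n d where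
  toFun w := tens w v
  map_add' _ _ := funext fun _ => smul_add _ _ _
  map_smul' _ _ := funext fun _ => smul_comm _ _ _

theorem tensHom_apply (v : Fin n → ℝ) (w : P n d) : tensHom d v w = tens w v := rfl

theorem tens_smul_left (a : ℝ) (w : P n d) (v : Fin n → ℝ) : tens (a • w) v = a • tens w v :=
  (tensHom d v).map_smul a w

theorem tens_smul_right (a : ℝ) (w : P n d) (v : Fin n → ℝ) : tens w (a • v) = a • tens w v :=
  funext fun c => by simp [tens, smul_smul]

theorem tens_zero_left (v : Fin n → ℝ) : tens (0 : P n d) v = 0 := (tensHom d v).map_zero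

theorem tens_zero_right (w : P n d) : tens w (0 : Fin n → ℝ) = 0 := funext fun c => by simp [tens]

theorem mult_tens (A : Matrix (Fin n) (Fin n) ℝ) (w : P n d) (v : Fin n → ℝ) :
    mult A d (tens w v) = tens w (Matrix.toLin' A v) := by
  funext c
  simp [mult_apply, tens, Matrix.toLin'_apply, Matrix.mulVec, dotProduct, Finset.sum_smul,
    smul_smul]

theorem compLeft_tens (f : Module.End ℝ (P n d)) (w : P n d) (v : Fin n → ℝ) :
    f.compLeft (Fin n) (tens w v) = tens (f w) v := by
  funext c
  simp [tens, LinearMap.compLeft_apply]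

theorem DN_tens_ket (w : P n d) (i : ℕ) :
    DN n d (tens w (ket n i)) = tens w (ket n (i + 1)) - tens (SN n d w) (ket n i) := by
  rw [DN, homOp, LinearMap.sub_apply, mult_tens, compLeft_tens, jordanN_ket]
  rfl

theorem tens_ket_apply (w : P n d) (i : ℕ) (c : Fin n) :
    tens w (ket n i) c = if (c : ℕ) + i + 1 = n then w else 0 := by
  simp [tens, ket]

theorem eq_sum_tens (u : VP n d) : u = ∑ c : Fin n, tens (u c) (ket n (n - 1 - c)) := by
  funext a
  rw [Finset.sum_apply, Finset.sum_eq_single a]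
  · rw [tens_ket_apply, if_pos]
    have := a.2
    omega
  · intro b _ hb
    rw [tens_ket_apply, if_neg]
    have := a.2
    have := b.2
    have : (b : ℕ) ≠ a := fun h => hb (Fin.ext h)
    omega
  · simp

/-! ### Reduction modulo the image of the homological operator -/

/-- Modulo the image of `Δ_N` the tensor `w ⊗ N e` is `S_N w ⊗ e`, so that every polynomial map
reduces to one with only its last component. The reduced map has this last component. -/
def reduce (n d : ℕ) : VP n d →ₗ[ℝ] P n d :=
  ∑ c : Fin n, (SN n d ^ (n - 1 - (c : ℕ))) ∘ₗ LinearMap.proj c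

theorem reduce_tens_ket [NeZero n] (hd : 1 ≤ d) (w : P n d) (i : ℕ) :
    reduce n d (tens w (ket n i)) = (SN n d ^ i) w := by
  rw [reduce, LinearMap.sum_apply]
  by_cases hi : i < n
  · rw [Finset.sum_eq_single ⟨n - 1 - i, by omega⟩]
    · simp only [LinearMap.comp_apply, LinearMap.proj_apply, tens_ket_apply]
      rw [if_pos (by omega), show n - 1 - (n - 1 - i) = i by omega]
    · intro b _ hb
      have : ¬ (b : ℕ) + i + 1 = n := fun h => hb (Fin.ext (by simp; omega))
      simp [tens_ket_apply, this]
    · simp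
  · rw [SN_pow_eq_zero hd (by omega), LinearMap.zero_apply]
    refine Finset.sum_eq_zero fun c _ => ?_
    rw [LinearMap.comp_apply, LinearMap.proj_apply, tens_ket_apply, if_neg (by omega), map_zero]

/-- The reduction to the last component takes place inside every space of polynomial maps with
components in an `S_N`-stable subspace `U`. -/
theorem sub_reduce_mem_map_DN {U : Submodule ℝ (P n d)}
    (hU : ∀ w ∈ U, SN n d w ∈ U) {u : VP n d} (hu : ∀ c, u c ∈ U) :
    u - tens (reduce n d u) (ket n 0) ∈
      (Submodule.pi Set.univ (fun _ => U) : Submodule ℝ (VP n d)).map (DN n d) := by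
  set T := (Submodule.pi Set.univ (fun _ => U) : Submodule ℝ (VP n d)).map (DN n d)
  have hpow : ∀ i, ∀ w ∈ U, (SN n d ^ i) w ∈ U := by
    intro i
    induction i with
    | zero => simp
    | succ i ih => exact fun w hw => by simpa [pow_succ'] using hU _ (ih w hw)
  have htens : ∀ w ∈ U, ∀ i, tens w (ket n i) ∈
      (Submodule.pi Set.univ (fun _ => U) : Submodule ℝ (VP n d)) := fun w hw i c _ =>
    U.smul_mem _ hw
  have key : ∀ i, ∀ w ∈ U, tens w (ket n i) - tens ((SN n d ^ i) w) (ket n 0) ∈ T := by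
    intro i
    induction i with
    | zero => simp
    | succ i ih =>
      intro w hw
      have h1 := ih _ (hU w hw)
      have h2 : DN n d (tens w (ket n i)) ∈ T := Submodule.mem_map_of_mem (htens w hw i)
      rw [DN_tens_ket] at h2
      have := add_mem h2 h1
      rwa [sub_add_sub_cancel, ← Module.End.mul_apply, ← pow_succ] at this
  have hsum : u - tens (reduce n d u) (ket n 0) = ∑ c : Fin n,
      (tens (u c) (ket n (n - 1 - c)) -
        tens ((SN n d ^ (n - 1 - (c : ℕ))) (u c)) (ket n 0)) := by
    rw [Finset.sum_sub_distrib, ← eq_sum_tens]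
    congr 1
    rw [← tensHom_apply, reduce, LinearMap.sum_apply, map_sum]
    rfl
  rw [hsum]
  exact Submodule.sum_mem _ fun c _ => key _ _ (hu c)

theorem range_DN [NeZero n] (hd : 1 ≤ d) :
    LinearMap.range (DN n d) = LinearMap.ker (reduce n d) := by
  refine le_antisymm ?_ fun u hu => ?_
  · rintro _ ⟨u, rfl⟩
    rw [eq_sum_tens u, LinearMap.mem_ker, map_sum, map_sum]
    refine Finset.sum_eq_zero fun c _ => ?_
    rw [DN_tens_ket, map_sub, reduce_tens_ket hd, reduce_tens_ket hd, pow_succ,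
      Module.End.mul_apply, sub_self]
  · have h := sub_reduce_mem_map_DN (U := ⊤) (fun _ _ => trivial) (u := u) fun _ => trivial
    rw [LinearMap.mem_ker.1 hu, tens_zero_left, sub_zero] at h
    exact LinearMap.map_le_range h

/-! ### The last component -/

/-- The last component of a polynomial map. -/
def lastComp (n d : ℕ) [NeZero n] : VP n d →ₗ[ℝ] P n d :=
  LinearMap.proj ⟨n - 1, Nat.sub_lt (NeZero.pos n) one_pos⟩

theorem lastComp_tens_ket [NeZero n] (w : P n d) (i : ℕ) :
    lastComp n d (tens w (ket n i)) = if i = 0 then w else 0 := by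
  have := NeZero.pos n
  rw [lastComp, LinearMap.proj_apply, tens_ket_apply]
  congr 1
  simp
  omega

theorem range_mult_jordanN [NeZero n] :
    LinearMap.range (mult (jordanN n) d) = LinearMap.ker (lastComp n d) := by
  refine le_antisymm ?_ fun u hu => ?_
  · rintro _ ⟨u, rfl⟩
    rw [eq_sum_tens u, LinearMap.mem_ker, map_sum, map_sum]
    refine Finset.sum_eq_zero fun c _ => ?_
    rw [mult_tens, jordanN_ket, lastComp_tens_ket, if_neg (by omega)]
  · rw [eq_sum_tens u]
    refine Submodule.sum_mem _ fun c _ => ?_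
    rcases Nat.eq_zero_or_pos (n - 1 - c) with h | h
    · have hc : c = ⟨n - 1, Nat.sub_lt (NeZero.pos n) one_pos⟩ := Fin.ext (by
        have := c.2
        simp
        omega)
      have : u c = 0 := by
        rw [hc]
        exact hu
      rw [this, tens_zero_left]
      exact zero_mem _
    · refine ⟨tens (u c) (ket n (n - 1 - c - 1)), ?_⟩
      rw [mult_tens, jordanN_ket, Nat.sub_add_cancel h]

theorem mem_ker_mult_jordanM [NeZero n] (u : VP n d) :
    u ∈ LinearMap.ker (mult (jordanM n) d) ↔ ∃ w, u = tens w (ket n 0) := by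
  constructor
  · intro hu
    refine ⟨lastComp n d u, funext fun c => ?_⟩
    rw [tens_ket_apply]
    split_ifs with hc
    · rw [lastComp, LinearMap.proj_apply]
      congr 1
      exact Fin.ext (by simp; omega)
    · have hc' : (c : ℕ) + 1 < n := by
        have := c.2
        omega
      have h := congrFun (LinearMap.mem_ker.1 hu) ⟨c + 1, hc'⟩
      rw [mult_apply, Finset.sum_eq_single c] at h
      · simpa [jordanM, jordanN] using h
      · intro b _ hb
        have : ¬ (b : ℕ) = c := fun h => hb (Fin.ext h)
        simp [jordanM, jordanN, this]
      · simp
  · rintro ⟨w, rfl⟩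
    rw [LinearMap.mem_ker, mult_tens, jordanM_ket_zero, tens_zero_right]

theorem DMbar_apply (u : VP n d) (c : Fin n) :
    DMbar n d u c = ∑ b, barM n (jordanN n) (jordanM n) c b • u b - SMbar n d (u c) := rfl

/-- In `ker Δ_M̄` each component is determined by the next one, because the bar of `M` has nonzero
entries just below the diagonal and no others. -/
theorem eq_zero_of_lastComp_eq_zero [NeZero n] {u : VP n d} (hu : DMbar n d u = 0)
    (hlast : lastComp n d u = 0) : u = 0 := by
  have key : ∀ i, ∀ c : Fin n, (c : ℕ) + i + 1 = n → u c = 0 := by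
    intro i
    induction i with
    | zero =>
      intro c hc
      have : c = ⟨n - 1, Nat.sub_lt (NeZero.pos n) one_pos⟩ := Fin.ext (by simp; omega)
      rw [this]
      exact hlast
    | succ i ih =>
      intro c hc
      have hc' : (c : ℕ) + 1 < n := by omega
      have h := congrFun hu ⟨c + 1, hc'⟩
      rw [DMbar_apply, ih ⟨c + 1, hc'⟩ (by simp; omega), map_zero, sub_zero,
        Finset.sum_eq_single c] at h
      · rw [barM_jordan_apply, if_pos rfl] at h
        refine (smul_eq_zero.1 h).resolve_left (mul_ne_zero ?_ (sub_ne_zero.2 ?_))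
        · exact Nat.cast_ne_zero.2 (Nat.succ_ne_zero c)
        · exact_mod_cast hc'.ne'
      · intro b _ hb
        rw [barM_jordan_apply, if_neg, zero_smul]
        intro h
        simp at h
        exact hb (Fin.ext h.symm)
      · simp
  funext c
  exact key (n - 1 - c) c (by have := c.2; omega)

end Operators

/-! ### Complements of kernels -/

section Complements

variable {E F ι : Type*} [AddCommGroup E] [Module ℝ E] [AddCommGroup F] [Module ℝ F]

theorem isCompl_span_ker {ρ : E →ₗ[ℝ] F} {b : ι → E} (hli : LinearIndependent ℝ (ρ ∘ b))
    (hspan : Submodule.span ℝ (Set.range (ρ ∘ b)) = ⊤) :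
    IsCompl (Submodule.span ℝ (Set.range b)) (LinearMap.ker ρ) := by
  refine IsCompl.of_eq ?_ ?_
  · refine (Submodule.eq_bot_iff _).2 fun u hu => ?_
    obtain ⟨hu1, hu2⟩ := Submodule.mem_inf.1 hu
    obtain ⟨a, rfl⟩ := Finsupp.mem_span_range_iff_exists_finsupp.1 hu1
    rw [LinearMap.mem_ker, Finsupp.sum, map_sum] at hu2
    simp only [map_smul] at hu2
    refine Finset.sum_eq_zero fun x hx => ?_
    simp only [linearIndependent_iff'.1 hli a.support a hu2 x hx, zero_smul]
  · refine eq_top_iff.2 fun u _ => ?_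
    have h : ρ u ∈ Submodule.span ℝ (Set.range (ρ ∘ b)) := hspan ▸ Submodule.mem_top
    rw [Set.range_comp, Submodule.span_image] at h
    obtain ⟨v, hv, hvu⟩ := h
    rw [← add_sub_cancel v u]
    refine Submodule.add_mem_sup hv ?_
    rw [LinearMap.mem_ker, map_sub, hvu, sub_self]

theorem isCompl_range_ker {ρ : E →ₗ[ℝ] F} {s : F →ₗ[ℝ] E} (h : ∀ w, ρ (s w) = w) :
    IsCompl (LinearMap.range s) (LinearMap.ker ρ) := by
  refine IsCompl.of_eq ?_ ?_
  · refine (Submodule.eq_bot_iff _).2 ?_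
    rintro _ ⟨⟨w, rfl⟩, hw⟩
    have : w = 0 := (h w).symm.trans hw
    rw [this, map_zero]
  · refine eq_top_iff.2 fun u _ => ?_
    rw [← add_sub_cancel (s (ρ u)) u]
    refine Submodule.add_mem_sup ⟨_, rfl⟩ ?_
    rw [LinearMap.mem_ker, map_sub, h, sub_self]

theorem projection_eq {p q : Submodule ℝ E} (h : IsCompl p q) {x y : E} (hy : y ∈ p)
    (hxy : x - y ∈ q) : p.projection q h x = y := by
  rw [← sub_add_cancel x y, map_add, Submodule.projection_apply_of_mem_left h hy,
    (Submodule.projection_apply_eq_zero_iff h).2 hxy, zero_add]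

theorem bijOn_projection {p p' q : Submodule ℝ E} (h : IsCompl p q) (h' : IsCompl p' q) :
    Set.BijOn (p.projection q h) p' p := by
  refine ⟨fun x _ => Submodule.projection_apply_mem h x, fun x hx y hy hxy => ?_, fun y hy => ?_⟩
  · have h1 : p.projection q h (x - y) = 0 := by rw [map_sub, hxy, sub_self]
    rw [Submodule.projection_apply_eq_zero_iff] at h1
    exact sub_eq_zero.1 (Submodule.disjoint_def.1 h'.disjoint _ (p'.sub_mem hx hy) h1)
  · obtain ⟨a, ha, b, hb, rfl⟩ :=
      Submodule.mem_sup.1 (h'.sup_eq_top ▸ Submodule.mem_top : y ∈ p' ⊔ q)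
    refine ⟨a, ha, projection_eq h hy ?_⟩
    simpa using q.neg_mem hb

theorem linearIndependent_smul_of_ne_zero {b : ι → F} (hb : LinearIndependent ℝ b) {a : ι → ℝ}
    (ha : ∀ x, a x ≠ 0) : LinearIndependent ℝ fun x => a x • b x :=
  hb.units_smul fun x => Units.mk0 (a x) (ha x)

theorem span_smul_of_ne_zero (b : ι → F) {a : ι → ℝ} (ha : ∀ x, a x ≠ 0) :
    Submodule.span ℝ (Set.range fun x => a x • b x) = Submodule.span ℝ (Set.range b) := by
  refine le_antisymm (Submodule.span_le.2 ?_) (Submodule.span_le.2 ?_)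
  · rintro _ ⟨x, rfl⟩
    exact Submodule.smul_mem _ _ (Submodule.subset_span ⟨x, rfl⟩)
  · rintro _ ⟨x, rfl⟩
    exact (Submodule.smul_mem_iff _ (ha x)).1 (Submodule.subset_span ⟨x, rfl⟩)

theorem iSup_pi_const {κ : Type*} [Finite κ] (A : ι → Submodule ℝ E) :
    (⨆ x, Submodule.pi Set.univ (fun _ : κ => A x)) = Submodule.pi Set.univ fun _ => ⨆ x, A x := by
  classical
  have := Fintype.ofFinite κ
  refine le_antisymm (iSup_le fun x u hu c hc => (le_iSup A x) (hu c hc)) fun u hu => ?_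
  rw [← Finset.univ_sum_single u]
  refine Submodule.sum_mem _ fun c _ => ?_
  have h : LinearMap.single ℝ (fun _ : κ => E) c (u c) ∈
      (⨆ x, A x).map (LinearMap.single ℝ (fun _ : κ => E) c) :=
    Submodule.mem_map_of_mem (hu c trivial)
  rw [Submodule.map_iSup] at h
  have hmono : ∀ x, (A x).map (LinearMap.single ℝ (fun _ : κ => E) c) ≤
      Submodule.pi Set.univ fun _ : κ => A x := ?_
  · exact iSup_mono hmono h
  rintro x _ ⟨y, hy, rfl⟩ b _
  rw [LinearMap.coe_single]
  by_cases hb : b = c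
  · subst hb
    simpa using hy
  · simp [hb]

theorem iSupIndep_pi_const {κ : Type*} [Finite κ] {A : ι → Submodule ℝ E} (hA : iSupIndep A) :
    iSupIndep fun x => Submodule.pi Set.univ (fun _ : κ => A x) := by
  intro x
  have hle : (⨆ y, ⨆ (_ : y ≠ x), Submodule.pi Set.univ (fun _ : κ => A y)) ≤
      Submodule.pi Set.univ fun _ : κ => ⨆ y, ⨆ (_ : y ≠ x), A y :=
    iSup₂_le fun y hy u hu c hc => (le_iSup₂ (f := fun y (_ : y ≠ x) => A y) y hy) (hu c hc)
  refine Submodule.disjoint_def.2 fun u hu hu' => funext fun c => ?_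
  exact Submodule.disjoint_def.1 (hA x) _ (hu c trivial) (hle hu' c trivial)

end Complements

/-! ### Coefficients of transvectants -/

section Coefficients

/-- The coefficient of `S_N^j w ⊗ |n-i⟩` in a transvectant of vectors of weights `b` and `a`. -/
def transvCoeff (a b i j : ℕ) : ℝ :=
  1 / (i ! * j !) * (((i + j).choose i : ℝ) / ((a.choose i : ℝ) * (b.choose j : ℝ)))

variable {a b i j p : ℕ}

theorem transvCoeff_eq (hi : i ≤ a) (hj : j ≤ b) : transvCoeff a b i j =
    (i + j)! * (a - i)! * (b - j)! / (i ! * j ! * a ! * b !) := by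
  have h1 := Nat.factorial_ne_zero
  rw [transvCoeff, Nat.cast_choose ℝ hi, Nat.cast_choose ℝ hj,
    Nat.cast_choose ℝ (Nat.le_add_right i j), Nat.add_sub_cancel_left]
  have hi0 : (i ! : ℝ) ≠ 0 := Nat.cast_ne_zero.2 (h1 _)
  have hj0 : (j ! : ℝ) ≠ 0 := Nat.cast_ne_zero.2 (h1 _)
  have ha0 : (a ! : ℝ) ≠ 0 := Nat.cast_ne_zero.2 (h1 _)
  have hb0 : (b ! : ℝ) ≠ 0 := Nat.cast_ne_zero.2 (h1 _)
  have hai0 : ((a - i)! : ℝ) ≠ 0 := Nat.cast_ne_zero.2 (h1 _)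
  have hbj0 : ((b - j)! : ℝ) ≠ 0 := Nat.cast_ne_zero.2 (h1 _)
  field_simp

theorem transvCoeff_ne_zero (hi : i ≤ a) (hj : j ≤ b) : transvCoeff a b i j ≠ 0 := by
  rw [transvCoeff_eq hi hj]
  positivity

/-- The cancellation which puts a transvectant in the kernel of the raising operator. -/
theorem transvCoeff_succ (hi : i + 1 ≤ a) (hj : j + 1 ≤ b) :
    transvCoeff a b (i + 1) j * ((i + 1) * (a - i)) =
      transvCoeff a b i (j + 1) * ((j + 1) * (b - j)) := by
  rw [transvCoeff_eq hi (by omega), transvCoeff_eq (by omega) hj]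
  obtain ⟨a', rfl⟩ : ∃ a', a = a' + 1 + i := ⟨a - i - 1, by omega⟩
  obtain ⟨b', rfl⟩ : ∃ b', b = b' + 1 + j := ⟨b - j - 1, by omega⟩
  rw [show a' + 1 + i - (i + 1) = a' by omega, show a' + 1 + i - i = a' + 1 by omega,
    show b' + 1 + j - (j + 1) = b' by omega, show b' + 1 + j - j = b' + 1 by omega,
    show i + 1 + j = i + (j + 1) by omega, Nat.factorial_succ a', Nat.factorial_succ b',
    Nat.factorial_succ i, Nat.factorial_succ j]
  push_cast
  field_simp
  ring

theorem sum_choose_mul_choose (α β p : ℕ) :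
    ∑ ij ∈ Finset.HasAntidiagonal.antidiagonal p,
      ((α + ij.2).choose α * (β + ij.1).choose β : ℝ) = ((α + β + 1 + p).choose p : ℝ) := by
  have h := congrArg (PowerSeries.coeff p)
    (pow_add (PowerSeries.mk 1 : PowerSeries ℝ) (β + 1) (α + 1))
  rw [show β + 1 + (α + 1) = (α + β + 1) + 1 by ring, PowerSeries.mk_one_pow_eq_mk_choose_add,
    PowerSeries.mk_one_pow_eq_mk_choose_add, PowerSeries.mk_one_pow_eq_mk_choose_add,
    PowerSeries.coeff_mul] at h
  simp only [PowerSeries.coeff_mk] at h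
  rw [Nat.choose_symm_add] at h
  rw [h]
  exact Finset.sum_congr rfl fun ij _ => mul_comm _ _

theorem sum_transvCoeff (ha : p ≤ a) (hb : p ≤ b) :
    ∑ ij ∈ Finset.HasAntidiagonal.antidiagonal p, transvCoeff a b ij.1 ij.2 =
      ((a + b + 1 - p).choose p : ℝ) / (p ! * a.choose p * b.choose p) := by
  have hterm : ∀ ij ∈ Finset.HasAntidiagonal.antidiagonal p, transvCoeff a b ij.1 ij.2 =
      (1 / (p ! * a.choose p * b.choose p)) *
        (((a - p) + ij.2).choose (a - p) * ((b - p) + ij.1).choose (b - p) : ℝ) := by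
    rintro ⟨i, j⟩ hij
    rw [Finset.HasAntidiagonal.mem_antidiagonal] at hij
    simp only at hij ⊢
    subst hij
    rw [transvCoeff_eq (by omega) (by omega), Nat.cast_choose ℝ ha, Nat.cast_choose ℝ hb,
      Nat.cast_choose ℝ (Nat.le_add_right _ j), Nat.cast_choose ℝ (Nat.le_add_right _ i),
      Nat.add_sub_cancel_left, Nat.add_sub_cancel_left,
      show a - (i + j) + j = a - i by omega, show b - (i + j) + i = b - j by omega]
    have h1 : ∀ m : ℕ, (m ! : ℝ) ≠ 0 := fun m => Nat.cast_ne_zero.2 (Nat.factorial_ne_zero m)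
    field_simp [h1]
  rw [Finset.sum_congr rfl hterm, ← Finset.mul_sum, sum_choose_mul_choose,
    show a - p + (b - p) + 1 + p = a + b + 1 - p by omega]
  ring

theorem sum_transvCoeff_ne_zero (ha : p ≤ a) (hb : p ≤ b) :
    ∑ ij ∈ Finset.HasAntidiagonal.antidiagonal p, transvCoeff a b ij.1 ij.2 ≠ 0 := by
  rw [sum_transvCoeff ha hb]
  have h1 := Nat.choose_pos ha
  have h2 := Nat.choose_pos hb
  have h3 : 0 < (a + b + 1 - p).choose p := Nat.choose_pos (by omega)
  positivity

end Coefficients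

/-! ### Transvectants -/

theorem reduceCoeff_ne_zero {n : ℕ} {m : Fin n} {p : ℕ} (hp : p < n - m) :
    ∑ ij ∈ Finset.HasAntidiagonal.antidiagonal p,
      transvCoeff (n - 1) (n - 1 - m) ij.1 ij.2 ≠ 0 :=
  sum_transvCoeff_ne_zero (by omega) (by omega)

section Transvectants

variable {n d : ℕ}

theorem transv_eq (m p : ℕ) (w : P n d) :
    transv m p w = ∑ ij ∈ Finset.HasAntidiagonal.antidiagonal p,
      transvCoeff (n - 1) (n - 1 - m) ij.1 ij.2 • tens ((SN n d ^ ij.2) w) (ket n ij.1) := by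
  rw [transv, transvectant]
  refine Finset.sum_congr rfl ?_
  rintro ⟨i, j⟩ hij
  rw [Finset.HasAntidiagonal.mem_antidiagonal] at hij
  simp only at hij ⊢
  subst hij
  rw [divPow, divPow, tens_smul_left, tens_smul_right, smul_smul, smul_smul,
    (isShiftString_ket n).f_pow, zero_add, transvCoeff]
  congr 1
  rw [one_div, mul_inv, mul_comm ((n - 1).choose i : ℝ)]
  ring

theorem isShiftString_braSpan [NeZero n] {m : Fin n} {w : P n d} (hw : w ∈ braSpan n d 0 m) :
    IsShiftString (SN n d) (SM n d) (n - m) fun j => (SN n d ^ j) w where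
  f_apply j := by rw [pow_succ', Module.End.mul_apply]
  eq_zero j hj := SN_pow_braSpan_eq_zero hw (by omega)
  y_zero := by
    rw [braSpan_eq_span] at hw
    induction hw using Submodule.span_induction with
    | mem x hx =>
      obtain ⟨g, rfl⟩ := hx
      exact g.isShiftString.y_zero
    | zero => simp
    | add x y _ _ hx hy => rw [map_add, map_add, hx, hy, add_zero]
    | smul a x _ hx => rw [map_smul, map_smul, hx, smul_zero]
  y_succ j hj := by
    rw [braSpan_eq_span] at hw
    induction hw using Submodule.span_induction with
    | mem x hx =>
      obtain ⟨g, rfl⟩ := hx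
      exact g.isShiftString.y_succ j hj
    | zero => simp
    | add x y _ _ hx hy => rw [map_add, map_add, map_add, hx, hy]
    | smul a x _ hx => rw [map_smul, map_smul, map_smul, hx]

theorem lastComp_transv [NeZero n] (m p : ℕ) (w : P n d) :
    lastComp n d (transv m p w) = transvCoeff (n - 1) (n - 1 - m) 0 p • (SN n d ^ p) w := by
  rw [transv_eq, map_sum, Finset.sum_eq_single (0, p)]
  · rw [map_smul, lastComp_tens_ket, if_pos rfl]
  · rintro ⟨i, j⟩ hij hne
    rw [Finset.HasAntidiagonal.mem_antidiagonal] at hij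
    have hi : i ≠ 0 := by
      rintro rfl
      simp only [zero_add] at hij
      exact hne (by rw [hij])
    rw [map_smul, lastComp_tens_ket, if_neg hi, smul_zero]
  · intro h
    exact absurd (by simp) h

theorem reduce_transv [NeZero n] (hd : 1 ≤ d) (m p : ℕ) (w : P n d) :
    reduce n d (transv m p w) = (∑ ij ∈ Finset.HasAntidiagonal.antidiagonal p,
      transvCoeff (n - 1) (n - 1 - m) ij.1 ij.2) • (SN n d ^ p) w := by
  rw [transv_eq, map_sum, Finset.sum_smul]
  refine Finset.sum_congr rfl ?_
  rintro ⟨i, j⟩ hij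
  rw [Finset.HasAntidiagonal.mem_antidiagonal] at hij
  simp only at hij ⊢
  rw [map_smul, reduce_tens_ket hd, ← Module.End.mul_apply, ← pow_add, hij]

theorem DMbar_tens_string [NeZero n] {m : Fin n} {w : P n d} (hw : w ∈ braSpan n d 0 m) {i j : ℕ}
    (hi : i < n) (hj : j < n - m) :
    DMbar n d (tens ((SN n d ^ j) w) (ket n i)) =
      ((i : ℝ) * ((n : ℝ) - i)) • tens ((SN n d ^ j) w) (ket n (i - 1)) -
      ((j : ℝ) * (((n - m : ℕ) : ℝ) - j)) • tens ((SN n d ^ (j - 1)) w) (ket n i) := by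
  rw [DMbar, LinearMap.sub_apply, mult_tens, compLeft_tens, barM_ket hi, tens_smul_right,
    ← tens_smul_left ((j : ℝ) * _)]
  congr 2
  exact (isShiftString_braSpan hw).barM_apply (Nat.sub_le _ _) hj

theorem DHbar_tens_string [NeZero n] {m : Fin n} {w : P n d} (hw : w ∈ braSpan n d 0 m) {i j : ℕ}
    (hi : i < n) (hj : j < n - m) :
    DHbar n d (tens ((SN n d ^ j) w) (ket n i)) =
      (((n : ℝ) - 1 - 2 * i) + (((n - m : ℕ) : ℝ) - 1 - 2 * j)) •
        tens ((SN n d ^ j) w) (ket n i) := by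
  rw [DHbar, LinearMap.add_apply, mult_tens, compLeft_tens, barH_ket hi, tens_smul_right,
    add_smul, ← tens_smul_left ((((n - m : ℕ) : ℝ) - 1 - 2 * j))]
  congr 2
  exact (isShiftString_braSpan hw).barH_apply (Nat.sub_le _ _) hj

theorem DMbar_transv [NeZero n] {m : Fin n} {w : P n d} (hw : w ∈ braSpan n d 0 m) {p : ℕ}
    (hp : p < n - m) : DMbar n d (transv m p w) = 0 := by
  rw [transv_eq, map_sum]
  have hterm : ∀ ij ∈ Finset.HasAntidiagonal.antidiagonal p,
      DMbar n d (transvCoeff (n - 1) (n - 1 - m) ij.1 ij.2 •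
        tens ((SN n d ^ ij.2) w) (ket n ij.1)) =
      (transvCoeff (n - 1) (n - 1 - m) ij.1 ij.2 * ((ij.1 : ℝ) * ((n : ℝ) - ij.1))) •
        tens ((SN n d ^ ij.2) w) (ket n (ij.1 - 1)) -
      (transvCoeff (n - 1) (n - 1 - m) ij.1 ij.2 * ((ij.2 : ℝ) * (((n - m : ℕ) : ℝ) - ij.2))) •
        tens ((SN n d ^ (ij.2 - 1)) w) (ket n ij.1) := by
    rintro ⟨i, j⟩ hij
    rw [Finset.HasAntidiagonal.mem_antidiagonal] at hij
    simp only at hij ⊢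
    rw [map_smul, DMbar_tens_string hw (by omega) (by omega), smul_sub, smul_smul, smul_smul]
  rw [Finset.sum_congr rfl hterm, Finset.sum_sub_distrib]
  rcases p with _ | q
  · simp
  -- after a shift of the summation index the two sums agree term by term
  rw [Finset.Nat.sum_antidiagonal_succ, Finset.Nat.sum_antidiagonal_succ', sub_eq_zero]
  simp only [Nat.cast_zero, zero_mul, mul_zero, zero_smul, zero_add,
    Nat.add_sub_cancel]
  refine Finset.sum_congr rfl ?_
  rintro ⟨i, j⟩ hij
  rw [Finset.HasAntidiagonal.mem_antidiagonal] at hij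
  simp only at hij ⊢
  have h1 : ((n - m : ℕ) : ℝ) = ((n - 1 - m : ℕ) : ℝ) + 1 := by
    rw [show n - (m : ℕ) = n - 1 - m + 1 by omega]
    push_cast
    rfl
  have h2 : (n : ℝ) = ((n - 1 : ℕ) : ℝ) + 1 := by
    rw [Nat.cast_sub (NeZero.pos n)]
    simp
  have h := transvCoeff_succ (a := n - 1) (b := n - 1 - m) (i := i) (j := j) (by omega) (by omega)
  congr 1
  rw [h1, h2]
  push_cast
  convert h using 2 <;> ring

theorem DHbar_transv [NeZero n] {m : Fin n} {w : P n d} (hw : w ∈ braSpan n d 0 m) {p : ℕ}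
    (hp : p < n - m) :
    DHbar n d (transv m p w) = (((n - 1 - m) + (n - 1) - 2 * p : ℕ) : ℝ) • transv m p w := by
  rw [transv_eq, map_sum, Finset.smul_sum]
  refine Finset.sum_congr rfl ?_
  rintro ⟨i, j⟩ hij
  rw [Finset.HasAntidiagonal.mem_antidiagonal] at hij
  simp only at hij ⊢
  subst hij
  rw [map_smul, DHbar_tens_string hw (by omega) (by omega), smul_comm]
  congr 1
  rw [show n - (m : ℕ) = n - 1 - m + 1 by omega,
    Nat.cast_sub (show 2 * (i + j) ≤ n - 1 - m + (n - 1) by omega)]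
  have h2 : (n : ℝ) = ((n - 1 : ℕ) : ℝ) + 1 := by
    rw [Nat.cast_sub (NeZero.pos n)]
    simp
  rw [h2]
  push_cast
  ring

theorem transv_eq_sum (m p : ℕ) (w : P n d) :
    transv m p w = ∑ ij ∈ Finset.HasAntidiagonal.antidiagonal p,
      ((1 : ℝ) / ((ij.1)! * (ij.2)!) * ((p.choose ij.1 : ℝ) /
        (((n - 1).choose ij.1 : ℝ) * ((n - 1 - m).choose ij.2 : ℝ)))) •
        tens ((SN n d ^ ij.2) w) (ket n ij.1) := by
  rw [transv_eq]
  refine Finset.sum_congr rfl fun ij hij => ?_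
  rw [transvCoeff, Finset.HasAntidiagonal.mem_antidiagonal.1 hij]

variable [NeZero n]

theorem Gen.poly_mem_braSpan {m : Fin n} (g : Gen n d m) : g.poly ∈ braSpan n d 0 m :=
  Submodule.subset_span ⟨g.1, g.2.2, rfl⟩

/-- The transvectants of the monomials, indexed by the basis of strings of monomials. -/
def transvVec (x : StringIdx n d) : VP n d := transv x.1 x.2.2 x.2.1.poly

theorem lastComp_comp_transvVec : lastComp n d ∘ transvVec = fun x : StringIdx n d =>
    transvCoeff (n - 1) (n - 1 - x.1) 0 x.2.2 • stringVec x :=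
  funext fun _ => lastComp_transv _ _ _

theorem reduce_comp_transvVec (hd : 1 ≤ d) : reduce n d ∘ transvVec = fun x : StringIdx n d =>
    (∑ ij ∈ Finset.HasAntidiagonal.antidiagonal (x.2.2 : ℕ),
      transvCoeff (n - 1) (n - 1 - x.1) ij.1 ij.2) • stringVec x :=
  funext fun _ => reduce_transv hd _ _ _

theorem lastCoeff_ne_zero (x : StringIdx n d) :
    transvCoeff (n - 1) (n - 1 - x.1) 0 x.2.2 ≠ 0 :=
  transvCoeff_ne_zero (Nat.zero_le _) (by have := x.2.2.2; omega)

theorem DMbar_transvVec (x : StringIdx n d) : DMbar n d (transvVec x) = 0 :=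
  DMbar_transv x.2.1.poly_mem_braSpan x.2.2.2

theorem linearIndependent_lastComp_transvVec :
    LinearIndependent ℝ (lastComp n d ∘ transvVec) := by
  rw [lastComp_comp_transvVec]
  exact linearIndependent_smul_of_ne_zero linearIndependent_stringVec lastCoeff_ne_zero

theorem span_lastComp_transvVec (hd : 1 ≤ d) :
    Submodule.span ℝ (Set.range (lastComp n d ∘ transvVec)) = ⊤ := by
  rw [lastComp_comp_transvVec, span_smul_of_ne_zero _ lastCoeff_ne_zero, span_stringVec hd]

theorem linearIndependent_transvVec : LinearIndependent ℝ (transvVec (n := n) (d := d)) :=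
  LinearIndependent.of_comp (lastComp n d) linearIndependent_lastComp_transvVec

/-- The transvectants span `ker Δ_M̄`: an element of the kernel is determined by its last
component, and the last components of the transvectants are multiples of the monomials. -/
theorem span_transvVec (hd : 1 ≤ d) :
    Submodule.span ℝ (Set.range (transvVec (n := n) (d := d))) = LinearMap.ker (DMbar n d) := by
  have hle : Submodule.span ℝ (Set.range (transvVec (n := n) (d := d))) ≤
      LinearMap.ker (DMbar n d) := by
    refine Submodule.span_le.2 ?_
    rintro _ ⟨x, rfl⟩
    exact DMbar_transvVec x
  refine le_antisymm hle fun u hu => ?_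
  have h : lastComp n d u ∈ Submodule.span ℝ (Set.range (lastComp n d ∘ transvVec)) := by
    rw [span_lastComp_transvVec hd]
    exact Submodule.mem_top
  rw [Set.range_comp, Submodule.span_image] at h
  obtain ⟨v, hv, hvu⟩ := h
  have h0 : u - v = 0 := by
    refine eq_zero_of_lastComp_eq_zero ?_ ?_
    · rw [map_sub, LinearMap.mem_ker.1 hu, LinearMap.mem_ker.1 (hle hv), sub_zero]
    · rw [map_sub, hvu, sub_self]
  rwa [sub_eq_zero.1 h0]

theorem isCompl_ker_DMbar_range_DN (hd : 1 ≤ d) :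
    IsCompl (LinearMap.ker (DMbar n d)) (LinearMap.range (DN n d)) := by
  have hc := fun x : StringIdx n d => reduceCoeff_ne_zero x.2.2.2
  rw [← span_transvVec hd, range_DN hd]
  refine isCompl_span_ker ?_ ?_
  · rw [reduce_comp_transvVec hd]
    exact linearIndependent_smul_of_ne_zero linearIndependent_stringVec hc
  · rw [reduce_comp_transvVec hd, span_smul_of_ne_zero _ hc, span_stringVec hd]

theorem isCompl_ker_DMbar_range_mult (hd : 1 ≤ d) :
    IsCompl (LinearMap.ker (DMbar n d)) (LinearMap.range (mult (jordanN n) d)) := by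
  rw [← span_transvVec hd, range_mult_jordanN]
  exact isCompl_span_ker linearIndependent_lastComp_transvVec (span_lastComp_transvVec hd)

theorem ker_mult_jordanM : LinearMap.ker (mult (jordanM n) d) =
    LinearMap.range (tensHom d (ket n 0)) := by
  ext u
  rw [mem_ker_mult_jordanM]
  exact ⟨fun ⟨w, h⟩ => ⟨w, h.symm⟩, fun ⟨w, h⟩ => ⟨w, h.symm⟩⟩

theorem isCompl_ker_mult_range_DN (hd : 1 ≤ d) :
    IsCompl (LinearMap.ker (mult (jordanM n) d)) (LinearMap.range (DN n d)) := by
  rw [ker_mult_jordanM, range_DN hd]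
  refine isCompl_range_ker fun w => ?_
  simpa [tensHom_apply] using reduce_tens_ket hd w 0

theorem isCompl_ker_mult_range_mult :
    IsCompl (LinearMap.ker (mult (jordanM n) d)) (LinearMap.range (mult (jordanN n) d)) := by
  rw [ker_mult_jordanM, range_mult_jordanN]
  refine isCompl_range_ker fun w => ?_
  simpa [tensHom_apply] using lastComp_tens_ket w 0

theorem projection_ker_DMbar (hd : 1 ≤ d)
    (h : IsCompl (LinearMap.ker (DMbar n d)) (LinearMap.range (DN n d))) {m : Fin n} {w : P n d}
    (hw : w ∈ braSpan n d 0 m) (i j : ℕ) :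
    Submodule.projection _ _ h (tens ((SN n d ^ j) w) (ket n i)) =
      (((i + j)! * (n - 1).choose (i + j) * (n - 1 - m).choose (i + j) : ℝ) /
        ((n + (n - m) - (i + j) - 1).choose (i + j) : ℝ)) • transv m (i + j) w := by
  have hred : reduce n d (tens ((SN n d ^ j) w) (ket n i)) = (SN n d ^ (i + j)) w := by
    rw [reduce_tens_ket hd, ← Module.End.mul_apply, ← pow_add]
  by_cases hp : i + j < n - m
  · refine projection_eq h ?_ ?_
    · exact Submodule.smul_mem _ _ (DMbar_transv hw hp)
    · rw [range_DN hd, LinearMap.mem_ker, map_sub, map_smul, hred, reduce_transv hd, smul_smul,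
        sum_transvCoeff (by omega) (by omega),
        show n - 1 + (n - 1 - m) + 1 - (i + j) = n + (n - m) - (i + j) - 1 by omega]
      have h1 : ((n + (n - m) - (i + j) - 1).choose (i + j) : ℝ) ≠ 0 :=
        Nat.cast_ne_zero.2 (Nat.choose_pos (by omega)).ne'
      have h2 : ((n - 1).choose (i + j) : ℝ) ≠ 0 :=
        Nat.cast_ne_zero.2 (Nat.choose_pos (by omega)).ne'
      have h3 : ((n - 1 - m).choose (i + j) : ℝ) ≠ 0 :=
        Nat.cast_ne_zero.2 (Nat.choose_pos (by omega)).ne'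
      have h4 : ((i + j)! : ℝ) ≠ 0 := Nat.cast_ne_zero.2 (Nat.factorial_ne_zero _)
      rw [div_mul_div_cancel₀ h1, div_self (mul_ne_zero (mul_ne_zero h4 h2) h3), one_smul,
        sub_self]
  · have hm := m.2
    rw [Nat.choose_eq_zero_of_lt (show n - 1 - (m : ℕ) < i + j by omega)]
    simp only [Nat.cast_zero, mul_zero, zero_div, zero_smul]
    rw [Submodule.projection_apply_eq_zero_iff, range_DN hd, LinearMap.mem_ker, hred,
      SN_pow_braSpan_eq_zero hw (by omega)]

theorem projection_ker_mult
    (h : IsCompl (LinearMap.ker (mult (jordanM n) d)) (LinearMap.range (mult (jordanN n) d)))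
    {m : Fin n} (w : P n d) {p : ℕ} (hp : p < n - m) :
    Submodule.projection _ _ h (transv m p w) =
      (((n - 1 - m - p)! : ℝ) / ((n - 1 - m)! : ℝ)) • tens ((SN n d ^ p) w) (ket n 0) := by
  refine projection_eq h ?_ ?_
  · exact Submodule.smul_mem _ _ ((mem_ker_mult_jordanM _).2 ⟨_, rfl⟩)
  · rw [range_mult_jordanN, LinearMap.mem_ker, map_sub, map_smul, lastComp_transv,
      lastComp_tens_ket, if_pos rfl, transvCoeff_eq (Nat.zero_le _) (by omega), sub_eq_zero]
    congr 1
    have h1 : ∀ m : ℕ, (m ! : ℝ) ≠ 0 := fun m => Nat.cast_ne_zero.2 (Nat.factorial_ne_zero m)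
    simp only [zero_add, Nat.sub_zero, Nat.factorial_zero, Nat.cast_one, one_mul]
    field_simp [h1]

/-! ### The Clebsch-Gordan decomposition -/

theorem transv_mem_pi {m : Fin n} (g : Gen n d m) (p : ℕ) :
    transv m p g.poly ∈
      (Submodule.pi Set.univ (fun _ => orbit (SN n d) g.poly) : Submodule ℝ (VP n d)) := by
  rw [transv_eq]
  refine Submodule.sum_mem _ fun ij _ => Submodule.smul_mem _ _ fun c _ => ?_
  exact Submodule.smul_mem _ _ (Submodule.subset_span ⟨_, rfl⟩)

theorem isDirectSum_orbit_transv (hd : 1 ≤ d) (m : Fin n) (g : Gen n d m) :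
    IsDirectSum (fun p : Fin (n - m) => orbit (DN n d) (transv m p g.poly))
      (Submodule.pi Set.univ (fun _ => orbit (SN n d) g.poly) : Submodule ℝ (VP n d)) := by
  set T : Submodule ℝ (VP n d) := Submodule.pi Set.univ (fun _ => orbit (SN n d) g.poly) with hT
  have hU : ∀ w ∈ orbit (SN n d) g.poly, SN n d w ∈ orbit (SN n d) g.poly :=
    fun w hw => map_mem_orbit _ _ hw
  constructor
  · refine iSupIndep_orbit (sl2Relations_homOp hd) (isNilpotent_DN hd)
      (fun p => DMbar_transv g.poly_mem_braSpan p.2)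
      (fun p => DHbar_transv g.poly_mem_braSpan p.2) ?_
    exact linearIndependent_transvVec.comp (fun p : Fin (n - m) => (⟨m, g, p⟩ : StringIdx n d))
      fun p q h => by simpa using h
  · refine le_antisymm (iSup_le fun p => orbit_le (transv_mem_pi g p) ?_)
      (le_iSup_orbit (isNilpotent_DN hd) ?_)
    · intro u hu c _
      have h1 : mult (jordanN n) d u c ∈ orbit (SN n d) g.poly := by
        rw [mult_apply]
        exact Submodule.sum_mem _ fun b _ => Submodule.smul_mem _ _ (hu b trivial)
      exact Submodule.sub_mem _ h1 (hU _ (hu c trivial))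
    · set K := Submodule.span ℝ (Set.range fun p : Fin (n - m) => transv m p g.poly) ⊔
        T.map (DN n d) with hK
      have hred : ∀ u ∈ T, u - tens (reduce n d u) (ket n 0) ∈ K := fun u hu =>
        Submodule.mem_sup_right (sub_reduce_mem_map_DN hU fun c => hu c trivial)
      have hlast : orbit (SN n d) g.poly ≤ K.comap (tensHom d (ket n 0)) := by
        refine Submodule.span_le.2 ?_
        rintro _ ⟨p, rfl⟩
        change tens ((SN n d ^ p) g.poly) (ket n 0) ∈ K
        by_cases hp : p < n - m
        · have h1 := hred _ (transv_mem_pi g p)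
          rw [reduce_transv hd, tens_smul_left] at h1
          have h2 : transv m p g.poly ∈ K :=
            Submodule.mem_sup_left (Submodule.subset_span ⟨⟨p, hp⟩, rfl⟩)
          have h3 := sub_mem h2 h1
          rw [sub_sub_cancel] at h3
          exact (Submodule.smul_mem_iff _ (reduceCoeff_ne_zero hp)).1 h3
        · rw [SN_pow_braSpan_eq_zero g.poly_mem_braSpan (by omega), tens_zero_left]
          exact zero_mem _
      intro u hu
      rw [← sub_add_cancel u (tens (reduce n d u) (ket n 0))]
      refine add_mem (hred u hu) (hlast ?_)
      rw [reduce, LinearMap.sum_apply]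
      refine Submodule.sum_mem _ fun c _ => ?_
      have hpow : ∀ i, ∀ w ∈ orbit (SN n d) g.poly, (SN n d ^ i) w ∈ orbit (SN n d) g.poly := by
        intro i
        induction i with
        | zero => simp
        | succ i ih => exact fun w hw => by simpa [pow_succ'] using hU _ (ih w hw)
      exact hpow _ _ (hu c trivial)

theorem isSl2Irrep_orbit_transv (hd : 1 ≤ d) (m : Fin n) (g : Gen n d m) (p : Fin (n - m)) :
    IsSl2Irrep (DMbar n d) (DHbar n d) (DN n d) ((n - 1 - m) + (n - 1) - 2 * p)
      (orbit (DN n d) (transv m p g.poly)) :=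
  isSl2Irrep_orbit (sl2Relations_homOp hd) (isNilpotent_DN hd)
    (DMbar_transv g.poly_mem_braSpan p.2) (DHbar_transv g.poly_mem_braSpan p.2)
    (linearIndependent_transvVec.ne_zero (⟨m, g, p⟩ : StringIdx n d))

theorem isDirectSum_pi_orbit (hd : 1 ≤ d) :
    IsDirectSum (fun x : Σ m : Fin n, Gen n d m =>
      (Submodule.pi Set.univ (fun _ => orbit (SN n d) x.2.poly) : Submodule ℝ (VP n d))) ⊤ := by
  obtain ⟨h1, h2⟩ := isDirectSum_orbit_poly (n := n) hd
  refine ⟨iSupIndep_pi_const h1, ?_⟩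
  rw [iSup_pi_const, h2]
  exact Submodule.pi_top _

theorem isDirectSum_orbit_transvVec (hd : 1 ≤ d) :
    IsDirectSum (fun x : StringIdx n d => orbit (DN n d) (transvVec x)) ⊤ := by
  refine ⟨iSupIndep_orbit (sl2Relations_homOp hd) (isNilpotent_DN hd) DMbar_transvVec
    (fun x => DHbar_transv x.2.1.poly_mem_braSpan x.2.2.2) linearIndependent_transvVec, ?_⟩
  rw [eq_top_iff, ← (isDirectSum_pi_orbit (n := n) hd).2]
  refine iSup_le fun x => ?_
  rw [← (isDirectSum_orbit_transv hd x.1 x.2).2]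
  exact iSup_le fun p => le_iSup (fun x : StringIdx n d => orbit (DN n d) (transvVec x))
    ⟨x.1, x.2, p⟩

end Transvectants

/-! ### Homogeneous parts of power series -/

section HomPart

variable {n : ℕ}

theorem coeff_homPart (d : ℕ) (f : MvPowerSeries (Fin n) ℝ) (s : Fin n →₀ ℕ) :
    MvPolynomial.coeff s (homPart d f : MvPolynomial (Fin n) ℝ) =
      if s.degree = d then MvPowerSeries.coeff s f else 0 := by
  simp only [homPart, MvPolynomial.coeff_sum, MvPolynomial.coeff_monomial, Finset.sum_ite_eq',
    Finset.mem_finsuppAntidiag, Finset.subset_univ, and_true, Finsupp.degree_eq_sum]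

theorem homPart_ext {d : ℕ} {u v : P n d}
    (h : ∀ s, MvPolynomial.coeff s (u : MvPolynomial (Fin n) ℝ) =
      MvPolynomial.coeff s (v : MvPolynomial (Fin n) ℝ)) : u = v :=
  Subtype.ext (MvPolynomial.ext _ _ h)

/-- `homPart d` as a linear map. -/
def homPartHom (n d : ℕ) : MvPowerSeries (Fin n) ℝ →ₗ[ℝ] P n d where
  toFun := homPart d
  map_add' f g := homPart_ext fun s => by
    simp only [Submodule.coe_add, MvPolynomial.coeff_add, coeff_homPart, map_add]
    split_ifs <;> simp
  map_smul' a f := homPart_ext fun s => by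
    simp only [RingHom.id_apply, Submodule.coe_smul, MvPolynomial.coeff_smul, coeff_homPart,
      MvPowerSeries.coeff_smul]
    split_ifs <;> simp

theorem homPartHom_apply (d : ℕ) (f : MvPowerSeries (Fin n) ℝ) : homPartHom n d f = homPart d f :=
  rfl

theorem homPart_add (d : ℕ) (f g : MvPowerSeries (Fin n) ℝ) :
    homPart d (f + g) = homPart d f + homPart d g := (homPartHom n d).map_add f g

theorem homPart_zero (d : ℕ) : homPart d (0 : MvPowerSeries (Fin n) ℝ) = 0 :=
  (homPartHom n d).map_zero

theorem powerSeries_ext {f g : MvPowerSeries (Fin n) ℝ}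
    (h0 : MvPowerSeries.constantCoeff f = MvPowerSeries.constantCoeff g)
    (h : ∀ d, 1 ≤ d → homPart d f = homPart d g) : f = g := by
  ext s
  by_cases hs : s = 0
  · subst hs
    simpa using h0
  · have hd : 1 ≤ s.degree := by
      by_contra hlt
      exact hs ((Finsupp.degree_eq_zero_iff s).1 (by omega))
    have := congrArg (fun u : P n s.degree => MvPolynomial.coeff s u.1) (h _ hd)
    simpa only [coeff_homPart, if_true] using this

theorem coeff_eq_zero_of_homPart {d : ℕ} {f : MvPowerSeries (Fin n) ℝ} (h : homPart d f = 0)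
    {s : Fin n →₀ ℕ} (hs : s.degree = d) : MvPowerSeries.coeff s f = 0 := by
  have := congrArg (fun u : P n d => MvPolynomial.coeff s u.1) h
  simp only [coeff_homPart, if_pos hs] at this
  exact this

theorem homPart_monomial {d : ℕ} {s : Fin n →₀ ℕ} (hs : s.degree = d) :
    (homPart d (MvPowerSeries.monomial s (1 : ℝ)) : MvPolynomial (Fin n) ℝ) =
      MvPolynomial.monomial s 1 := by
  ext t
  rw [coeff_homPart, MvPowerSeries.coeff_monomial, MvPolynomial.coeff_monomial]
  split_ifs with h1 h2 h3 h3 h2 <;> first | rfl | exact absurd (Eq.symm ‹_›) ‹_› | skip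
  subst h2
  exact absurd hs h1

theorem coe_homPart_one_linMap (A : Matrix (Fin n) (Fin n) ℝ) (i : Fin n) :
    (homPart 1 (linMap A i) : MvPolynomial (Fin n) ℝ) = linForm A i := by
  ext s
  rw [coeff_homPart, linMap, MvPolynomial.coeff_coe]
  split_ifs with h
  · rfl
  · by_contra hne
    refine h ?_
    rw [Finsupp.degree_eq_weight_one]
    exact linForm_isHomogeneous A i (Ne.symm hne)

theorem homPart_linMap {d : ℕ} (hd : d ≠ 1) (A : Matrix (Fin n) (Fin n) ℝ) (i : Fin n) :
    homPart d (linMap A i) = 0 := by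
  refine homPart_ext fun s => ?_
  rw [coeff_homPart, linMap, MvPolynomial.coeff_coe]
  split_ifs with h
  · by_contra hne
    refine hd ?_
    rw [← h, Finsupp.degree_eq_weight_one]
    exact linForm_isHomogeneous A i hne
  · rfl

theorem constantCoeff_linMap (A : Matrix (Fin n) (Fin n) ℝ) (i : Fin n) :
    MvPowerSeries.constantCoeff (linMap A i) = 0 := by
  have h := congrArg (fun u : P n 0 => MvPolynomial.coeff 0 u.1)
    (homPart_linMap zero_ne_one A i)
  simpa [coeff_homPart] using h

/-- Being in normal form is a condition on the nonlinear part. -/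
theorem isNormalForm_add_iff {A : Matrix (Fin n) (Fin n) ℝ} {K : ∀ d, Submodule ℝ (VP n d)}
    (hK : ∀ d, 2 ≤ d → IsCompl (LinearMap.range (homOp A d)) (K d))
    (r : Fin n → MvPowerSeries (Fin n) ℝ) :
    IsNormalForm A K (linMap A + r) ↔ (∀ i, MvPowerSeries.constantCoeff (r i) = 0) ∧
      (∀ i, homPart 1 (r i) = 0) ∧ ∀ d, 2 ≤ d → (fun i => homPart d (r i)) ∈ K d := by
  have hpart : ∀ d, 2 ≤ d → (fun i => homPart d ((linMap A + r) i)) = fun i => homPart d (r i) :=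
    fun d hd => funext fun i => by
      rw [Pi.add_apply, homPart_add, homPart_linMap (by omega), zero_add]
  constructor
  · rintro ⟨h1, h2, -, h4⟩
    refine ⟨fun i => ?_, fun i => ?_, fun d hd => ?_⟩
    · simpa [constantCoeff_linMap] using h1 i
    · have h := h2 i
      rw [Pi.add_apply, homPart_add, Submodule.coe_add, coe_homPart_one_linMap] at h
      exact Subtype.ext (by simpa using h)
    · rw [← hpart d hd]
      exact h4 d hd
  · rintro ⟨h1, h2, h3⟩
    refine ⟨fun i => ?_, fun i => ?_, hK, fun d hd => ?_⟩
    · simpa [constantCoeff_linMap] using h1 i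
    · rw [Pi.add_apply, homPart_add, h2, add_zero, coe_homPart_one_linMap]
    · rw [hpart d hd]
      exact h3 d hd

end HomPart

/-! ### Series of monomials with given lowest and highest index -/

section Bracket

variable {n : ℕ}

/-- The inclusion of `m + 1` consecutive variables, starting with the one of index `j`. -/
def windowEmb {j m : ℕ} (h : j + m < n) : Fin (m + 1) ↪ Fin n where
  toFun b := ⟨j + b, by have := b.2; omega⟩
  inj' a b hab := Fin.ext (by simpa using hab)

@[simp]
theorem windowEmb_val {j m : ℕ} (h : j + m < n) (b : Fin (m + 1)) :
    (windowEmb h b : ℕ) = j + b := rfl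

/-- The exponent of `x_j x_{j+m}`, and of `x_j` if `m = 0`. -/
def endsExp {j m : ℕ} (h : j + m < n) : Fin n →₀ ℕ :=
  if m = 0 then Finsupp.single ⟨j, by omega⟩ 1
  else Finsupp.single ⟨j, by omega⟩ 1 + Finsupp.single ⟨j + m, h⟩ 1

/-- The exponents which occur in `bracket n j m F`. -/
def braExp {j m : ℕ} (h : j + m < n) (t : Fin (m + 1) →₀ ℕ) : Fin n →₀ ℕ :=
  endsExp h + t.embDomain (windowEmb h)

variable {j m : ℕ} (h : j + m < n)

theorem braExp_injective : Function.Injective (braExp h) := fun _ _ hst =>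
  Finsupp.embDomain_injective _ (add_left_cancel hst)

theorem braExp_windowEmb (t : Fin (m + 1) →₀ ℕ) (b : Fin (m + 1)) :
    braExp h t (windowEmb h b) = t b + if (b : ℕ) = 0 ∨ (b : ℕ) = m then 1 else 0 := by
  rw [braExp, Finsupp.add_apply, Finsupp.embDomain_apply_self, add_comm]
  congr 1
  have hb := b.2
  by_cases hm : m = 0
  · rw [endsExp, if_pos hm, Finsupp.single_apply, if_pos, if_pos (by omega)]
    exact Fin.ext (by simp; omega)
  · rw [endsExp, if_neg hm, Finsupp.add_apply, Finsupp.single_apply, Finsupp.single_apply]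
    simp only [windowEmb_val, Fin.ext_iff]
    split_ifs <;> first | rfl | omega

theorem mem_range_windowEmb (a : Fin n) :
    a ∈ Set.range (windowEmb h) ↔ j ≤ (a : ℕ) ∧ (a : ℕ) ≤ j + m := by
  constructor
  · rintro ⟨b, rfl⟩
    have := b.2
    rw [windowEmb_val]
    omega
  · rintro ⟨h1, h2⟩
    exact ⟨⟨a - j, by omega⟩, Fin.ext (by rw [windowEmb_val]; simp only; omega)⟩

theorem braExp_of_notMem (t : Fin (m + 1) →₀ ℕ) {a : Fin n} (ha : a ∉ Set.range (windowEmb h)) :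
    braExp h t a = 0 := by
  rw [braExp, Finsupp.add_apply, Finsupp.embDomain_of_notMem_range _ _ _ ha, add_zero]
  rw [mem_range_windowEmb] at ha
  rw [endsExp]
  have h1 : ¬ (⟨j, by omega⟩ : Fin n) = a := fun hc => ha (by rw [← hc]; simp)
  have h2 : ¬ (⟨j + m, h⟩ : Fin n) = a := fun hc => ha (by rw [← hc]; simp)
  split_ifs with hm
  · rw [Finsupp.single_apply, if_neg h1]
  · rw [Finsupp.add_apply, Finsupp.single_apply, Finsupp.single_apply, if_neg h1, if_neg h2,
      add_zero]

theorem isBra_braExp (t : Fin (m + 1) →₀ ℕ) :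
    IsBra ⟨j, by omega⟩ ⟨j + m, h⟩ (braExp h t) := by
  have h0 : windowEmb h 0 = ⟨j, by omega⟩ := rfl
  have h1 : windowEmb h (Fin.last m) = ⟨j + m, h⟩ := rfl
  refine ⟨?_, ?_, fun i hi => braExp_of_notMem h t ?_, fun i hi => braExp_of_notMem h t ?_⟩
  · rw [← h0, braExp_windowEmb]
    simp
  · rw [← h1, braExp_windowEmb]
    simp
  · rw [Fin.lt_def] at hi
    rw [mem_range_windowEmb]
    simp at hi
    omega
  · rw [gt_iff_lt, Fin.lt_def] at hi
    rw [mem_range_windowEmb]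
    simp at hi
    omega

theorem exists_braExp_eq {s : Fin n →₀ ℕ} (hs : IsBra ⟨j, by omega⟩ ⟨j + m, h⟩ s) :
    ∃ t, braExp h t = s := by
  refine ⟨Finsupp.equivFunOnFinite.symm fun b =>
    s (windowEmb h b) - if (b : ℕ) = 0 ∨ (b : ℕ) = m then 1 else 0, ?_⟩
  ext a
  by_cases ha : a ∈ Set.range (windowEmb h)
  · obtain ⟨b, rfl⟩ := ha
    rw [braExp_windowEmb, Finsupp.equivFunOnFinite_symm_apply_apply]
    refine Nat.sub_add_cancel ?_
    split_ifs with hb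
    · rcases hb with hb | hb
      · have : windowEmb h b = ⟨j, by omega⟩ := Fin.ext (by simp [hb])
        rw [this]
        exact hs.1
      · have : windowEmb h b = ⟨j + m, h⟩ := Fin.ext (by simp [hb])
        rw [this]
        exact hs.2.1
    · exact Nat.zero_le _
  · rw [braExp_of_notMem h _ ha]
    rw [mem_range_windowEmb] at ha
    rcases Nat.lt_or_ge a j with h1 | h1
    · exact (hs.2.2.1 a h1).symm
    · refine (hs.2.2.2 a ?_).symm
      rw [gt_iff_lt, Fin.lt_def]
      simp
      omega

theorem shiftUp_braExp (h0 : 0 + m < n) (t : Fin (m + 1) →₀ ℕ) :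
    shiftUp j (braExp h0 t) = braExp h t := by
  ext a
  by_cases ha : a ∈ Set.range (windowEmb h)
  · have h1 := (mem_range_windowEmb h a).1 ha
    obtain ⟨b, rfl⟩ := ha
    have h2 : (⟨(windowEmb h b : Fin n) - j, (Nat.sub_le _ _).trans_lt (windowEmb h b).2⟩ : Fin n) =
        windowEmb h0 b := Fin.ext (by simp)
    rw [shiftUp_apply, if_pos h1.1, h2, braExp_windowEmb, braExp_windowEmb]
  · rw [braExp_of_notMem h t ha, shiftUp_apply]
    rw [mem_range_windowEmb] at ha
    split_ifs with h1
    · refine braExp_of_notMem h0 t ?_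
      rw [mem_range_windowEmb]
      simp
      omega
    · rfl

theorem degree_braExp (t : Fin (m + 1) →₀ ℕ) :
    (braExp h t).degree = (if m = 0 then 1 else 2) + t.degree := by
  have h1 : (t.embDomain (windowEmb h)).degree = t.degree := by
    rw [Finsupp.embDomain_eq_mapDomain, Finsupp.degree_mapDomain]
  rw [braExp, map_add, h1, endsExp]
  split_ifs
  · rw [Finsupp.degree_single]
  · rw [map_add, Finsupp.degree_single, Finsupp.degree_single]

/-- Every nonzero exponent is of the form `braExp`, for the window from its lowest to its highest
occurring index. -/
theorem exists_braExp {s : Fin n →₀ ℕ} (hs : s ≠ 0) :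
    ∃ (m : Fin n) (p : Fin (n - m)) (hpm : (p : ℕ) + m < n) (t : Fin ((m : ℕ) + 1) →₀ ℕ),
      braExp hpm t = s := by
  obtain ⟨k, l, hkl⟩ := exists_isBra hs
  have hle := Fin.le_def.1 hkl.le
  have hl := l.2
  refine ⟨⟨l - k, by omega⟩, ⟨k, by simp; omega⟩, by simp; omega, ?_⟩
  refine exists_braExp_eq _ ?_
  convert hkl
  simp
  omega

theorem pvar_of_lt {t : ℕ} (ht : t < n) : pvar n t = MvPowerSeries.X ⟨t, ht⟩ := dif_pos ht

theorem bracket_eq (F : MvPowerSeries (Fin (m + 1)) ℝ) :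
    bracket n j m F =
      MvPowerSeries.monomial (endsExp h) 1 * MvPowerSeries.rename (windowEmb h) F := by
  have hsub : (fun b : Fin (m + 1) => pvar n (j + b)) = MvPowerSeries.X ∘ windowEmb h :=
    funext fun b => pvar_of_lt _
  rw [bracket, hsub, ← MvPowerSeries.rename_eq_subst, endsExp, pvar_of_lt (by omega), pvar_of_lt h]
  congr 1
  split_ifs
  · rfl
  · rw [MvPowerSeries.X, MvPowerSeries.X, MvPowerSeries.monomial_mul_monomial, one_mul]

theorem coeff_braExp_bracket (F : MvPowerSeries (Fin (m + 1)) ℝ) (t : Fin (m + 1) →₀ ℕ) :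
    MvPowerSeries.coeff (braExp h t) (bracket n j m F) = MvPowerSeries.coeff t F := by
  rw [bracket_eq h, braExp, MvPowerSeries.coeff_add_monomial_mul, one_mul,
    MvPowerSeries.coeff_embDomain_rename]

theorem coeff_bracket_eq_zero (F : MvPowerSeries (Fin (m + 1)) ℝ) {s : Fin n →₀ ℕ}
    (hs : s ∉ Set.range (braExp h)) : MvPowerSeries.coeff s (bracket n j m F) = 0 := by
  classical
  rw [bracket_eq h, MvPowerSeries.coeff_monomial_mul]
  split_ifs with hle
  · rw [MvPowerSeries.coeff_rename_eq_zero, mul_zero]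
    rintro ⟨t, ht⟩
    refine hs ⟨t, ?_⟩
    rw [braExp, Finsupp.embDomain_eq_mapDomain, ht, add_tsub_cancel_of_le hle]
  · rfl

theorem constantCoeff_bracket {j m : ℕ} (h : j + m < n) (F : MvPowerSeries (Fin (m + 1)) ℝ) :
    MvPowerSeries.constantCoeff (bracket n j m F) = 0 := by
  rw [← MvPowerSeries.coeff_zero_eq_constantCoeff_apply]
  refine coeff_bracket_eq_zero h F ?_
  rintro ⟨t, ht⟩
  have := (isBra_braExp h t).1
  rw [ht] at this
  simp at this

theorem homPart_bracket_eq_sum (d : ℕ) (F : MvPowerSeries (Fin (m + 1)) ℝ) :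
    homPart d (bracket n j m F) =
      ∑ t ∈ (Finset.univ.finsuppAntidiag (d - if m = 0 then 1 else 2)).filter
          (fun t => (if m = 0 then 1 else 2) + t.degree = d),
        MvPowerSeries.coeff t F • homPart d (MvPowerSeries.monomial (braExp h t) (1 : ℝ)) := by
  classical
  refine homPart_ext fun s => ?_
  rw [AddSubmonoidClass.coe_finsetSum, MvPolynomial.coeff_sum, coeff_homPart]
  have hterm : ∀ t, MvPolynomial.coeff s ((MvPowerSeries.coeff t F •
      homPart d (MvPowerSeries.monomial (braExp h t) (1 : ℝ)) : P n d) : MvPolynomial (Fin n) ℝ) =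
      if s.degree = d ∧ s = braExp h t then MvPowerSeries.coeff t F else 0 := by
    intro t
    rw [Submodule.coe_smul, MvPolynomial.coeff_smul, coeff_homPart, MvPowerSeries.coeff_monomial]
    by_cases h1 : s.degree = d <;> by_cases h2 : s = braExp h t <;> simp [h1, h2]
  rw [Finset.sum_congr rfl fun t _ => hterm t]
  by_cases hs : s ∈ Set.range (braExp h)
  · obtain ⟨t, rfl⟩ := hs
    by_cases hd : (braExp h t).degree = d
    · rw [if_pos hd, Finset.sum_eq_single t, if_pos ⟨hd, rfl⟩, coeff_braExp_bracket]
      · intro t' _ hne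
        rw [if_neg]
        rintro ⟨-, h2⟩
        exact hne (braExp_injective h h2).symm
      · intro hnot
        rw [degree_braExp] at hd
        refine absurd ?_ hnot
        rw [Finset.mem_filter, Finset.mem_finsuppAntidiag]
        refine ⟨⟨?_, Finset.subset_univ _⟩, hd⟩
        have h3 : Finset.univ.sum t = t.degree := (Finsupp.degree_eq_sum t).symm
        split_ifs at hd ⊢ <;> omega
    · rw [if_neg hd]
      exact (Finset.sum_eq_zero fun t' _ => if_neg fun h2 => hd h2.1).symm
  · rw [coeff_bracket_eq_zero h F hs]
    simp only [ite_self]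
    exact (Finset.sum_eq_zero fun t' _ => if_neg fun h2 => hs ⟨t', h2.2.symm⟩).symm

/-- The homogeneous parts of the summands of a transvectant with coefficient function `F` arise from
the one with `j = 0` by applying powers of `S_N`. -/
theorem homPart_bracket {j m : ℕ} (h : j + m < n) (h0 : 0 + m < n) (d : ℕ)
    (F : MvPowerSeries (Fin (m + 1)) ℝ) :
    homPart d (bracket n j m F) = (SN n d ^ j) (homPart d (bracket n 0 m F)) := by
  rw [homPart_bracket_eq_sum h, homPart_bracket_eq_sum h0, map_sum]
  refine Finset.sum_congr rfl fun t ht => ?_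
  have hd := (Finset.mem_filter.1 ht).2
  rw [map_smul]
  congr 1
  apply Subtype.ext
  rw [SN_pow_monomial (isBra_braExp h0 t) (homPart_monomial ((degree_braExp h0 t).trans hd)),
    homPart_monomial ((degree_braExp h t).trans hd), if_pos (by simp; omega), shiftUp_braExp h]

theorem homPart_bracket_mem_braSpan [NeZero n] (m : Fin n) (d : ℕ)
    (F : MvPowerSeries (Fin ((m : ℕ) + 1)) ℝ) : homPart d (bracket n 0 m F) ∈ braSpan n d 0 m := by
  have h0 : 0 + (m : ℕ) < n := by simp
  rw [homPart_bracket_eq_sum h0]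
  refine Submodule.sum_mem _ fun t ht => Submodule.smul_mem _ _ (Submodule.subset_span ?_)
  refine ⟨braExp h0 t, ?_, homPart_monomial ((degree_braExp h0 t).trans (Finset.mem_filter.1 ht).2)⟩
  convert isBra_braExp h0 t using 1
  all_goals exact Fin.ext (by simp)

end Bracket

/-! ### The formal normal form -/

section NormalForm

variable {n : ℕ}

theorem transvectantSum_apply
    (F : ∀ m : Fin n, Fin (n - m) → MvPowerSeries (Fin ((m : ℕ) + 1)) ℝ) (c : Fin n) :
    transvectantSum n F c = ∑ m : Fin n, ∑ p : Fin (n - m),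
      ∑ ij ∈ Finset.HasAntidiagonal.antidiagonal (p : ℕ),
        if (c : ℕ) + ij.1 + 1 = n then
          transvCoeff (n - 1) (n - 1 - m) ij.1 ij.2 • bracket n ij.2 m (F m p) else 0 := by
  rw [transvectantSum]
  refine Finset.sum_congr rfl fun m _ => Finset.sum_congr rfl fun p _ =>
    Finset.sum_congr rfl fun ij hij => ?_
  rw [Finset.HasAntidiagonal.mem_antidiagonal] at hij
  rw [transvCoeff, hij]

/-- In each degree the sum of transvectants is a combination of transvectants. -/
theorem homPart_transvectantSum [NeZero n] (d : ℕ)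
    (F : ∀ m : Fin n, Fin (n - m) → MvPowerSeries (Fin ((m : ℕ) + 1)) ℝ) :
    (fun c => homPart d (transvectantSum n F c)) =
      ∑ m : Fin n, ∑ p : Fin (n - m), transv m p (homPart d (bracket n 0 m (F m p))) := by
  funext c
  rw [transvectantSum_apply, ← homPartHom_apply]
  simp only [map_sum, Finset.sum_apply, transv_eq]
  refine Finset.sum_congr rfl fun m _ => Finset.sum_congr rfl fun p _ =>
    Finset.sum_congr rfl fun ij hij => ?_
  rw [Finset.HasAntidiagonal.mem_antidiagonal] at hij
  have hp := p.2
  rw [Pi.smul_apply, tens_ket_apply]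
  split_ifs
  · have h1 : ij.2 + (m : ℕ) < n := by omega
    rw [map_smul, homPartHom_apply, homPart_bracket h1 (by omega)]
  · rw [map_zero, smul_zero]

theorem homPart_transvectantSum_mem_ker [NeZero n] (d : ℕ)
    (F : ∀ m : Fin n, Fin (n - m) → MvPowerSeries (Fin ((m : ℕ) + 1)) ℝ) :
    DMbar n d (fun c => homPart d (transvectantSum n F c)) = 0 := by
  rw [homPart_transvectantSum, map_sum]
  refine Finset.sum_eq_zero fun m _ => ?_
  rw [map_sum]
  exact Finset.sum_eq_zero fun p _ => DMbar_transv (homPart_bracket_mem_braSpan m d _) p.2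

theorem constantCoeff_transvectantSum
    (F : ∀ m : Fin n, Fin (n - m) → MvPowerSeries (Fin ((m : ℕ) + 1)) ℝ) (c : Fin n) :
    MvPowerSeries.constantCoeff (transvectantSum n F c) = 0 := by
  rw [transvectantSum_apply]
  simp only [map_sum]
  refine Finset.sum_eq_zero fun m _ => Finset.sum_eq_zero fun p _ =>
    Finset.sum_eq_zero fun ij hij => ?_
  rw [Finset.HasAntidiagonal.mem_antidiagonal] at hij
  have hp := p.2
  split_ifs
  · have h1 : ij.2 + (m : ℕ) < n := by omega
    rw [MvPowerSeries.smul_eq_C_mul, map_mul, constantCoeff_bracket h1, mul_zero]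
  · rw [map_zero]

/-- The last component of the sum of transvectants sorts the monomials by the window of variables
which they occupy. -/
theorem coeff_last_transvectantSum {c : Fin n} (hc : (c : ℕ) + 1 = n)
    (F : ∀ m : Fin n, Fin (n - m) → MvPowerSeries (Fin ((m : ℕ) + 1)) ℝ) (m : Fin n)
    (p : Fin (n - m)) (h : (p : ℕ) + m < n) (t : Fin ((m : ℕ) + 1) →₀ ℕ) :
    MvPowerSeries.coeff (braExp h t) (transvectantSum n F c) =
      transvCoeff (n - 1) (n - 1 - m) 0 p * MvPowerSeries.coeff t (F m p) := by
  have hsum : transvectantSum n F c = ∑ m : Fin n, ∑ p : Fin (n - m),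
      transvCoeff (n - 1) (n - 1 - m) 0 p • bracket n p m (F m p) := by
    rw [transvectantSum_apply]
    refine Finset.sum_congr rfl fun m _ => Finset.sum_congr rfl fun p _ => ?_
    rw [Finset.sum_eq_single (0, (p : ℕ))]
    · rw [if_pos (by simpa using hc)]
    · rintro ⟨i, j⟩ hij hne
      rw [Finset.HasAntidiagonal.mem_antidiagonal] at hij
      simp only at hij
      rw [if_neg]
      intro hi
      simp only at hi
      have hi0 : i = 0 := by omega
      exact hne (by rw [← hij, hi0, zero_add])
    · intro h
      exact absurd (by simp) h
  have hother : ∀ (m' : Fin n) (p' : Fin (n - m')), ¬ (m' = m ∧ (p' : ℕ) = p) →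
      MvPowerSeries.coeff (braExp h t) (bracket n p' m' (F m' p')) = 0 := by
    intro m' p' hne
    have hp' := p'.2
    refine coeff_bracket_eq_zero (by omega) _ ?_
    rintro ⟨t', ht'⟩
    have h1 := isBra_braExp (n := n) (j := p') (m := m') (by omega) t'
    rw [ht'] at h1
    obtain ⟨h2, h3⟩ := h1.unique (isBra_braExp h t)
    simp at h2 h3
    exact hne ⟨Fin.ext (by omega), h2⟩
  rw [hsum, map_sum, Finset.sum_eq_single m, map_sum, Finset.sum_eq_single p,
    MvPowerSeries.coeff_smul, coeff_braExp_bracket]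
  · intro p' _ hne
    rw [MvPowerSeries.coeff_smul, hother, mul_zero]
    exact fun h => hne (Fin.ext h.2)
  · simp
  · intro m' _ hne
    rw [map_sum]
    refine Finset.sum_eq_zero fun p' _ => ?_
    rw [MvPowerSeries.coeff_smul, hother, mul_zero]
    exact fun h => hne h.1
  · simp

/-- Every power series without constant term is the last component of a sum of transvectants. -/
theorem exists_last_transvectantSum_eq {c : Fin n} (hc : (c : ℕ) + 1 = n)
    {g : MvPowerSeries (Fin n) ℝ} (hg : MvPowerSeries.constantCoeff g = 0) :
    ∃ F, transvectantSum n F c = g := by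
  have hpm : ∀ (m : Fin n) (p : Fin (n - m)), (p : ℕ) + m < n := fun m p => by
    have := p.2
    omega
  obtain ⟨F, hF⟩ : ∃ F : ∀ m : Fin n, Fin (n - m) → MvPowerSeries (Fin ((m : ℕ) + 1)) ℝ,
      ∀ m p t, MvPowerSeries.coeff t (F m p) = (transvCoeff (n - 1) (n - 1 - m) 0 p)⁻¹ *
        MvPowerSeries.coeff (braExp (hpm m p) t) g :=
    ⟨fun m p => show (Fin ((m : ℕ) + 1) →₀ ℕ) → ℝ from
      fun t => (transvCoeff (n - 1) (n - 1 - m) 0 p)⁻¹ *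
        MvPowerSeries.coeff (braExp (hpm m p) t) g, fun _ _ _ => rfl⟩
  refine ⟨F, ?_⟩
  ext s
  by_cases hs : s = 0
  · subst hs
    rw [MvPowerSeries.coeff_zero_eq_constantCoeff_apply,
      MvPowerSeries.coeff_zero_eq_constantCoeff_apply, constantCoeff_transvectantSum, hg]
  · obtain ⟨m, p, h, t, rfl⟩ := exists_braExp hs
    rw [coeff_last_transvectantSum hc, hF]
    exact mul_inv_cancel_left₀ (transvCoeff_ne_zero (Nat.zero_le _) (by omega)) _

variable [NeZero n]

/-- A formal map without constant terms which lies in `ker Δ_M̄` in each degree is determined by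
its last component. -/
theorem eq_of_last_eq {r r' : Fin n → MvPowerSeries (Fin n) ℝ}
    (h0 : ∀ c, MvPowerSeries.constantCoeff (r c) = MvPowerSeries.constantCoeff (r' c))
    (hr : ∀ d, 1 ≤ d → DMbar n d (fun c => homPart d (r c)) = 0)
    (hr' : ∀ d, 1 ≤ d → DMbar n d (fun c => homPart d (r' c)) = 0)
    (hlast : ∀ c : Fin n, (c : ℕ) + 1 = n → r c = r' c) : r = r' := by
  funext c
  refine powerSeries_ext (h0 c) fun d hd => ?_
  have h : (fun c => homPart d (r c)) - (fun c => homPart d (r' c)) = 0 := by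
    refine eq_zero_of_lastComp_eq_zero ?_ ?_
    · rw [map_sub, hr d hd, hr' d hd, sub_zero]
    · have := NeZero.pos n
      rw [lastComp, LinearMap.proj_apply, Pi.sub_apply, hlast _ (by simp; omega), sub_self]
  exact congrFun (sub_eq_zero.1 h) c

theorem transvectantSum_injective {F F' : ∀ m : Fin n, Fin (n - m) →
      MvPowerSeries (Fin ((m : ℕ) + 1)) ℝ} (h : transvectantSum n F = transvectantSum n F') :
    F = F' := by
  funext m p
  ext t
  have hp := p.2
  have hn := NeZero.pos n
  have h1 := coeff_last_transvectantSum (c := ⟨n - 1, by omega⟩) (by simp; omega) F m p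
    (by omega) t
  have h2 := coeff_last_transvectantSum (c := ⟨n - 1, by omega⟩) (by simp; omega) F' m p
    (by omega) t
  rw [h, h2] at h1
  exact (mul_left_cancel₀ (transvCoeff_ne_zero (Nat.zero_le _) (by omega)) h1).symm

/-- The constant terms which are forbidden are those which would give linear terms. -/
theorem homPart_one_transvectantSum_iff
    (F : ∀ m : Fin n, Fin (n - m) → MvPowerSeries (Fin ((m : ℕ) + 1)) ℝ) :
    (∀ c, homPart 1 (transvectantSum n F c) = 0) ↔
      ∀ (m : Fin n) (p : Fin (n - m)), (m : ℕ) = 0 →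
        MvPowerSeries.constantCoeff (F m p) = 0 := by
  have hn := NeZero.pos n
  have hc : ((⟨n - 1, by omega⟩ : Fin n) : ℕ) + 1 = n := by simp; omega
  constructor
  · intro h m p hm
    have hp := p.2
    have hpm : (p : ℕ) + m < n := by omega
    have h1 := coeff_eq_zero_of_homPart (h ⟨n - 1, by omega⟩) (s := braExp hpm 0)
      (by simp [degree_braExp, hm])
    rw [coeff_last_transvectantSum hc] at h1
    have h2 := (mul_eq_zero.1 h1).resolve_left
      (transvCoeff_ne_zero (Nat.zero_le _) (by omega))
    rwa [MvPowerSeries.coeff_zero_eq_constantCoeff_apply] at h2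
  · intro h
    refine congrFun (eq_zero_of_lastComp_eq_zero (homPart_transvectantSum_mem_ker 1 F) ?_)
    rw [lastComp, LinearMap.proj_apply]
    refine homPart_ext fun s => ?_
    rw [coeff_homPart]
    split_ifs with hs
    · have hs0 : s ≠ 0 := by
        rintro rfl
        simp at hs
      obtain ⟨m, p, hpm, t, rfl⟩ := exists_braExp hs0
      rw [degree_braExp] at hs
      have hm : (m : ℕ) = 0 := by
        by_contra hm
        rw [if_neg hm] at hs
        omega
      rw [if_pos hm] at hs
      have ht : t = 0 := (Finsupp.degree_eq_zero_iff t).1 (by omega)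
      rw [coeff_last_transvectantSum hc, ht, MvPowerSeries.coeff_zero_eq_constantCoeff_apply,
        h m p hm, mul_zero]
      rfl
    · rfl

theorem isNormalForm_kerDelta_iff (f : Fin n → MvPowerSeries (Fin n) ℝ) :
    IsNormalForm (jordanN n) (kerDeltaStyle n) f ↔
      ∃! F : ∀ m : Fin n, Fin (n - m) → MvPowerSeries (Fin ((m : ℕ) + 1)) ℝ,
        (∀ (m : Fin n) (p : Fin (n - m)), (m : ℕ) = 0 →
          MvPowerSeries.constantCoeff (F m p) = 0) ∧
        f = linMap (jordanN n) + transvectantSum n F := by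
  have hK : ∀ d, 2 ≤ d → IsCompl (LinearMap.range (homOp (jordanN n) d)) (kerDeltaStyle n d) :=
    fun d hd => (isCompl_ker_DMbar_range_DN (by omega)).symm
  constructor
  · intro hf
    obtain ⟨r, rfl⟩ : ∃ r, f = linMap (jordanN n) + r := ⟨f - linMap (jordanN n), by simp⟩
    obtain ⟨h0, h1, h2⟩ := (isNormalForm_add_iff hK r).1 hf
    have hn := NeZero.pos n
    obtain ⟨F, hF⟩ := exists_last_transvectantSum_eq (c := ⟨n - 1, by omega⟩) (by simp; omega)
      (h0 ⟨n - 1, by omega⟩)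
    have hrF : r = transvectantSum n F := by
      refine eq_of_last_eq (fun c => ?_) (fun d hd => ?_)
        (fun d _ => homPart_transvectantSum_mem_ker d F) fun c hc => ?_
      · rw [h0, constantCoeff_transvectantSum]
      · rcases hd.lt_or_eq with hd | rfl
        · exact h2 d hd
        · have : (fun c => homPart 1 (r c)) = 0 := funext h1
          rw [this, map_zero]
      · have : c = ⟨n - 1, by omega⟩ := Fin.ext (by simp; omega)
        rw [this, hF]
    refine ⟨F, ⟨?_, by rw [hrF]⟩, ?_⟩
    · rw [← homPart_one_transvectantSum_iff, ← hrF]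
      exact h1
    · rintro F' ⟨-, hF'⟩
      exact transvectantSum_injective ((add_left_cancel hF').symm.trans hrF)
  · rintro ⟨F, ⟨hF, rfl⟩, -⟩
    exact (isNormalForm_add_iff hK _).2 ⟨constantCoeff_transvectantSum F,
      (homPart_one_transvectantSum_iff F).2 hF, fun d _ => homPart_transvectantSum_mem_ker d F⟩

theorem isNormalForm_kerMult_iff (f : Fin n → MvPowerSeries (Fin n) ℝ) :
    IsNormalForm (jordanN n) (kerMultStyle n) f ↔
      ∃! g : MvPowerSeries (Fin n) ℝ,
        MvPowerSeries.constantCoeff g = 0 ∧ homPart 1 g = 0 ∧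
        f = linMap (jordanN n) + (fun c : Fin n => if (c : ℕ) + 1 = n then g else 0) := by
  have hK : ∀ d, 2 ≤ d → IsCompl (LinearMap.range (homOp (jordanN n) d)) (kerMultStyle n d) :=
    fun d hd => (isCompl_ker_mult_range_DN (by omega)).symm
  have hn := NeZero.pos n
  have hc : ((⟨n - 1, by omega⟩ : Fin n) : ℕ) + 1 = n := by simp; omega
  constructor
  · intro hf
    obtain ⟨r, rfl⟩ : ∃ r, f = linMap (jordanN n) + r := ⟨f - linMap (jordanN n), by simp⟩
    obtain ⟨h0, h1, h2⟩ := (isNormalForm_add_iff hK r).1 hf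
    refine ⟨r ⟨n - 1, by omega⟩, ⟨h0 _, h1 _, ?_⟩, ?_⟩
    · congr 1
      funext c
      split_ifs with hcn
      · congr 1
        exact Fin.ext (by simp; omega)
      · refine powerSeries_ext ((h0 c).trans (map_zero _).symm) fun d hd => ?_
        rw [homPart_zero]
        rcases hd.lt_or_eq with hd | rfl
        · obtain ⟨w, hw⟩ := (mem_ker_mult_jordanM _).1 (h2 d hd)
          have := congrFun hw c
          rwa [tens_ket_apply, if_neg (by simpa using hcn)] at this
        · exact h1 c
    · rintro g ⟨-, -, hg⟩
      have := congrFun (add_left_cancel hg) ⟨n - 1, by omega⟩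
      rw [if_pos hc] at this
      exact this.symm
  · rintro ⟨g, ⟨hg0, hg1, rfl⟩, -⟩
    refine (isNormalForm_add_iff hK _).2 ⟨fun c => ?_, fun c => ?_, fun d _ => ?_⟩
    · split_ifs
      · exact hg0
      · exact map_zero _
    · split_ifs
      · exact hg1
      · exact homPart_zero 1
    · refine (mem_ker_mult_jordanM _).2 ⟨homPart d g, funext fun c => ?_⟩
      rw [tens_ket_apply, add_zero]
      split_ifs
      · rfl
      · exact homPart_zero d

end NormalForm

/-! ### Dimensions two and three -/

section LowDimension

theorem bracket_zero {n j : ℕ} (h : j < n) (F : MvPowerSeries (Fin 1) ℝ) :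
    bracket n j 0 F = MvPowerSeries.X ⟨j, h⟩ * MvPowerSeries.subst ![MvPowerSeries.X ⟨j, h⟩] F := by
  rw [bracket, if_pos rfl, pvar_of_lt h]
  congr 2
  funext b
  fin_cases b
  exact pvar_of_lt h

theorem bracket_one {n j : ℕ} (h : j + 1 < n) (F : MvPowerSeries (Fin 2) ℝ) :
    bracket n j 1 F = MvPowerSeries.X ⟨j, by omega⟩ * MvPowerSeries.X ⟨j + 1, h⟩ *
      MvPowerSeries.subst ![MvPowerSeries.X ⟨j, by omega⟩, MvPowerSeries.X ⟨j + 1, h⟩] F := by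
  rw [bracket, if_neg one_ne_zero, pvar_of_lt h, pvar_of_lt (show j < n by omega)]
  congr 2
  funext b
  fin_cases b
  · exact pvar_of_lt _
  · exact pvar_of_lt _

theorem bracket_two {n j : ℕ} (h : j + 2 < n) (F : MvPowerSeries (Fin 3) ℝ) :
    bracket n j 2 F = MvPowerSeries.X ⟨j, by omega⟩ * MvPowerSeries.X ⟨j + 2, h⟩ *
      MvPowerSeries.subst ![MvPowerSeries.X ⟨j, by omega⟩, MvPowerSeries.X ⟨j + 1, by omega⟩,
        MvPowerSeries.X ⟨j + 2, h⟩] F := by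
  rw [bracket, if_neg two_ne_zero, pvar_of_lt h, pvar_of_lt (show j < n by omega)]
  congr 2
  funext b
  fin_cases b
  · exact pvar_of_lt _
  · exact pvar_of_lt _
  · exact pvar_of_lt _

/-- Coefficient functions in dimension two, listed as `F₂⁰, F₁⁰, F₁¹`. -/
def coeffEquivTwo : (∀ m : Fin 2, Fin (2 - m) → MvPowerSeries (Fin ((m : ℕ) + 1)) ℝ) ≃
    MvPowerSeries (Fin 2) ℝ × MvPowerSeries (Fin 1) ℝ × MvPowerSeries (Fin 1) ℝ where
  toFun F := (F 1 (0 : Fin 1), F 0 (0 : Fin 2), F 0 (1 : Fin 2))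
  invFun G := fun m => match m with
    | 0 => ![G.2.1, G.2.2]
    | 1 => ![G.1]
  left_inv F := by
    funext m
    match m with
    | 0 =>
      funext (p : Fin 2)
      match p with
      | 0 => rfl
      | 1 => rfl
    | 1 =>
      funext (p : Fin 1)
      match p with
      | 0 => rfl
  right_inv G := rfl

theorem linMap_jordanN_two : linMap (jordanN 2) = ![MvPowerSeries.X 1, 0] := by
  funext c
  fin_cases c <;> simp [linMap, linForm_jordanN]

theorem transvectantSum_two
    (F : ∀ m : Fin 2, Fin (2 - m) → MvPowerSeries (Fin ((m : ℕ) + 1)) ℝ) (c : Fin 2) :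
    transvectantSum 2 F c =
      ((∑ ij ∈ Finset.HasAntidiagonal.antidiagonal 0, if (c : ℕ) + ij.1 + 1 = 2 then
          transvCoeff 1 1 ij.1 ij.2 • bracket 2 ij.2 0 (F 0 (0 : Fin 2)) else 0) +
        (∑ ij ∈ Finset.HasAntidiagonal.antidiagonal 1, if (c : ℕ) + ij.1 + 1 = 2 then
          transvCoeff 1 1 ij.1 ij.2 • bracket 2 ij.2 0 (F 0 (1 : Fin 2)) else 0)) +
      (∑ ij ∈ Finset.HasAntidiagonal.antidiagonal 0, if (c : ℕ) + ij.1 + 1 = 2 then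
          transvCoeff 1 0 ij.1 ij.2 • bracket 2 ij.2 1 (F 1 (0 : Fin 1)) else 0) := by
  rw [transvectantSum_apply, Fin.sum_univ_two]
  congr 1
  · exact Fin.sum_univ_two _
  · exact Fin.sum_univ_one _

theorem normalForm_two_eq (F : ∀ m : Fin 2, Fin (2 - m) → MvPowerSeries (Fin ((m : ℕ) + 1)) ℝ) :
    linMap (jordanN 2) + transvectantSum 2 F =
      let x : Fin 2 → MvPowerSeries (Fin 2) ℝ := MvPowerSeries.X
      let F20 := (coeffEquivTwo F).1
      let F10 := (coeffEquivTwo F).2.1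
      let F11 := (coeffEquivTwo F).2.2
      ![x 1, 0]
        + ![0, x 0 * x 1 * F20.subst ![x 0, x 1]]
        + ![0, x 0 * F10.subst ![x 0]]
        + ![x 0 * F11.subst ![x 0], x 1 * F11.subst ![x 1]] := by
  have h00 := bracket_zero (n := 2) (j := 0) (by omega)
  have h10 := bracket_zero (n := 2) (j := 1) (by omega)
  have h01 := bracket_one (n := 2) (j := 0) (by omega)
  have e20 : (coeffEquivTwo F).1 = F 1 (0 : Fin 1) := rfl
  have e10 : (coeffEquivTwo F).2.1 = F 0 (0 : Fin 2) := rfl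
  have e11 : (coeffEquivTwo F).2.2 = F 0 (1 : Fin 2) := rfl
  rw [linMap_jordanN_two, e20, e10, e11]
  funext c
  rw [Pi.add_apply, transvectantSum_two]
  fin_cases c
  · simp [transvCoeff, Finset.Nat.antidiagonal_succ, h00]
  · simp [transvCoeff, Finset.Nat.antidiagonal_succ, h00, h10, h01]
    ring

theorem isNormalForm_two_iff (f : Fin 2 → MvPowerSeries (Fin 2) ℝ) :
    IsNormalForm (jordanN 2) (kerDeltaStyle 2) f ↔
      ∃! F : MvPowerSeries (Fin 2) ℝ × MvPowerSeries (Fin 1) ℝ × MvPowerSeries (Fin 1) ℝ,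
        let x : Fin 2 → MvPowerSeries (Fin 2) ℝ := MvPowerSeries.X
        let F20 := F.1
        let F10 := F.2.1
        let F11 := F.2.2
        MvPowerSeries.constantCoeff F10 = 0 ∧ MvPowerSeries.constantCoeff F11 = 0 ∧
        f = ![x 1, 0]
          + ![0, x 0 * x 1 * F20.subst ![x 0, x 1]]
          + ![0, x 0 * F10.subst ![x 0]]
          + ![x 0 * F11.subst ![x 0], x 1 * F11.subst ![x 1]] := by
  rw [isNormalForm_kerDelta_iff]
  refine coeffEquivTwo.existsUnique_congr fun {F} => ?_
  rw [normalForm_two_eq]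
  simp only [← and_assoc]
  refine and_congr_left fun _ => ⟨fun h => ⟨h 0 (0 : Fin 2) rfl, h 0 (1 : Fin 2) rfl⟩, ?_⟩
  rintro ⟨h0, h1⟩ m p hm
  have : m = 0 := Fin.ext hm
  subst this
  revert p
  exact Fin.forall_fin_two.2 ⟨h0, h1⟩

/-- Every power series in `x₁, x₂` is `x₂ A(x₁, x₂) + B(x₁)` for unique `A`, `B`. -/
theorem bijective_split : Function.Bijective
    fun G : MvPowerSeries (Fin 2) ℝ × MvPowerSeries (Fin 1) ℝ =>
      MvPowerSeries.X 1 * G.1 +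
        MvPowerSeries.subst ![(MvPowerSeries.X 0 : MvPowerSeries (Fin 2) ℝ)] G.2 := by
  have h : 0 + 0 < 2 := by omega
  have hren : ∀ B : MvPowerSeries (Fin 1) ℝ,
      MvPowerSeries.subst ![(MvPowerSeries.X 0 : MvPowerSeries (Fin 2) ℝ)] B =
        MvPowerSeries.rename (windowEmb h) B := by
    intro B
    rw [MvPowerSeries.rename_eq_subst]
    congr 1
    funext b
    fin_cases b
    rfl
  have hwin : ∀ t : Fin 1 →₀ ℕ, t.embDomain (windowEmb h) 1 = 0 := fun t => by
    rw [Finsupp.embDomain_of_notMem_range]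
    rintro ⟨b, hb⟩
    have := congrArg Fin.val hb
    simp at this
  have hA : ∀ G : MvPowerSeries (Fin 2) ℝ × MvPowerSeries (Fin 1) ℝ, ∀ s,
      MvPowerSeries.coeff (Finsupp.single 1 1 + s)
        (MvPowerSeries.X 1 * G.1 + MvPowerSeries.rename (windowEmb h) G.2) =
          MvPowerSeries.coeff s G.1 := by
    intro G s
    rw [map_add, MvPowerSeries.X, MvPowerSeries.coeff_add_monomial_mul, one_mul,
      MvPowerSeries.coeff_rename_eq_zero, add_zero]
    rintro ⟨t, ht⟩
    have h1 := hwin t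
    rw [Finsupp.embDomain_eq_mapDomain, ht] at h1
    simp at h1
  have hB : ∀ G : MvPowerSeries (Fin 2) ℝ × MvPowerSeries (Fin 1) ℝ, ∀ t : Fin 1 →₀ ℕ,
      MvPowerSeries.coeff (t.embDomain (windowEmb h))
        (MvPowerSeries.X 1 * G.1 + MvPowerSeries.rename (windowEmb h) G.2) =
          MvPowerSeries.coeff t G.2 := by
    classical
    intro G t
    rw [map_add, MvPowerSeries.X, MvPowerSeries.coeff_monomial_mul, if_neg, zero_add,
      MvPowerSeries.coeff_embDomain_rename]
    intro hle
    have h1 := hle 1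
    rw [hwin] at h1
    simp at h1
  simp only [hren]
  refine ⟨fun G G' hG => ?_, fun q => ?_⟩
  · refine Prod.ext (MvPowerSeries.ext fun s => ?_) (MvPowerSeries.ext fun t => ?_)
    · rw [← hA G, ← hA G']
      exact congrArg _ hG
    · rw [← hB G, ← hB G']
      exact congrArg _ hG
  · obtain ⟨A, hA'⟩ : ∃ A : MvPowerSeries (Fin 2) ℝ, ∀ s, MvPowerSeries.coeff s A =
        MvPowerSeries.coeff (Finsupp.single 1 1 + s) q :=
      ⟨show (Fin 2 →₀ ℕ) → ℝ from fun s => MvPowerSeries.coeff (Finsupp.single 1 1 + s) q,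
        fun _ => rfl⟩
    obtain ⟨B, hB'⟩ : ∃ B : MvPowerSeries (Fin 1) ℝ, ∀ t, MvPowerSeries.coeff t B =
        MvPowerSeries.coeff (t.embDomain (windowEmb h)) q :=
      ⟨show (Fin 1 →₀ ℕ) → ℝ from fun t => MvPowerSeries.coeff (t.embDomain (windowEmb h)) q,
        fun _ => rfl⟩
    refine ⟨(A, B), MvPowerSeries.ext fun s => ?_⟩
    by_cases hs : s 1 = 0
    · have : s = (Finsupp.single 0 (s 0)).embDomain (windowEmb h) := by
        ext a
        fin_cases a
        · exact (Finsupp.embDomain_apply_self (windowEmb h) (Finsupp.single 0 (s 0)) 0).symm ▸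
            (Finsupp.single_eq_same).symm
        · exact hs.trans (hwin _).symm
      rw [this, hB (A, B), hB']
    · have : s = Finsupp.single 1 1 + (s - Finsupp.single 1 1) := by
        rw [add_tsub_cancel_of_le]
        exact Finsupp.single_le_iff.2 (Nat.pos_of_ne_zero hs)
      rw [this, hA (A, B), hA']

theorem isNormalForm_two_iff' (f : Fin 2 → MvPowerSeries (Fin 2) ℝ) :
    IsNormalForm (jordanN 2) (kerDeltaStyle 2) f ↔
      ∃! F : MvPowerSeries (Fin 2) ℝ × MvPowerSeries (Fin 1) ℝ,
        let x : Fin 2 → MvPowerSeries (Fin 2) ℝ := MvPowerSeries.X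
        let q := F.1
        let F11 := F.2
        MvPowerSeries.constantCoeff q = 0 ∧ MvPowerSeries.constantCoeff F11 = 0 ∧
        f = ![x 1, 0]
          + ![0, x 0 * q]
          + ![x 0 * F11.subst ![x 0], x 1 * F11.subst ![x 1]] := by
  rw [isNormalForm_two_iff]
  refine ((Equiv.prodAssoc _ _ _).symm.trans
    ((Equiv.ofBijective _ bijective_split).prodCongr (Equiv.refl _))).existsUnique_congr ?_
  rintro ⟨A, B, C⟩
  simp only [Equiv.trans_apply, Equiv.prodAssoc_symm_apply, Equiv.prodCongr_apply, Prod.map_apply,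
    Equiv.ofBijective_apply, Equiv.refl_apply]
  have hid : MvPowerSeries.subst ![(MvPowerSeries.X 0 : MvPowerSeries (Fin 2) ℝ),
      MvPowerSeries.X 1] A = A := by
    have : ![(MvPowerSeries.X 0 : MvPowerSeries (Fin 2) ℝ), MvPowerSeries.X 1] =
        MvPowerSeries.X := by
      funext c
      fin_cases c <;> rfl
    rw [this, MvPowerSeries.subst_self, id]
  have hconst : MvPowerSeries.constantCoeff
      (MvPowerSeries.subst ![(MvPowerSeries.X 0 : MvPowerSeries (Fin 2) ℝ)] B) =
      MvPowerSeries.constantCoeff B := by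
    have h : 0 + 0 < 2 := by omega
    have : ![(MvPowerSeries.X 0 : MvPowerSeries (Fin 2) ℝ)] =
        MvPowerSeries.X ∘ windowEmb h := by
      funext b
      fin_cases b
      rfl
    rw [this, ← MvPowerSeries.rename_eq_subst, MvPowerSeries.constantCoeff_rename]
  rw [hid, map_add, map_mul, MvPowerSeries.constantCoeff_X, zero_mul, zero_add, hconst]
  refine and_congr_right fun _ => and_congr_right fun _ => ?_
  refine Eq.congr_right ?_
  congr 1
  rw [add_assoc]
  congr 1
  funext c
  fin_cases c
  · simp
  · simp
    ring

/-- Coefficient functions in dimension three, listed as `F₃⁰, (F₂⁰, F₂¹), (F₁⁰, F₁¹, F₁²)`. In the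
last two the constant coefficient `1/2` of the transvectants is absorbed. -/
def coeffEquivThree : (∀ m : Fin 3, Fin (3 - m) → MvPowerSeries (Fin ((m : ℕ) + 1)) ℝ) ≃
    MvPowerSeries (Fin 3) ℝ × (MvPowerSeries (Fin 2) ℝ × MvPowerSeries (Fin 2) ℝ) ×
      (MvPowerSeries (Fin 1) ℝ × MvPowerSeries (Fin 1) ℝ × MvPowerSeries (Fin 1) ℝ) where
  toFun F := (F 2 (0 : Fin 1), (F 1 (0 : Fin 2), F 1 (1 : Fin 2)),
    (F 0 (0 : Fin 3), (1 / 2 : ℝ) • F 0 (1 : Fin 3), (1 / 2 : ℝ) • F 0 (2 : Fin 3)))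
  invFun G := fun m => match m with
    | 0 => ![G.2.2.1, (2 : ℝ) • G.2.2.2.1, (2 : ℝ) • G.2.2.2.2]
    | 1 => ![G.2.1.1, G.2.1.2]
    | 2 => ![G.1]
  left_inv F := by
    have h2 : ∀ A : MvPowerSeries (Fin 1) ℝ, (2 : ℝ) • (1 / 2 : ℝ) • A = A := fun A => by
      rw [smul_smul]
      norm_num
    funext m
    match m with
    | 0 =>
      funext (p : Fin 3)
      match p with
      | 0 => rfl
      | 1 => exact h2 _
      | 2 => exact h2 _
    | 1 =>
      funext (p : Fin 2)
      match p with
      | 0 => rfl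
      | 1 => rfl
    | 2 =>
      funext (p : Fin 1)
      match p with
      | 0 => rfl
  right_inv G := by
    have h2 : ∀ A : MvPowerSeries (Fin 1) ℝ, (1 / 2 : ℝ) • (2 : ℝ) • A = A := fun A => by
      rw [smul_smul]
      norm_num
    obtain ⟨A, ⟨B, C⟩, D, E, K⟩ := G
    exact congrArg₂ (fun E K => (A, (B, C), D, E, K)) (h2 E) (h2 K)

theorem linMap_jordanN_three :
    linMap (jordanN 3) = ![MvPowerSeries.X 1, MvPowerSeries.X 2, 0] := by
  funext c
  fin_cases c <;> simp [linMap, linForm_jordanN]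

theorem transvectantSum_three
    (F : ∀ m : Fin 3, Fin (3 - m) → MvPowerSeries (Fin ((m : ℕ) + 1)) ℝ) (c : Fin 3) :
    transvectantSum 3 F c =
      ((∑ ij ∈ Finset.HasAntidiagonal.antidiagonal 0, if (c : ℕ) + ij.1 + 1 = 3 then
          transvCoeff 2 2 ij.1 ij.2 • bracket 3 ij.2 0 (F 0 (0 : Fin 3)) else 0) +
        (∑ ij ∈ Finset.HasAntidiagonal.antidiagonal 1, if (c : ℕ) + ij.1 + 1 = 3 then
          transvCoeff 2 2 ij.1 ij.2 • bracket 3 ij.2 0 (F 0 (1 : Fin 3)) else 0) +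
        (∑ ij ∈ Finset.HasAntidiagonal.antidiagonal 2, if (c : ℕ) + ij.1 + 1 = 3 then
          transvCoeff 2 2 ij.1 ij.2 • bracket 3 ij.2 0 (F 0 (2 : Fin 3)) else 0)) +
      ((∑ ij ∈ Finset.HasAntidiagonal.antidiagonal 0, if (c : ℕ) + ij.1 + 1 = 3 then
          transvCoeff 2 1 ij.1 ij.2 • bracket 3 ij.2 1 (F 1 (0 : Fin 2)) else 0) +
        (∑ ij ∈ Finset.HasAntidiagonal.antidiagonal 1, if (c : ℕ) + ij.1 + 1 = 3 then
          transvCoeff 2 1 ij.1 ij.2 • bracket 3 ij.2 1 (F 1 (1 : Fin 2)) else 0)) +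
      (∑ ij ∈ Finset.HasAntidiagonal.antidiagonal 0, if (c : ℕ) + ij.1 + 1 = 3 then
          transvCoeff 2 0 ij.1 ij.2 • bracket 3 ij.2 2 (F 2 (0 : Fin 1)) else 0) := by
  rw [transvectantSum_apply, Fin.sum_univ_three]
  congr 1
  · congr 1
    · exact Fin.sum_univ_three _
    · exact Fin.sum_univ_two _
  · exact Fin.sum_univ_one _

theorem normalForm_three_eq
    (F : ∀ m : Fin 3, Fin (3 - m) → MvPowerSeries (Fin ((m : ℕ) + 1)) ℝ) :
    linMap (jordanN 3) + transvectantSum 3 F =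
      let x : Fin 3 → MvPowerSeries (Fin 3) ℝ := MvPowerSeries.X
      let F30 := (coeffEquivThree F).1
      let F20 := (coeffEquivThree F).2.1.1
      let F21 := (coeffEquivThree F).2.1.2
      let F10 := (coeffEquivThree F).2.2.1
      let F11 := (coeffEquivThree F).2.2.2.1
      let F12 := (coeffEquivThree F).2.2.2.2
      ![x 1, x 2, 0]
        + ![0, 0, x 0 * x 2 * F30.subst ![x 0, x 1, x 2]]
        + ![0, 0, x 0 * x 1 * F20.subst ![x 0, x 1]]
        + ![0, 0, x 0 * F10.subst ![x 0]]
        + ![0, (1 / 2 : ℝ) • (x 0 * x 1 * F21.subst ![x 0, x 1]),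
            x 1 * x 2 * F21.subst ![x 1, x 2]]
        + ![0, x 0 * F11.subst ![x 0], x 1 * F11.subst ![x 1]]
        + ![x 0 * F12.subst ![x 0], x 1 * F12.subst ![x 1], x 2 * F12.subst ![x 2]] := by
  have h00 := bracket_zero (n := 3) (j := 0) (by omega)
  have h10 := bracket_zero (n := 3) (j := 1) (by omega)
  have h20 := bracket_zero (n := 3) (j := 2) (by omega)
  have h01 := bracket_one (n := 3) (j := 0) (by omega)
  have h11 := bracket_one (n := 3) (j := 1) (by omega)
  have h02 := bracket_two (n := 3) (j := 0) (by omega)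
  have hsmul : ∀ (i : Fin 3) (a : ℝ) (A : MvPowerSeries (Fin 1) ℝ),
      MvPowerSeries.subst ![(MvPowerSeries.X i : MvPowerSeries (Fin 3) ℝ)] (a • A) =
        a • MvPowerSeries.subst ![(MvPowerSeries.X i : MvPowerSeries (Fin 3) ℝ)] A := fun i a A =>
    MvPowerSeries.subst_smul (MvPowerSeries.hasSubst_of_constantCoeff_zero fun b => by
      fin_cases b
      exact MvPowerSeries.constantCoeff_X i) a A
  have e30 : (coeffEquivThree F).1 = F 2 (0 : Fin 1) := rfl
  have e20 : (coeffEquivThree F).2.1.1 = F 1 (0 : Fin 2) := rfl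
  have e21 : (coeffEquivThree F).2.1.2 = F 1 (1 : Fin 2) := rfl
  have e10 : (coeffEquivThree F).2.2.1 = F 0 (0 : Fin 3) := rfl
  have e11 : (coeffEquivThree F).2.2.2.1 = (1 / 2 : ℝ) • F 0 (1 : Fin 3) := rfl
  have e12 : (coeffEquivThree F).2.2.2.2 = (1 / 2 : ℝ) • F 0 (2 : Fin 3) := rfl
  have c1 : transvCoeff 2 2 0 1 = 1 / 2 := by norm_num [transvCoeff]
  have c2 : transvCoeff 2 2 1 0 = 1 / 2 := by norm_num [transvCoeff]
  have c3 : transvCoeff 2 2 0 2 = 1 / 2 := by norm_num [transvCoeff]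
  have c4 : transvCoeff 2 2 1 1 = 1 / 2 := by norm_num [transvCoeff]
  have c5 : transvCoeff 2 2 2 0 = 1 / 2 := by norm_num [transvCoeff]
  have c6 : transvCoeff 2 1 0 1 = 1 := by norm_num [transvCoeff]
  have c7 : transvCoeff 2 1 1 0 = 1 / 2 := by norm_num [transvCoeff]
  have c8 : ∀ a b, transvCoeff a b 0 0 = 1 := fun a b => by simp [transvCoeff]
  rw [linMap_jordanN_three, e30, e20, e21, e10, e11, e12]
  funext c
  rw [Pi.add_apply, transvectantSum_three]
  fin_cases c
  · simp [c5, Finset.Nat.antidiagonal_succ, h00, hsmul]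
  · simp [c2, c4, c7, Finset.Nat.antidiagonal_succ, h00, h10, h01, hsmul]
    ring
  · simp [c1, c3, c6, c8, Finset.Nat.antidiagonal_succ, h00, h10, h20, h01, h11, h02, hsmul]
    ring

theorem isNormalForm_three_iff (f : Fin 3 → MvPowerSeries (Fin 3) ℝ) :
    IsNormalForm (jordanN 3) (kerDeltaStyle 3) f ↔
      ∃! F : MvPowerSeries (Fin 3) ℝ × (MvPowerSeries (Fin 2) ℝ × MvPowerSeries (Fin 2) ℝ) ×
          (MvPowerSeries (Fin 1) ℝ × MvPowerSeries (Fin 1) ℝ × MvPowerSeries (Fin 1) ℝ),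
        let x : Fin 3 → MvPowerSeries (Fin 3) ℝ := MvPowerSeries.X
        let F30 := F.1
        let F20 := F.2.1.1
        let F21 := F.2.1.2
        let F10 := F.2.2.1
        let F11 := F.2.2.2.1
        let F12 := F.2.2.2.2
        MvPowerSeries.constantCoeff F10 = 0 ∧ MvPowerSeries.constantCoeff F11 = 0 ∧
        MvPowerSeries.constantCoeff F12 = 0 ∧
        f = ![x 1, x 2, 0]
          + ![0, 0, x 0 * x 2 * F30.subst ![x 0, x 1, x 2]]
          + ![0, 0, x 0 * x 1 * F20.subst ![x 0, x 1]]
          + ![0, 0, x 0 * F10.subst ![x 0]]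
          + ![0, (1 / 2 : ℝ) • (x 0 * x 1 * F21.subst ![x 0, x 1]),
              x 1 * x 2 * F21.subst ![x 1, x 2]]
          + ![0, x 0 * F11.subst ![x 0], x 1 * F11.subst ![x 1]]
          + ![x 0 * F12.subst ![x 0], x 1 * F12.subst ![x 1], x 2 * F12.subst ![x 2]] := by
  rw [isNormalForm_kerDelta_iff]
  refine coeffEquivThree.existsUnique_congr fun {F} => ?_
  rw [normalForm_three_eq]
  simp only [← and_assoc]
  refine and_congr_left fun _ => ?_
  have hhalf : ∀ A : MvPowerSeries (Fin 1) ℝ,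
      MvPowerSeries.constantCoeff ((1 / 2 : ℝ) • A) = 0 ↔ MvPowerSeries.constantCoeff A = 0 :=
    fun A => by simp [MvPowerSeries.smul_eq_C_mul]
  have e1 := hhalf (F 0 (1 : Fin 3))
  have e2 := hhalf (F 0 (2 : Fin 3))
  constructor
  · intro h
    exact ⟨⟨h 0 (0 : Fin 3) rfl, e1.2 (h 0 (1 : Fin 3) rfl)⟩, e2.2 (h 0 (2 : Fin 3) rfl)⟩
  · rintro ⟨⟨h0, h1⟩, h2⟩ m p hm
    have : m = 0 := Fin.ext hm
    subst this
    change Fin 3 at p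
    match p with
    | 0 => exact h0
    | 1 => exact e1.1 h1
    | 2 => exact e2.1 h2

end LowDimension

end NilMap

end

theorem mainTheorem4 :
    (∀ (n : ℕ) [NeZero n],
      (∀ d : ℕ, 1 ≤ d →
        -- the operators form triples
        (Sl2Relations (SMbar n d) (SHbar n d) (SN n d) ∧
          Sl2Relations (barM n (jordanN n) (jordanM n)) (barH n (jordanN n) (jordanM n))
            (jordanN n) ∧
          Sl2Relations (DMbar n d) (DHbar n d) (DN n d)) ∧
        -- action of the substitution operators on monomials of type |k,l|
        (∀ (k l : Fin n) (s : Fin n →₀ ℕ), IsBra k l s →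
          ∀ w : P n d, (w : MvPolynomial (Fin n) ℝ) = MvPolynomial.monomial s 1 → ∀ j : ℕ,
            (((SN n d ^ j) w : P n d) : MvPolynomial (Fin n) ℝ) =
                (if (l : ℕ) + j < n then MvPolynomial.monomial (shiftUp j s) 1 else 0) ∧
            (((SM n d ^ j) w : P n d) : MvPolynomial (Fin n) ℝ) =
                (if j ≤ (k : ℕ) then MvPolynomial.monomial (shiftDown j s) 1 else 0)) ∧
        -- the kernel of S_M and the eigenvalues of S_H on it
        (LinearMap.ker (SMbar n d) = LinearMap.ker (SM n d) ∧
          IsDirectSum (fun m : Fin n => braSpan n d 0 m) (LinearMap.ker (SM n d)) ∧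
          ∀ m : Fin n, ∀ w ∈ braSpan n d 0 m,
            SHbar n d w = (((n - 1 - m : ℕ) : ℝ)) • w) ∧
        -- decomposition of the space into V_{k-1} ⊗ V_{n-1}, with k = n - m
        (IsSl2Irrep (Matrix.toLin' (barM n (jordanN n) (jordanM n)))
            (Matrix.toLin' (barH n (jordanN n) (jordanM n))) (Matrix.toLin' (jordanN n))
            (n - 1) ⊤ ∧
          (∀ (m : Fin n) (g : Gen n d m),
            IsSl2Irrep (SMbar n d) (SHbar n d) (SN n d) (n - 1 - m) (orbit (SN n d) g.poly)) ∧
          IsDirectSum (fun x : Σ m : Fin n, Gen n d m => orbit (SN n d) x.2.poly) ⊤ ∧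
          IsDirectSum (fun x : Σ m : Fin n, Gen n d m =>
            (Submodule.pi Set.univ (fun _ => orbit (SN n d) x.2.poly) :
              Submodule ℝ (VP n d))) ⊤) ∧
        -- Clebsch-Gordan decomposition of each summand and of the whole space
        ((∀ (m : Fin n) (g : Gen n d m),
            IsDirectSum (fun p : Fin (n - m) => orbit (DN n d) (transv m p g.poly))
              (Submodule.pi Set.univ (fun _ => orbit (SN n d) g.poly) :
                Submodule ℝ (VP n d)) ∧
            ∀ p : Fin (n - m),
              IsSl2Irrep (DMbar n d) (DHbar n d) (DN n d) ((n - 1 - m) + (n - 1) - 2 * p)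
                (orbit (DN n d) (transv m p g.poly))) ∧
          IsDirectSum (fun x : Σ m : Fin n, Gen n d m × Fin (n - m) =>
            orbit (DN n d) (transv x.1 x.2.2 x.2.1.poly)) ⊤) ∧
        -- transvectants: explicit formula, kernel, weight, and basis of the kernel
        ((∀ (m : Fin n), ∀ w ∈ braSpan n d 0 m, ∀ p : Fin (n - m),
            transv m p w = (∑ ij ∈ Finset.HasAntidiagonal.antidiagonal (p : ℕ),
              ((1 : ℝ) / ((ij.1)! * (ij.2)!) * (((p : ℕ).choose ij.1 : ℝ) /
                (((n - 1).choose ij.1 : ℝ) * ((n - 1 - m).choose ij.2 : ℝ)))) •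
                tens ((SN n d ^ ij.2) w) (ket n ij.1)) ∧
            DMbar n d (transv m p w) = 0 ∧
            DHbar n d (transv m p w) =
              (((n - 1 - m) + (n - 1) - 2 * p : ℕ) : ℝ) • transv m p w) ∧
          LinearIndependent ℝ (fun x : Σ m : Fin n, Gen n d m × Fin (n - m) =>
            transv x.1 x.2.2 x.2.1.poly) ∧
          Submodule.span ℝ (Set.range fun x : Σ m : Fin n, Gen n d m × Fin (n - m) =>
            transv x.1 x.2.2 x.2.1.poly) = LinearMap.ker (DMbar n d)) ∧
        -- the two styles, the projections onto them, and their equivalence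
        (∀ u : VP n d, u ∈ LinearMap.ker (mult (jordanM n) d) ↔ ∃ w, u = tens w (ket n 0)) ∧
        (∃ (hD : IsCompl (LinearMap.ker (DMbar n d)) (LinearMap.range (DN n d)))
            (hM : IsCompl (LinearMap.ker (mult (jordanM n) d))
              (LinearMap.range (mult (jordanN n) d))),
          IsCompl (LinearMap.ker (mult (jordanM n) d)) (LinearMap.range (DN n d)) ∧
          (∀ (m : Fin n), ∀ w ∈ braSpan n d 0 m, ∀ i j : ℕ, i ≤ n - 1 → j ≤ n - 1 - m →
            Submodule.projection _ _ hD (tens ((SN n d ^ j) w) (ket n i)) =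
              (((i + j)! * (n - 1).choose (i + j) * (n - 1 - m).choose (i + j) : ℝ) /
                ((n + (n - m) - (i + j) - 1).choose (i + j) : ℝ)) • transv m (i + j) w) ∧
          (∀ (m : Fin n), ∀ w ∈ braSpan n d 0 m, ∀ p : Fin (n - m),
            Submodule.projection _ _ hM (transv m p w) =
              (((n - 1 - m - p)! : ℝ) / ((n - 1 - m)! : ℝ)) •
                tens ((SN n d ^ (p : ℕ)) w) (ket n 0)) ∧
          Set.BijOn (Submodule.projection _ _ hM)
            (LinearMap.ker (DMbar n d)) (LinearMap.ker (mult (jordanM n) d)) ∧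
          Set.BijOn (Submodule.projection _ _ hD)
            (LinearMap.ker (mult (jordanM n) d)) (LinearMap.ker (DMbar n d)))) ∧
      -- the formal normal form in the two styles
      (∀ f : Fin n → MvPowerSeries (Fin n) ℝ,
        (IsNormalForm (jordanN n) (kerDeltaStyle n) f ↔
          ∃! F : ∀ m : Fin n, Fin (n - m) → MvPowerSeries (Fin ((m : ℕ) + 1)) ℝ,
            (∀ (m : Fin n) (p : Fin (n - m)), (m : ℕ) = 0 →
              MvPowerSeries.constantCoeff (F m p) = 0) ∧
            f = linMap (jordanN n) + transvectantSum n F) ∧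
        (IsNormalForm (jordanN n) (kerMultStyle n) f ↔
          ∃! g : MvPowerSeries (Fin n) ℝ,
            MvPowerSeries.constantCoeff g = 0 ∧ homPart 1 g = 0 ∧
            f = linMap (jordanN n) + (fun c : Fin n => if (c : ℕ) + 1 = n then g else 0)))) ∧
    -- the two-dimensional case
    (∀ f : Fin 2 → MvPowerSeries (Fin 2) ℝ,
      (IsNormalForm (jordanN 2) (kerDeltaStyle 2) f ↔
        ∃! F : MvPowerSeries (Fin 2) ℝ × MvPowerSeries (Fin 1) ℝ × MvPowerSeries (Fin 1) ℝ,
          let x : Fin 2 → MvPowerSeries (Fin 2) ℝ := MvPowerSeries.X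
          let F20 := F.1
          let F10 := F.2.1
          let F11 := F.2.2
          MvPowerSeries.constantCoeff F10 = 0 ∧ MvPowerSeries.constantCoeff F11 = 0 ∧
          f = ![x 1, 0]
            + ![0, x 0 * x 1 * F20.subst ![x 0, x 1]]
            + ![0, x 0 * F10.subst ![x 0]]
            + ![x 0 * F11.subst ![x 0], x 1 * F11.subst ![x 1]]) ∧
      (IsNormalForm (jordanN 2) (kerDeltaStyle 2) f ↔
        ∃! F : MvPowerSeries (Fin 2) ℝ × MvPowerSeries (Fin 1) ℝ,
          let x : Fin 2 → MvPowerSeries (Fin 2) ℝ := MvPowerSeries.X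
          let q := F.1
          let F11 := F.2
          MvPowerSeries.constantCoeff q = 0 ∧ MvPowerSeries.constantCoeff F11 = 0 ∧
          f = ![x 1, 0]
            + ![0, x 0 * q]
            + ![x 0 * F11.subst ![x 0], x 1 * F11.subst ![x 1]])) ∧
    -- the three-dimensional case
    (∀ f : Fin 3 → MvPowerSeries (Fin 3) ℝ,
      IsNormalForm (jordanN 3) (kerDeltaStyle 3) f ↔
        ∃! F : MvPowerSeries (Fin 3) ℝ × (MvPowerSeries (Fin 2) ℝ × MvPowerSeries (Fin 2) ℝ) ×
            (MvPowerSeries (Fin 1) ℝ × MvPowerSeries (Fin 1) ℝ × MvPowerSeries (Fin 1) ℝ),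
          let x : Fin 3 → MvPowerSeries (Fin 3) ℝ := MvPowerSeries.X
          let F30 := F.1
          let F20 := F.2.1.1
          let F21 := F.2.1.2
          let F10 := F.2.2.1
          let F11 := F.2.2.2.1
          let F12 := F.2.2.2.2
          MvPowerSeries.constantCoeff F10 = 0 ∧ MvPowerSeries.constantCoeff F11 = 0 ∧
          MvPowerSeries.constantCoeff F12 = 0 ∧
          f = ![x 1, x 2, 0]
            + ![0, 0, x 0 * x 2 * F30.subst ![x 0, x 1, x 2]]
            + ![0, 0, x 0 * x 1 * F20.subst ![x 0, x 1]]
            + ![0, 0, x 0 * F10.subst ![x 0]]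
            + ![0, (1 / 2 : ℝ) • (x 0 * x 1 * F21.subst ![x 0, x 1]),
                x 1 * x 2 * F21.subst ![x 1, x 2]]
            + ![0, x 0 * F11.subst ![x 0], x 1 * F11.subst ![x 1]]
            + ![x 0 * F12.subst ![x 0], x 1 * F12.subst ![x 1], x 2 * F12.subst ![x 2]]) := by
  refine ⟨fun n _ => ⟨fun d hd => ⟨⟨sl2Relations_subs hd, sl2Relations_jordan n,
    sl2Relations_homOp hd⟩, fun k l s hs w hw j => ⟨SN_pow_monomial hs hw j,
    SM_pow_monomial hs hw j⟩, ⟨(ker_SMbar hd).trans (ker_SM hd).symm, isDirectSum_braSpan hd,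
    fun m w hw => SHbar_braSpan hw⟩, ⟨isSl2Irrep_standard n,
    fun m g => isSl2Irrep_orbit_poly hd g, isDirectSum_orbit_poly hd, isDirectSum_pi_orbit hd⟩,
    ⟨fun m g => ⟨isDirectSum_orbit_transv hd m g, isSl2Irrep_orbit_transv hd m g⟩,
      isDirectSum_orbit_transvVec hd⟩,
    ⟨fun m w hw p => ⟨transv_eq_sum m p w, DMbar_transv hw p.2, DHbar_transv hw p.2⟩,
      linearIndependent_transvVec, span_transvVec hd⟩, mem_ker_mult_jordanM,
    isCompl_ker_DMbar_range_DN hd, isCompl_ker_mult_range_mult, isCompl_ker_mult_range_DN hd,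
    fun m w hw i j _ _ => projection_ker_DMbar hd _ hw i j,
    fun m w _ p => projection_ker_mult _ w p.2,
    bijOn_projection _ (isCompl_ker_DMbar_range_mult hd),
    bijOn_projection _ (isCompl_ker_mult_range_DN hd)⟩,
    fun f => ⟨isNormalForm_kerDelta_iff f, isNormalForm_kerMult_iff f⟩⟩,
    fun f => ⟨isNormalForm_two_iff f, isNormalForm_two_iff' f⟩, isNormalForm_three_iff⟩
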